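/- **Setting.** Let $m,n\ge 1$, $N=mn$, $A_{i\tau}\in\mathbb R^{d\times t}$, $\phi_{i\tau}:\mathbb R^t\to\mathbb R$ convex and $1/\gamma$-smooth ($\gamma>0$), and $g:\mathbb R^d\to\mathbb R$ $\lambda$-strongly convex ($\lambda>0$), for $i\in[m]$, $\tau\in[n]$. With $Y=(y_{i\tau})$, $y_{i\tau}\in\mathbb R^t$, let $$f(x,Y)=g(x)+\tfrac1N\sum_{\tau=1}^n\sum_{i=1}^m\big(\langle y_{i\tau},A_{i\tau}^\top x\rangle-\phi_{i\tau}^*(y_{i\tau})\big)\in[-\infty,\infty),$$ and let $(x^*,Y^*)$ be a saddle point of $\min_x\max_Y f(x,Y)$. Put $R_m=\max_{i,\tau}\|A_{i\tau}\|$, $\bar R^2=\max_\tau\frac1m\lambda_{\max}(\sum_iA_{i\tau}A_{i\tau}^\top)$, $R^2=\frac1N\lambda_{\max}(\sum_{\tau,i}A_{i\tau}A_{i\tau}^\top)$. Let $Q,Q_1$ be randomized maps of $\mathbb R^d$ that are contraction compressors with parameters $\delta,\delta_1\in(0,1]$: $\mathbb E\|x-Q(x)\|^2\le(1-\delta)\|x\|^2$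 and $\mathbb E\|x-Q_1(x)\|^2\le(1-\delta_1)\|x\|^2$ for all $x$. **Algorithm (ECSPDC)** with parameters $\sigma,\eta,\theta$. Start from deterministic $x^0=z^0$, $y^0_{i\tau}$, $h^0_\tau$, with $e^0_\tau=0$, $u^0_\tau=\frac1m\sum_iA_{i\tau}y^0_{i\tau}$. In iteration $k$, each node $\tau$ draws $i=i_k^\tau$ uniformly from $[m]$, sets $$y^{k+1}_{i\tau}=\arg\max_y\{\langle y,A_{i\tau}^\top z^k\rangle-\phi_{i\tau}^*(y)-\tfrac1{2\sigma}\|y-y^k_{i\tau}\|^2\},$$ keeps $y^{k+1}_{j\tau}=y^k_{j\tau}$ for $j\ne i_k^\tau$, and, with $a_\tau^k=A_{i\tau}(y^{k+1}_{i\tau}-y^k_{i\tau})$ for $i=i_k^\tau$, sets $\Delta^k_\tau=Q(a^k_\tau+u^k_\tau-h^k_\tau+e^k_\tau)$, $u^{k+1}_\tau=u^k_\tau+\frac1ma^k_\tau$, $h^{k+1}_\tau=h^k_\tau+Q_1(u^k_\tau-h^k_\tau)$, $e^{k+1}_\tau=e^k_\tau+a^k_\tau+u^k_\tau-h^k_\tau-\Delta^k_\tau$.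 Then, writing $v^k=\frac1n\sum_\tau v^k_\tau$ for $v\in\{u,h,e,\Delta\}$, $$x^{k+1}=\arg\min_x\{g(x)+\langle h^k+\Delta^k,x\rangle+\tfrac1{2\eta}\|x-x^k\|^2\},\qquad z^{k+1}=x^{k+1}+\theta(x^{k+1}-x^k).$$ The index draws and the randomness of the compressors are independent of each other, and both are independent across nodes and iterations ($Q$ and $Q_1$ may be coupled within one node and iteration). **Lyapunov functions.** Let $\tilde x^k=x^k-\eta e^k$, $D^k=\sum_{\tau,i}\|y^k_{i\tau}-y^*_{i\tau}\|^2$, $\eta'=\eta+\lambda\eta^2$ and $$G^k=f(x^k,Y^*)-f(x^*,Y^*)+m\big(f(x^*,Y^*)-f(x^*,Y^k)\big),$$ $$\Phi_2^k=\big(\tfrac1{2\eta}+\tfrac\lambda4\big)\|\tilde x^k-x^*\|^2+\big(\tfrac1{4\sigma}+\tfrac\gamma2\big)\tfrac1nD^k+\tfrac{3\eta'}{\delta n}\sum_\tau\|e^k_\tau\|^2+G^k+\tfrac{42(1-\delta)\eta'}{\delta^2\delta_1n}\sum_\tau\|h^k_\tau-u^k_\tau\|^2,$$ $$\Psi_2^k=\big(\tfrac1{2\eta}+\tfrac\lambda4\big)\|\tilde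 x^k-x^*\|^2+\big(\tfrac1{4\sigma}+\tfrac\gamma2\big)\tfrac1nD^k+G^k+\tfrac{3\eta'}{\delta}\|e^k\|^2+\tfrac{21(1-\delta)\eta'}{\delta n^2}\sum_\tau\|e^k_\tau\|^2+\tfrac{84(1-\delta)\eta'}{5\delta^2\delta_1}\|h^k-u^k\|^2+\tfrac{1512(1-\delta)\eta'}{5\delta^2\delta_1n^2}\sum_\tau\|h^k_\tau-u^k_\tau\|^2.$$ **Constants.** $$\mathcal R_2^2=2R^2+\tfrac{2R_m^2}n+\tfrac{3(1-\delta)}4\Big(\tfrac{14\bar R^2}{\delta^2}+\tfrac{7R_m^2}{2\delta}+\tfrac{84(1-\delta_1)\bar R^2}{\delta^2\delta_1^2m^2}+\tfrac{42R_m^2}{\delta^2\delta_1m^2}\Big),$$ $$\mathcal R_3^2=2R^2+\tfrac{2R_m^2}n+\tfrac{21(1-\delta)}4\Big(\tfrac{2R^2}{\delta^2}+\tfrac{11R_m^2}{2\delta n}+\tfrac{12(1-\delta)\bar R^2}{\delta^2n}+\tfrac{12R^2}{5\delta^2\delta_1^2m^2}+\tfrac{228R_m^2}{5\delta^2\delta_1m^2n}+\tfrac{432(1-\delta_1)\bar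 R^2}{5\delta^2\delta_1^2m^2n}\Big).$$ For $\mathcal R_1>0$ use the stepsizes $\sigma=\frac1{2\mathcal R_1}\sqrt{\frac{m\lambda}\gamma}$, $\eta=\frac1{2\mathcal R_1}\sqrt{\frac\gamma{m\lambda}}$, $\theta=1-\min\big\{\frac1{m+4\mathcal R_1\sqrt{m/(\lambda\gamma)}},\frac\delta6,\frac{\delta_1}6\big\}$. **Theorem.** There are an absolute constant $C>0$ and, for each $c>0$, a constant $K_c>0$ depending only on $c$, such that in every such setting the following hold. (i) Let $\mathcal R_1=\mathcal R_2$ and assume $\mathcal R_2^2/(\lambda\gamma)\ge1$. Then $\Phi_2^k$ is a random variable for every $k$, and for every $\epsilon>0$ $$\mathbb E[\Phi_2^k]\le\epsilon\Big(\Phi_2^0+\tfrac1{4\sigma n}D^0\Big)\quad\text{as long as}\quad k\ge C\Big(\tfrac1\delta+\tfrac1{\delta_1}+m+\mathcal R_2\sqrt{\tfrac m{\lambda\gamma}}\Big)\log\tfrac1\epsilon .$$ If moreover $\frac1m\le c\,\delta_1$, the same bound holds as long as $$k\ge K_c\Big(\Big(R+\tfrac{R_m}{\sqrt n}+\tfrac{\sqrt{1-\delta}\,\bar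 R}\delta+\tfrac{\sqrt{1-\delta}\,R_m}{\sqrt\delta}\Big)\sqrt{\tfrac m{\lambda\gamma}}+\tfrac1\delta+m\Big)\log\tfrac1\epsilon .$$ (ii) Let $\mathcal R_1=\mathcal R_3$, assume $\mathcal R_3^2/(\lambda\gamma)\ge1$ and that $\mathbb E[Q(x)]=\delta x$, $\mathbb E[Q_1(x)]=\delta_1x$ for all $x$. Then $\Psi_2^k$ is a random variable for every $k$, and for every $\epsilon>0$ $$\mathbb E[\Psi_2^k]\le\epsilon\Big(\Psi_2^0+\tfrac1{4\sigma n}D^0\Big)\quad\text{as long as}\quad k\ge C\Big(\tfrac1\delta+\tfrac1{\delta_1}+m+\mathcal R_3\sqrt{\tfrac m{\lambda\gamma}}\Big)\log\tfrac1\epsilon .$$ If moreover $\frac1m\le c\,\delta_1$, the same bound holds as long as $$k\ge K_c\Big(\Big(R+\tfrac{R_m}{\sqrt n}+\tfrac{\sqrt{1-\delta}\,R}\delta+\tfrac{\sqrt{1-\delta}\,R_m}{\sqrt{\delta n}}\Big)\sqrt{\tfrac m{\lambda\gamma}}+\tfrac1\delta+m\Big)\log\tfrac1\epsilon .$$ 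-/

import Mathlib

open MeasureTheory ProbabilityTheory
open scoped InnerProductSpace ENNReal

noncomputable section

namespace ECSPDC

/-- `ℝ^d` with its Euclidean norm. -/
abbrev Vec (d : ℕ) : Type := EuclideanSpace ℝ (Fin d)

/-- Largest eigenvalue of a (symmetric) operator on `ℝ^d`. -/
def lambdaMax {d : ℕ} (T : Vec d →L[ℝ] Vec d) : ℝ :=
  sSup {μ : ℝ | Module.End.HasEigenvalue (T : Vec d →ₗ[ℝ] Vec d) μ}

/-- Convex conjugate, with values in the extended reals. -/
def conj {t : ℕ} (φ : Vec t → ℝ) (y : Vec t) : EReal :=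
  ⨆ x : Vec t, ((⟪y, x⟫_ℝ - φ x : ℝ) : EReal)

/-- Data of the problem `min_x (1/N) ∑_τ ∑_i φ_{iτ}(A_{iτ}ᵀ x) + g x`, `N = m n`. The `d × t` matrix
`A_{iτ}` is given as a linear map `ℝ^t → ℝ^d`, and its transpose is the adjoint. -/
structure Problem (d t m n : ℕ) where
  A : Fin m → Fin n → (Vec t →L[ℝ] Vec d)
  φ : Fin m → Fin n → Vec t → ℝ
  g : Vec d → ℝ

namespace Problem

variable {d t m n : ℕ} (P : Problem d t m n)

/-- Each `φ_{iτ}` is convex and `1/γ`-smooth, and `g` is `lam`-strongly convex. -/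
structure Regular (γ lam : ℝ) : Prop where
  convex_φ : ∀ i τ, ConvexOn ℝ Set.univ (P.φ i τ)
  differentiable_φ : ∀ i τ, Differentiable ℝ (P.φ i τ)
  smooth_φ : ∀ i τ (v w : Vec t),
    ‖gradient (P.φ i τ) v - gradient (P.φ i τ) w‖ ≤ 1 / γ * ‖v - w‖
  strongConvex_g : StrongConvexOn Set.univ lam P.g

/-- The saddle function
`f(x, Y) = g x + (1/N) ∑_τ ∑_i (⟨y_{iτ}, A_{iτ}ᵀ x⟩ - φ_{iτ}^*(y_{iτ}))`, with values in `[-∞, ∞)`. -/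
def saddle (x : Vec d) (Y : Fin m → Fin n → Vec t) : EReal :=
  (P.g x : EReal) + ((1 / ((m : ℝ) * n) : ℝ) : EReal) *
    ∑ τ : Fin n, ∑ i : Fin m,
      (((⟪Y i τ, (P.A i τ).adjoint x⟫_ℝ : ℝ) : EReal) - conj (P.φ i τ) (Y i τ))

/-- `(xs, Ys)` solves `min_x max_Y f(x, Y)`. -/
def IsSaddlePoint (xs : Vec d) (Ys : Fin m → Fin n → Vec t) : Prop :=
  (∀ Y, P.saddle xs Y ≤ P.saddle xs Ys) ∧ (∀ x, P.saddle xs Ys ≤ P.saddle x Ys)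

/-- `R_m = max_{i,τ} ‖A_{iτ}‖`. -/
def Rm : ℝ := ⨆ p : Fin m × Fin n, ‖P.A p.1 p.2‖

/-- `R̄² = max_τ (1/m) λ_max (∑_i A_{iτ} A_{iτ}ᵀ)`. -/
def RbarSq : ℝ :=
  ⨆ τ : Fin n, 1 / (m : ℝ) * lambdaMax (∑ i : Fin m, (P.A i τ) ∘L (P.A i τ).adjoint)

/-- `R² = (1/N) λ_max (∑_τ ∑_i A_{iτ} A_{iτ}ᵀ)`. -/
def RSq : ℝ :=
  1 / ((m : ℝ) * n) * lambdaMax (∑ τ : Fin n, ∑ i : Fin m, (P.A i τ) ∘L (P.A i τ).adjoint)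

/-- The constant `𝓡₂²`. -/
def R2Sq (δ δ₁ : ℝ) : ℝ :=
  2 * P.RSq + 2 * P.Rm ^ 2 / n + 3 * (1 - δ) / 4 *
    (14 * P.RbarSq / δ ^ 2 + 7 * P.Rm ^ 2 / (2 * δ)
      + 84 * (1 - δ₁) * P.RbarSq / (δ ^ 2 * δ₁ ^ 2 * (m : ℝ) ^ 2)
      + 42 * P.Rm ^ 2 / (δ ^ 2 * δ₁ * (m : ℝ) ^ 2))

/-- The constant `𝓡₃²`. -/
def R3Sq (δ δ₁ : ℝ) : ℝ :=
  2 * P.RSq + 2 * P.Rm ^ 2 / n + 21 * (1 - δ) / 4 *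
    (2 * P.RSq / δ ^ 2 + 11 * P.Rm ^ 2 / (2 * δ * n)
      + 12 * (1 - δ) * P.RbarSq / (δ ^ 2 * n)
      + 12 * P.RSq / (5 * δ ^ 2 * δ₁ ^ 2 * (m : ℝ) ^ 2)
      + 228 * P.Rm ^ 2 / (5 * δ ^ 2 * δ₁ * (m : ℝ) ^ 2 * n)
      + 432 * (1 - δ₁) * P.RbarSq / (5 * δ ^ 2 * δ₁ ^ 2 * (m : ℝ) ^ 2 * n))

end Problem

/-- The stepsize `σ = (1/(2 r)) √(m lam / γ)`, where `r` stands for `𝓡₁`. -/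
def sigma (m : ℕ) (γ lam r : ℝ) : ℝ := 1 / (2 * r) * √(m * lam / γ)

/-- The stepsize `η = (1/(2 r)) √(γ / (m lam))`. -/
def eta (m : ℕ) (γ lam r : ℝ) : ℝ := 1 / (2 * r) * √(γ / (m * lam))

/-- `θ = 1 - min {1/(m + 4 r √(m/(lam γ))), δ/6, δ₁/6}`. -/
def theta (m : ℕ) (γ lam δ δ₁ r : ℝ) : ℝ :=
  1 - min (1 / (m + 4 * r * √(m / (lam * γ)))) (min (δ / 6) (δ₁ / 6))

section Compressors

variable {S : Type*} [MeasurableSpace S] {d : ℕ}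

/-- A randomized map on `ℝ^d` is a jointly measurable `Q : S → ℝ^d → ℝ^d` together with the law `ν`
of its random seed. It is a contraction compressor with parameter `δ ∈ (0, 1]` if
`E ‖x - Q(x)‖² ≤ (1 - δ) ‖x‖²` for all `x`. -/
structure IsContractionCompressor (ν : Measure S) (Q : S → Vec d → Vec d) (δ : ℝ) : Prop where
  measurable : Measurable (fun p : S × Vec d => Q p.1 p.2)
  pos : 0 < δ
  le_one : δ ≤ 1
  contraction : ∀ x : Vec d,
    ∫⁻ s, ENNReal.ofReal (‖x - Q s x‖ ^ 2) ∂ν ≤ ENNReal.ofReal ((1 - δ) * ‖x‖ ^ 2)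

/-- `E[Q(x)] = δ x` for all `x`. -/
def ScalesInMean (ν : Measure S) (Q : S → Vec d → Vec d) (δ : ℝ) : Prop :=
  ∀ x : Vec d, ∫ s, Q s x ∂ν = δ • x

end Compressors

/-- The randomness of the algorithm. In iteration `k`, node `τ` draws an index `ι k τ` uniformly from
`[m]` and, independently, a seed `ξ k τ` with law `ν` for its two compressors; draws at different
nodes or iterations are independent. (One seed may drive both compressors, so their joint law at a
node is arbitrary; independent compressors are the case of a product seed.) -/
structure IsSampling {Ω S : Type*} [MeasurableSpace Ω] [MeasurableSpace S] {m n : ℕ}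
    (μ : Measure Ω) (ν : Measure S) (ι : ℕ → Fin n → Ω → Fin m) (ξ : ℕ → Fin n → Ω → S) :
    Prop where
  measurable_index : ∀ k τ, Measurable (ι k τ)
  measurable_seed : ∀ k τ, Measurable (ξ k τ)
  law : ∀ k τ, μ.map (fun ω => (ι k τ ω, ξ k τ ω)) =
    (uniformOn (Set.univ : Set (Fin m))).prod ν
  indep : iIndepFun (fun (p : ℕ × Fin n) ω => (ι p.1 p.2 ω, ξ p.1 p.2 ω)) μ

/-- The variables `x^k, z^k, y_{iτ}^k, u_τ^k, h_τ^k, e_τ^k` at one iteration. -/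
structure State (d t m n : ℕ) where
  x : Vec d
  z : Vec d
  y : Fin m → Fin n → Vec t
  u : Fin n → Vec d
  h : Fin n → Vec d
  e : Fin n → Vec d

/-- Average over the `n` nodes. -/
def avg {d n : ℕ} (v : Fin n → Vec d) : Vec d := (1 / (n : ℝ)) • ∑ τ : Fin n, v τ

namespace Problem

variable {d t m n : ℕ} (P : Problem d t m n)

/-- The initial state: `x^0 = z^0`, `e_τ^0 = 0`, `u_τ^0 = (1/m) ∑_i A_{iτ} y_{iτ}^0`. -/
def init (x0 : Vec d) (y0 : Fin m → Fin n → Vec t) (h0 : Fin n → Vec d) : State d t m n where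
  x := x0
  z := x0
  y := y0
  u := fun τ => (1 / (m : ℝ)) • ∑ i : Fin m, P.A i τ (y0 i τ)
  h := h0
  e := fun _ => 0

/-- `A_{i_k^τ τ} (y_{i_k^τ τ}^{k+1} - y_{i_k^τ τ}^k)`, for states `s`, `s'` at times `k`, `k+1`. -/
def incr (idx : Fin n → Fin m) (s s' : State d t m n) (τ : Fin n) : Vec d :=
  P.A (idx τ) τ (s'.y (idx τ) τ - s.y (idx τ) τ)

/-- The vector to which node `τ` applies `Q`. -/
def message (idx : Fin n → Fin m) (s s' : State d t m n) (τ : Fin n) : Vec d :=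
  P.incr idx s s' τ + s.u τ - s.h τ + s.e τ

/-- One iteration of ECSPDC from `s` to `s'`, with sampled indices `idx` and seeds `sd`. -/
structure Step {S : Type*} (Q Q₁ : S → Vec d → Vec d) (σ η θ : ℝ)
    (idx : Fin n → Fin m) (sd : Fin n → S) (s s' : State d t m n) : Prop where
  y_sampled : ∀ τ, IsMaxOn
    (fun y : Vec t =>
      ((⟪y, (P.A (idx τ) τ).adjoint s.z⟫_ℝ - 1 / (2 * σ) * ‖y - s.y (idx τ) τ‖ ^ 2 : ℝ) : EReal)
        - conj (P.φ (idx τ) τ) y)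
    Set.univ (s'.y (idx τ) τ)
  y_other : ∀ τ i, i ≠ idx τ → s'.y i τ = s.y i τ
  u_step : ∀ τ, s'.u τ = s.u τ + (1 / (m : ℝ)) • P.incr idx s s' τ
  h_step : ∀ τ, s'.h τ = s.h τ + Q₁ (sd τ) (s.u τ - s.h τ)
  e_step : ∀ τ, s'.e τ = P.message idx s s' τ - Q (sd τ) (P.message idx s s' τ)
  x_step : IsMinOn
    (fun x : Vec d =>
      P.g x + ⟪avg s.h + avg (fun τ => Q (sd τ) (P.message idx s s' τ)), x⟫_ℝ
        + ‖x - s.x‖ ^ 2 / (2 * η))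
    Set.univ s'.x
  z_step : s'.z = s'.x + θ • (s'.x - s.x)

/-- `s` is a trajectory of ECSPDC started at `s0`, driven by the indices `ι` and the seeds `ξ`. -/
structure IsRun {Ω S : Type*} (Q Q₁ : S → Vec d → Vec d) (σ η θ : ℝ)
    (ι : ℕ → Fin n → Ω → Fin m) (ξ : ℕ → Fin n → Ω → S)
    (s0 : State d t m n) (s : ℕ → Ω → State d t m n) : Prop where
  start : ∀ ω, s 0 ω = s0
  step : ∀ k ω, P.Step Q Q₁ σ η θ (fun τ => ι k τ ω) (fun τ => ξ k τ ω) (s k ω) (s (k + 1) ω)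

/-- `f(x, Y*) - f(x*, Y*) + m (f(x*, Y*) - f(x*, Y))`. -/
def gap (xs : Vec d) (Ys : Fin m → Fin n → Vec t) (s : State d t m n) : EReal :=
  (P.saddle s.x Ys - P.saddle xs Ys) + (m : EReal) * (P.saddle xs Ys - P.saddle xs s.y)

/-- `∑_τ ∑_i ‖y_{iτ} - y_{iτ}*‖²`. -/
def dualDist (Ys : Fin m → Fin n → Vec t) (s : State d t m n) : ℝ :=
  ∑ τ : Fin n, ∑ i : Fin m, ‖s.y i τ - Ys i τ‖ ^ 2

/-- The Lyapunov function `Φ₂`; here `x̃ = x - η e`. -/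
def Phi2 (γ lam δ δ₁ σ η : ℝ) (xs : Vec d) (Ys : Fin m → Fin n → Vec t)
    (s : State d t m n) : EReal :=
  (((1 / (2 * η) + lam / 4) * ‖s.x - η • avg s.e - xs‖ ^ 2
      + (1 / (4 * σ) + γ / 2) * (1 / n) * dualDist Ys s
      + 3 * (η + lam * η ^ 2) / (δ * n) * ∑ τ : Fin n, ‖s.e τ‖ ^ 2
      + 42 * (1 - δ) * (η + lam * η ^ 2) / (δ ^ 2 * δ₁ * n)
          * ∑ τ : Fin n, ‖s.h τ - s.u τ‖ ^ 2 : ℝ) : EReal)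
    + P.gap xs Ys s

/-- The Lyapunov function `Ψ₂`. -/
def Psi2 (γ lam δ δ₁ σ η : ℝ) (xs : Vec d) (Ys : Fin m → Fin n → Vec t)
    (s : State d t m n) : EReal :=
  (((1 / (2 * η) + lam / 4) * ‖s.x - η • avg s.e - xs‖ ^ 2
      + (1 / (4 * σ) + γ / 2) * (1 / n) * dualDist Ys s
      + 3 * (η + lam * η ^ 2) / δ * ‖avg s.e‖ ^ 2
      + 21 * (1 - δ) * (η + lam * η ^ 2) / (δ * (n : ℝ) ^ 2) * ∑ τ : Fin n, ‖s.e τ‖ ^ 2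
      + 84 * (1 - δ) * (η + lam * η ^ 2) / (5 * δ ^ 2 * δ₁) * ‖avg s.h - avg s.u‖ ^ 2
      + 1512 * (1 - δ) * (η + lam * η ^ 2) / (5 * δ ^ 2 * δ₁ * (n : ℝ) ^ 2)
          * ∑ τ : Fin n, ‖s.h τ - s.u τ‖ ^ 2 : ℝ) : EReal)
    + P.gap xs Ys s

end Problem

/-- Expectation of an extended-real random variable, `E[F⁺] - E[F⁻]`. -/
def expect {Ω : Type*} [MeasurableSpace Ω] (μ : Measure Ω) (F : Ω → EReal) : EReal :=
  ((∫⁻ ω, (F ω).toENNReal ∂μ : ℝ≥0∞) : EReal) - ((∫⁻ ω, (-F ω).toENNReal ∂μ : ℝ≥0∞) : EReal)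

end ECSPDC

end

open ECSPDC

/-! ECSPDC is an inexact randomized primal-dual proximal method. The proof finds a function
`lyapunov` whose conditional expectation shrinks by the factor `θ` in every iteration
(`lintegral_lyapunov_next_le`), which dominates `Φ₂` or `Ψ₂`, and which exceeds it at the start by
exactly `D⁰/(4σn)`.

Error feedback. Since `Q(message) = message - e'`, the direction `h + Δ` equals `u + a + e - e'`
after averaging over nodes, where `a` is the average jump (`tilt_eq`); the shift `h` cancels. Hence
the virtual point `x - ηe` moves along the uncompressed direction `u + a`, and `perturbed_prox_le`
rewrites the proximal inequality for virtual points at a price of order `η(‖e‖² + ‖e'‖²)`.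

Primal-dual cancellation. Smoothness of `φ` makes its conjugate `γ`-strongly convex, so a dual
proximal step has quadratic growth (`growth_dual`). A block is updated with probability `1/m`; the
factor `m` on the dual gap turns the dual potential into a sum over blocks that can be averaged one
by one (`dual_drift`). The bilinear terms of the primal and dual inequalities cancel, except for the
product of `u` minus its optimal value with `x^k - x^{k-1}`. Extrapolation reproduces this product
with the factor `θ`, so it belongs to the Lyapunov function, together with `‖x^k - x^{k-1}‖²/(8η)`.
All remaining costs are multiples of `M`, the average squared length of the full dual move, and are
paid by the term `-M/(2σ)` of the dual step.

Compression. The error `e` and the lag `h - u` contract in mean square up to multiples of the jumps.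
Suitable weights combine them into one potential that decays by `θ` at a cost proportional to `M`
(`errPotential_drift`). If the compressors scale in mean, the node averages obey linear recursions
in expectation and the independent node fluctuations carry a factor `1/n`, which yields the better
constants of `errPotentialMean_drift`.

Stepsizes. `𝓡₂²` and `𝓡₃²` are `2R² + 2R_m²/n + (3/4)T`, with `T` the compression cost, which is
what closes the budget for `M` (`stepBounds`). When `1/m ≤ cδ₁`, the terms containing `δ₁` are
dominated by the others.

Probability. Proximal points are unique and Lipschitz in their data, so a run is the iteration of a
measurable map `next` fed with draws independent of the past. Integrals of nonnegative functions
then iterate without any integrability of the iterates. -/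

noncomputable section

namespace ECSPDC

/-! ### Proximal points of extended-valued strongly convex functions. -/

section Prox

variable {E : Type*} [NormedAddCommGroup E] [InnerProductSpace ℝ E]

/-- A closed proper `κ`-strongly convex function with values in `(-∞, ∞]` that is bounded below by
a linear function of the norm. -/
structure IsProxable (h : E → EReal) (κ : ℝ) : Prop where
  lsc : LowerSemicontinuous h
  lower : ∃ a b : ℝ, 0 ≤ b ∧ ∀ x, ((-a - b * ‖x‖ : ℝ) : EReal) ≤ h x
  proper : ∃ x, h x ≠ ⊤
  nonneg : 0 ≤ κ
  convex : StrongConvexOn {x | h x ≠ ⊤} κ (fun x => (h x).toReal)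

/-- The objective of a proximal step with linear tilt `p`, centre `c` and stepsize `η`. -/
def proxObj (h : E → EReal) (η : ℝ) (p c x : E) : EReal :=
  h x + ((⟪p, x⟫_ℝ + ‖x - c‖ ^ 2 / (2 * η) : ℝ) : EReal)

lemma IsProxable.ne_bot {h : E → EReal} {κ : ℝ} (hh : IsProxable h κ) (x : E) : h x ≠ ⊥ := by
  obtain ⟨a, b, -, hab⟩ := hh.lower
  exact ne_of_gt (lt_of_lt_of_le (EReal.bot_lt_coe _) (hab x))

lemma IsProxable.coe_toReal {h : E → EReal} {κ : ℝ} (hh : IsProxable h κ) {x : E}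
    (hx : h x ≠ ⊤) : ((h x).toReal : EReal) = h x :=
  EReal.coe_toReal hx (hh.ne_bot x)

lemma IsProxable.proxObj_eq {h : E → EReal} {κ : ℝ} (hh : IsProxable h κ) (η : ℝ) (p c : E) {x : E}
    (hx : h x ≠ ⊤) : proxObj h η p c x =
      (((h x).toReal + (⟪p, x⟫_ℝ + ‖x - c‖ ^ 2 / (2 * η)) : ℝ) : EReal) := by
  rw [proxObj, EReal.coe_add (h x).toReal, hh.coe_toReal hx]

lemma IsProxable.ne_top_of_isMinOn {h : E → EReal} {κ : ℝ} (hh : IsProxable h κ) {η : ℝ} {p c x : E}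
    (hx : IsMinOn (proxObj h η p c) Set.univ x) : h x ≠ ⊤ := by
  obtain ⟨y, hy⟩ := hh.proper
  intro htop
  have h1 : proxObj h η p c x ≤ proxObj h η p c y := hx (Set.mem_univ y)
  rw [hh.proxObj_eq η p c hy, proxObj, htop, EReal.top_add_coe] at h1
  exact EReal.coe_ne_top _ (top_le_iff.1 h1)

lemma norm_sq_combo (x y c : E) (t : ℝ) :
    ‖(1 - t) • x + t • y - c‖ ^ 2 =
      (1 - t) * ‖x - c‖ ^ 2 + t * ‖y - c‖ ^ 2 - t * (1 - t) * ‖x - y‖ ^ 2 := by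
  have e1 : (1 - t) • x + t • y - c = (1 - t) • (x - c) + t • (y - c) := by module
  have e2 : x - y = (x - c) - (y - c) := by abel
  rw [e1, e2, norm_add_sq_real, norm_sub_sq_real (x - c) (y - c), norm_smul, norm_smul,
    inner_smul_left, inner_smul_right, mul_pow, mul_pow]
  simp only [Real.norm_eq_abs, sq_abs, RCLike.conj_to_real]
  ring

/-- Quadratic growth at the minimizer of a proximal objective. -/
lemma IsProxable.growth {h : E → EReal} {κ : ℝ} (hh : IsProxable h κ) {η : ℝ} (hη : 0 < η)
    {p c x : E} (hx : IsMinOn (proxObj h η p c) Set.univ x) {y : E} (hy : h y ≠ ⊤) :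
    (h x).toReal + (⟪p, x⟫_ℝ + ‖x - c‖ ^ 2 / (2 * η)) + (κ / 2 + 1 / (2 * η)) * ‖x - y‖ ^ 2 ≤
      (h y).toReal + (⟪p, y⟫_ℝ + ‖y - c‖ ^ 2 / (2 * η)) := by
  have hx' := hh.ne_top_of_isMinOn hx
  have hC : 0 ≤ (κ / 2 + 1 / (2 * η)) * ‖x - y‖ ^ 2 := by
    have := hh.nonneg
    positivity
  set C := (κ / 2 + 1 / (2 * η)) * ‖x - y‖ ^ 2 with hCdef
  have key : ∀ t : ℝ, 0 < t → t < 1 →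
      (h x).toReal + (⟪p, x⟫_ℝ + ‖x - c‖ ^ 2 / (2 * η)) + (1 - t) * C ≤
      (h y).toReal + (⟪p, y⟫_ℝ + ‖y - c‖ ^ 2 / (2 * η)) := by
    intro t ht ht1
    have hconv := hh.convex
    have hz : h ((1 - t) • x + t • y) ≠ ⊤ :=
      hconv.1 hx' hy (by linarith) ht.le (by ring)
    have h2 := hconv.2 hx' hy (by linarith : 0 ≤ 1 - t) ht.le (by ring)
    have h1 : proxObj h η p c x ≤ proxObj h η p c ((1 - t) • x + t • y) := hx (Set.mem_univ _)
    rw [hh.proxObj_eq η p c hx', hh.proxObj_eq η p c hz, EReal.coe_le_coe_iff, norm_sq_combo,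
      inner_add_right, inner_smul_right, inner_smul_right] at h1
    simp only [smul_eq_mul] at h2
    have e : ((1 - t) * ‖x - c‖ ^ 2 + t * ‖y - c‖ ^ 2 - t * (1 - t) * ‖x - y‖ ^ 2) / (2 * η) =
      (1 - t) * (‖x - c‖ ^ 2 / (2 * η)) + t * (‖y - c‖ ^ 2 / (2 * η))
        - t * (1 - t) * (1 / (2 * η) * ‖x - y‖ ^ 2) := by ring
    rw [e] at h1
    have h3 : t * ((h x).toReal + (⟪p, x⟫_ℝ + ‖x - c‖ ^ 2 / (2 * η)) + (1 - t) * C) ≤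
      t * ((h y).toReal + (⟪p, y⟫_ℝ + ‖y - c‖ ^ 2 / (2 * η))) := by
      rw [hCdef]
      linarith
    exact le_of_mul_le_mul_left h3 ht
  by_contra hlt
  push Not at hlt
  set δ := (h x).toReal + (⟪p, x⟫_ℝ + ‖x - c‖ ^ 2 / (2 * η)) + C
    - ((h y).toReal + (⟪p, y⟫_ℝ + ‖y - c‖ ^ 2 / (2 * η))) with hδ
  have hδ0 : 0 < δ := by linarith
  -- This is the limit `t → 0` made explicit: the chosen `t` has `t * C ≤ δ / 2`, whereas a
  -- violation by `δ` would require `δ ≤ t * C`.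
  have hk := key (δ / (2 * (δ + C))) (by positivity)
    (by rw [div_lt_one (by positivity)]; linarith)
  have h5 : δ / (2 * (δ + C)) * C ≤ δ / 2 := by
    rw [div_mul_eq_mul_div, div_le_div_iff₀ (by positivity) (by positivity)]
    nlinarith
  linarith

/-- Far away the quadratic term beats the linear lower bound, so a minimizer over a large compact
ball, given by lower semicontinuity, is global. -/
lemma IsProxable.exists_isMinOn [FiniteDimensional ℝ E] {h : E → EReal} {κ : ℝ}
    (hh : IsProxable h κ) {η : ℝ} (hη : 0 < η) (p c : E) :
    ∃ x, IsMinOn (proxObj h η p c) Set.univ x := by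
  obtain ⟨a, b, hb, hab⟩ := hh.lower
  obtain ⟨x1, hx1⟩ := hh.proper
  have hlsc : LowerSemicontinuous (proxObj h η p c) := by
    refine LowerSemicontinuous.add' hh.lsc ?_ ?_
    · exact (continuous_coe_real_ereal.comp (by fun_prop)).lowerSemicontinuous
    · intro x
      exact EReal.continuousAt_add (Or.inr (EReal.coe_ne_bot _)) (Or.inl (hh.ne_bot x))
  set V := (h x1).toReal + (⟪p, x1⟫_ℝ + ‖x1 - c‖ ^ 2 / (2 * η)) with hV
  set B := b + ‖p‖ with hB
  have hB0 : 0 ≤ B := by positivity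
  set W := |V + a + B * ‖c‖| with hW
  -- Outside this ball `T = ‖y - c‖` is at least `2η(B + W) + 1`, so `T²/(2η) ≥ BT + WT`. Here `BT`
  -- absorbs the linear terms and `WT ≥ W` brings the value above the one at `x1`.
  set ρ := ‖c‖ + ‖x1‖ + 2 * η * (B + W) + 1 with hρ
  obtain ⟨x, -, hx⟩ := LowerSemicontinuousOn.exists_isMinOn (f := proxObj h η p c)
    (s := Metric.closedBall (0 : E) ρ) ⟨0, by simp; positivity⟩
    (isCompact_closedBall _ _) (hlsc.lowerSemicontinuousOn _)
  have hx1mem : x1 ∈ Metric.closedBall (0 : E) ρ := by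
    rw [mem_closedBall_zero_iff, hρ]
    have : 0 ≤ 2 * η * (B + W) := by positivity
    linarith [norm_nonneg c]
  refine ⟨x, fun y _ => ?_⟩
  by_cases hy : y ∈ Metric.closedBall (0 : E) ρ
  · exact hx hy
  have h1 : proxObj h η p c x ≤ V := by
    have := hx hx1mem
    rw [Set.mem_ofPred_eq, hh.proxObj_eq η p c hx1] at this
    exact this
  refine h1.trans ?_
  rw [mem_closedBall_zero_iff, not_le] at hy
  have hip : -(‖p‖ * ‖y‖) ≤ ⟪p, y⟫_ℝ := neg_le_of_abs_le (abs_real_inner_le_norm p y)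
  set T := ‖y - c‖ with hT
  have hyT : ‖y‖ ≤ T + ‖c‖ := by
    calc ‖y‖ = ‖(y - c) + c‖ := by simp
      _ ≤ _ := norm_add_le _ _
  have hT1 : 2 * η * (B + W) + 1 ≤ T := by linarith [norm_nonneg x1]
  have hW0 : 0 ≤ W := abs_nonneg _
  have hT2 : (B + W) * T ≤ T ^ 2 / (2 * η) := by
    rw [le_div_iff₀ (by positivity)]
    nlinarith [norm_nonneg (y - c)]
  have hT3 : W ≤ W * T ∨ T < 1 := by
    by_cases h1T : 1 ≤ T
    · left; nlinarith
    · right; linarith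
  have hT4 : 1 ≤ T := by
    have : 0 ≤ 2 * η * (B + W) := by positivity
    linarith
  have hWV : V + a + B * ‖c‖ ≤ W := le_abs_self _
  have hreal : V ≤ (-a - b * ‖y‖) + (⟪p, y⟫_ℝ + T ^ 2 / (2 * η)) := by
    have h6 : B * ‖y‖ ≤ B * (T + ‖c‖) := mul_le_mul_of_nonneg_left hyT hB0
    have h7 : B * ‖y‖ = b * ‖y‖ + ‖p‖ * ‖y‖ := by rw [hB]; ring
    have h8 : W ≤ W * T := by nlinarith
    nlinarith
  calc (V : EReal) ≤ ((-a - b * ‖y‖ : ℝ) : EReal) + ((⟪p, y⟫_ℝ + T ^ 2 / (2 * η) : ℝ) : EReal) := by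
        rw [← EReal.coe_add, EReal.coe_le_coe_iff]; exact hreal
    _ ≤ _ := add_le_add (hab y) le_rfl

/-- The proximal point is Lipschitz in the tilt and the centre. -/
lemma IsProxable.norm_sub_le {h : E → EReal} {κ : ℝ} (hh : IsProxable h κ) {η : ℝ} (hη : 0 < η)
    {p c x p' c' x' : E} (hx : IsMinOn (proxObj h η p c) Set.univ x)
    (hx' : IsMinOn (proxObj h η p' c') Set.univ x') :
    ‖x - x'‖ ≤ η * ‖p - p'‖ + ‖c - c'‖ := by
  have g1 := hh.growth hη hx (hh.ne_top_of_isMinOn hx')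
  have g2 := hh.growth hη hx' (hh.ne_top_of_isMinOn hx)
  rw [norm_sub_rev x' x] at g2
  have hκ : 0 ≤ κ / 2 * ‖x - x'‖ ^ 2 := by have := hh.nonneg; positivity
  have e1 : ‖x' - c‖ ^ 2 - ‖x' - c'‖ ^ 2 + ‖x - c'‖ ^ 2 - ‖x - c‖ ^ 2 =
      2 * ⟪c - c', x - x'⟫_ℝ := by
    simp only [norm_sub_sq_real, inner_sub_left, inner_sub_right, real_inner_comm]
    ring
  have e2 : ⟪p, x'⟫_ℝ - ⟪p', x'⟫_ℝ + ⟪p', x⟫_ℝ - ⟪p, x⟫_ℝ = -⟪p - p', x - x'⟫_ℝ := by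
    simp only [inner_sub_left, inner_sub_right]
    ring
  have hm : 1 / (2 * η) * ‖x - x'‖ ^ 2 * 2 ≤
      -⟪p - p', x - x'⟫_ℝ + 2 * ⟪c - c', x - x'⟫_ℝ / (2 * η) := by
    rw [← e1, ← e2, sub_div, add_div, sub_div]
    linarith
  have i1 := neg_le_of_abs_le (abs_real_inner_le_norm (p - p') (x - x'))
  have i2 := le_of_abs_le (abs_real_inner_le_norm (c - c') (x - x'))
  have hm2 : ‖x - x'‖ ^ 2 ≤ (η * ‖p - p'‖ + ‖c - c'‖) * ‖x - x'‖ := by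
    have h3 : ‖x - x'‖ ^ 2 = η * (1 / (2 * η) * ‖x - x'‖ ^ 2 * 2) := by field_simp
    have h4 : η * (-⟪p - p', x - x'⟫_ℝ + 2 * ⟪c - c', x - x'⟫_ℝ / (2 * η)) =
      η * -⟪p - p', x - x'⟫_ℝ + ⟪c - c', x - x'⟫_ℝ := by field_simp
    rw [h3]
    refine (mul_le_mul_of_nonneg_left hm hη.le).trans ?_
    rw [h4]
    nlinarith
  rcases (norm_nonneg (x - x')).eq_or_lt with h0 | h0
  · rw [← h0]; positivity
  · rw [pow_two] at hm2
    exact le_of_mul_le_mul_right hm2 h0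

open Classical in
/-- A minimizer of the proximal objective, if there is one. -/
def prox (h : E → EReal) (η : ℝ) (p c : E) : E :=
  if H : ∃ x, IsMinOn (proxObj h η p c) Set.univ x then H.choose else 0

lemma IsProxable.isMinOn_prox [FiniteDimensional ℝ E] {h : E → EReal} {κ : ℝ}
    (hh : IsProxable h κ) {η : ℝ} (hη : 0 < η) (p c : E) :
    IsMinOn (proxObj h η p c) Set.univ (prox h η p c) := by
  have H := hh.exists_isMinOn hη p c
  rw [prox, dif_pos H]
  exact H.choose_spec

/-- Equal data give distance zero in the Lipschitz estimate. This allows an argmin condition to be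
replaced by a function of its data. -/
lemma IsProxable.eq_prox [FiniteDimensional ℝ E] {h : E → EReal} {κ : ℝ}
    (hh : IsProxable h κ) {η : ℝ} (hη : 0 < η) {p c x : E}
    (hx : IsMinOn (proxObj h η p c) Set.univ x) : x = prox h η p c := by
  have := hh.norm_sub_le hη hx (hh.isMinOn_prox hη p c)
  simp only [sub_self, norm_zero, mul_zero, add_zero] at this
  exact sub_eq_zero.1 (norm_le_zero_iff.1 this)

lemma IsProxable.continuous_prox [FiniteDimensional ℝ E] {h : E → EReal} {κ : ℝ}
    (hh : IsProxable h κ) {η : ℝ} (hη : 0 < η) :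
    Continuous (fun q : E × E => prox h η q.1 q.2) := by
  refine (LipschitzWith.of_dist_le_mul (K := (η + 1).toNNReal) fun q q' => ?_).continuous
  rw [dist_eq_norm, Real.coe_toNNReal _ (by positivity)]
  refine (hh.norm_sub_le hη (hh.isMinOn_prox hη q.1 q.2) (hh.isMinOn_prox hη q'.1 q'.2)).trans ?_
  have h1 : ‖q.1 - q'.1‖ ≤ dist q q' := by rw [← dist_eq_norm]; exact le_max_left _ _
  have h2 : ‖q.2 - q'.2‖ ≤ dist q q' := by rw [← dist_eq_norm]; exact le_max_right _ _
  nlinarith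

/-- A finite strongly convex function on a finite-dimensional space. -/
lemma isProxable_coe [FiniteDimensional ℝ E] {g : E → ℝ} {κ : ℝ} (hκ : 0 ≤ κ)
    (hg : StrongConvexOn Set.univ κ g) : IsProxable (fun x => (g x : EReal)) κ := by
  have hconv : ConvexOn ℝ Set.univ g := hg.convexOn (fun r => by positivity)
  have hcont : Continuous g := by
    rw [← continuousOn_univ]
    exact hconv.continuousOn isOpen_univ
  refine ⟨(continuous_coe_real_ereal.comp hcont).lowerSemicontinuous, ?_, ⟨0, EReal.coe_ne_top _⟩, hκ,
    ?_⟩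
  -- The minimum over the unit ball controls all of space: outside the ball, convexity on the
  -- segment from `0` to `x` is compared with its point of norm one.
  · obtain ⟨z, -, hz⟩ := (isCompact_closedBall (0 : E) 1).exists_isMinOn ⟨0, by simp⟩
      hcont.continuousOn
    have hz0 : g z ≤ g 0 := hz (by simp)
    refine ⟨-g z, g 0 - g z, by linarith, fun x => ?_⟩
    rw [EReal.coe_le_coe_iff]
    by_cases hx : ‖x‖ ≤ 1
    · have : g z ≤ g x := hz (by simpa using hx)
      nlinarith [norm_nonneg x]
    · push Not at hx
      have hx0 : 0 < ‖x‖ := by linarith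
      have hi : 0 ≤ 1 - ‖x‖⁻¹ := by
        have := inv_le_one_of_one_le₀ hx.le
        linarith
      have h1 := hconv.2 (Set.mem_univ (0 : E)) (Set.mem_univ x) hi
        (inv_nonneg.2 hx0.le) (by ring)
      have h2 : g z ≤ g ((1 - ‖x‖⁻¹) • (0 : E) + ‖x‖⁻¹ • x) := hz (by
        simp [norm_smul, hx0.ne'])
      simp only [smul_eq_mul] at h1
      have h3 : g z * ‖x‖ ≤ (‖x‖ - 1) * g 0 + g x := by
        have := mul_le_mul_of_nonneg_right (h2.trans h1) hx0.le
        refine this.trans_eq ?_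
        field_simp
      nlinarith
  · have : {x : E | (g x : EReal) ≠ ⊤} = Set.univ := by ext; simp
    rw [this]
    simpa using hg

end Prox

/-! ### Conjugates of convex smooth functions. -/

section Conjugate

variable {t : ℕ} {φ : Vec t → ℝ} {γ : ℝ}

lemma inner_sub_le_conj (φ : Vec t → ℝ) (y x : Vec t) :
    ((⟪y, x⟫_ℝ - φ x : ℝ) : EReal) ≤ conj φ y :=
  le_iSup (fun x : Vec t => ((⟪y, x⟫_ℝ - φ x : ℝ) : EReal)) x

lemma conj_ne_bot (φ : Vec t → ℝ) (y : Vec t) : conj φ y ≠ ⊥ :=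
  ne_of_gt (lt_of_lt_of_le (EReal.bot_lt_coe _) (inner_sub_le_conj φ y 0))

lemma lowerSemicontinuous_conj (φ : Vec t → ℝ) : LowerSemicontinuous (conj φ) := by
  unfold conj
  refine lowerSemicontinuous_iSup fun x => ?_
  exact (continuous_coe_real_ereal.comp (by fun_prop)).lowerSemicontinuous

lemma hasDerivAt_comp_line (hφ : Differentiable ℝ φ) (w v : Vec t) (s : ℝ) :
    HasDerivAt (fun s : ℝ => φ (w + s • v)) ⟪gradient φ (w + s • v), v⟫_ℝ s := by
  have h1 : HasFDerivAt φ (InnerProductSpace.toDual ℝ (Vec t) (gradient φ (w + s • v)))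
      (w + s • v) := (hφ _).hasGradientAt.hasFDerivAt
  have h2 : HasDerivAt (fun s : ℝ => w + s • v) v s := by
    simpa using ((hasDerivAt_id s).smul_const v).const_add w
  exact h1.comp_hasDerivAt s h2

/-- The quadratic upper bound for a function with Lipschitz gradient. -/
lemma le_quadratic_of_lipschitz_gradient (hφ : Differentiable ℝ φ) {L : ℝ}
    (hL : ∀ v w : Vec t, ‖gradient φ v - gradient φ w‖ ≤ L * ‖v - w‖) (w v : Vec t) :
    φ (w + v) ≤ φ w + ⟪gradient φ w, v⟫_ℝ + L / 2 * ‖v‖ ^ 2 := by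
  set f : ℝ → ℝ := fun s => φ (w + s • v) - s * ⟪gradient φ w, v⟫_ℝ - L / 2 * ‖v‖ ^ 2 * s ^ 2 with hf
  have hd : ∀ s, HasDerivAt f (⟪gradient φ (w + s • v), v⟫_ℝ - 1 * ⟪gradient φ w, v⟫_ℝ
      - L / 2 * ‖v‖ ^ 2 * (2 * s)) s := by
    intro s
    have h3 : HasDerivAt (fun s : ℝ => s ^ 2) (2 * s) s := by simpa using hasDerivAt_pow 2 s
    exact ((hasDerivAt_comp_line hφ w v s).sub ((hasDerivAt_id s).mul_const _)).sub
      (h3.const_mul _)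
  have hanti : AntitoneOn f (Set.Icc 0 1) := by
    refine antitoneOn_of_deriv_nonpos (convex_Icc 0 1)
      (fun s _ => (hd s).continuousAt.continuousWithinAt)
      (fun s _ => (hd s).differentiableAt.differentiableWithinAt) fun s hs => ?_
    rw [interior_Icc] at hs
    rw [(hd s).deriv]
    have h1 : ⟪gradient φ (w + s • v) - gradient φ w, v⟫_ℝ ≤ L * (s * ‖v‖) * ‖v‖ := by
      refine (real_inner_le_norm _ _).trans ?_
      refine mul_le_mul_of_nonneg_right ?_ (norm_nonneg _)
      refine (hL _ _).trans_eq ?_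
      rw [add_sub_cancel_left, norm_smul, Real.norm_of_nonneg hs.1.le]
    rw [inner_sub_left] at h1
    nlinarith
  have := hanti (Set.left_mem_Icc.2 zero_le_one) (Set.right_mem_Icc.2 zero_le_one) zero_le_one
  simp only [hf, one_smul, zero_smul, add_zero] at this
  linarith

/-- The tangent inequality at `0` bounds every competitor in the supremum by `-φ 0`. This is the
source of finite conjugate values, both for properness and for the existence of a finite saddle
value. -/
lemma conj_gradient_zero_ne_top (hc : ConvexOn ℝ Set.univ φ) (hφ : Differentiable ℝ φ) :
    conj φ (gradient φ 0) ≠ ⊤ := by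
  refine ne_of_lt (lt_of_le_of_lt (iSup_le fun x => ?_) (EReal.coe_lt_top (-φ 0)))
  rw [EReal.coe_le_coe_iff]
  have hline : ConvexOn ℝ Set.univ (fun s : ℝ => φ (0 + s • x)) := by
    refine ⟨convex_univ, fun a _ b _ p q hp hq hpq => ?_⟩
    have := hc.2 (Set.mem_univ ((0 : Vec t) + a • x)) (Set.mem_univ ((0 : Vec t) + b • x)) hp hq hpq
    refine le_trans (le_of_eq ?_) this
    have e : (0 : Vec t) + (p • a + q • b) • x = p • (0 + a • x) + q • (0 + b • x) := by
      simp only [smul_eq_mul, zero_add]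
      module
    exact congrArg φ e
  have hder := hasDerivAt_comp_line hφ 0 x 0
  have := hline.le_slope_of_hasDerivAt (Set.mem_univ 0) (Set.mem_univ 1) zero_lt_one hder
  rw [slope_def_field] at this
  simp only [zero_smul, add_zero, one_smul, zero_add, sub_zero, div_one] at this
  linarith

/-- The conjugate of a convex `1/γ`-smooth function is closed, proper and `γ`-strongly convex. -/
lemma isProxable_conj (hγ : 0 < γ) (hc : ConvexOn ℝ Set.univ φ) (hφ : Differentiable ℝ φ)
    (hL : ∀ v w : Vec t, ‖gradient φ v - gradient φ w‖ ≤ 1 / γ * ‖v - w‖) :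
    IsProxable (conj φ) γ := by
  have key : ∀ (a b : Vec t), conj φ a ≠ ⊤ → conj φ b ≠ ⊤ → ∀ p q : ℝ, 0 ≤ p → 0 ≤ q → p + q = 1 →
      conj φ (p • a + q • b) ≤ ((p * (conj φ a).toReal + q * (conj φ b).toReal
        - p * q * (γ / 2 * ‖a - b‖ ^ 2) : ℝ) : EReal) := by
    intro a b ha hb p q hp hq hpq
    refine iSup_le fun x => ?_
    rw [EReal.coe_le_coe_iff]
    -- The conjugate at `a` and at `b` is tested at points shifted by `γq` and `-γp` along `a - b`.
    -- With weights `p` and `q` the gradient terms cancel, the inner products gain `γpq‖a - b‖²`,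
    -- and smoothness takes back half of it.
    have hx1 := inner_sub_le_conj φ a (x + (γ * q) • (a - b))
    have hx2 := inner_sub_le_conj φ b (x + (-(γ * p)) • (a - b))
    rw [← EReal.coe_toReal ha (conj_ne_bot φ a), EReal.coe_le_coe_iff] at hx1
    rw [← EReal.coe_toReal hb (conj_ne_bot φ b), EReal.coe_le_coe_iff] at hx2
    have s1 := le_quadratic_of_lipschitz_gradient hφ hL x ((γ * q) • (a - b))
    have s2 := le_quadratic_of_lipschitz_gradient hφ hL x ((-(γ * p)) • (a - b))
    simp only [inner_add_right, inner_smul_right, norm_smul, mul_pow, Real.norm_eq_abs, sq_abs]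
      at hx1 hx2 s1 s2
    have e3 : ‖a - b‖ ^ 2 = ⟪a, a - b⟫_ℝ - ⟪b, a - b⟫_ℝ := by
      rw [← inner_sub_left, real_inner_self_eq_norm_sq]
    rw [inner_add_left, inner_smul_left, inner_smul_left]
    simp only [RCLike.conj_to_real]
    set N := ‖a - b‖ ^ 2
    have t1 : 1 / γ / 2 * (γ ^ 2 * q ^ 2 * N) = γ / 2 * q ^ 2 * N := by field_simp
    have t2 : 1 / γ / 2 * ((-(γ * p)) ^ 2 * N) = γ / 2 * p ^ 2 * N := by field_simp
    rw [t1] at s1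
    rw [t2] at s2
    have u1 := mul_le_mul_of_nonneg_left (add_le_add hx1 s1) hp
    have u2 := mul_le_mul_of_nonneg_left (add_le_add hx2 s2) hq
    have hq' : q = 1 - p := by linarith
    subst hq'
    have e4 : ⟪b, a - b⟫_ℝ = ⟪a, a - b⟫_ℝ - N := by linarith
    rw [e4] at u2
    nlinarith
  refine ⟨lowerSemicontinuous_conj φ, ⟨φ 0, 0, le_rfl, fun y => ?_⟩,
    ⟨_, conj_gradient_zero_ne_top hc hφ⟩, hγ.le, ?_, ?_⟩
  · refine le_trans (le_of_eq ?_) (inner_sub_le_conj φ y 0)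
    simp
  · intro a ha b hb p q hp hq hpq
    exact ne_of_lt (lt_of_le_of_lt (key a b ha hb p q hp hq hpq) (EReal.coe_lt_top _))
  · intro a ha b hb p q hp hq hpq
    have := key a b ha hb p q hp hq hpq
    have hne := ne_of_lt (lt_of_le_of_lt this (EReal.coe_lt_top _))
    rw [← EReal.coe_toReal hne (conj_ne_bot _ _), EReal.coe_le_coe_iff] at this
    simpa [smul_eq_mul] using this

end Conjugate

/-! ### Largest eigenvalues of Gram operators as operator bounds. -/

section Spectral

variable {d : ℕ}

lemma bddAbove_eigenvalues (T : Vec d →L[ℝ] Vec d) :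
    BddAbove {μ : ℝ | Module.End.HasEigenvalue (T : Vec d →ₗ[ℝ] Vec d) μ} := by
  refine ⟨‖T‖, fun μ hμ => ?_⟩
  obtain ⟨v, hv⟩ := hμ.exists_hasEigenvector
  have h1 : T v = μ • v := hv.apply_eq_smul
  have h2 := T.le_opNorm v
  rw [h1, norm_smul] at h2
  exact (le_abs_self μ).trans (le_of_mul_le_mul_right h2 (norm_pos_iff.2 hv.2))

lemma inner_le_lambdaMax (T : Vec d →L[ℝ] Vec d) (hT : (T : Vec d →ₗ[ℝ] Vec d).IsSymmetric)
    (x : Vec d) : ⟪T x, x⟫_ℝ ≤ lambdaMax T * ‖x‖ ^ 2 := by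
  by_cases hx : x = 0
  · simp [hx]
  have : Nontrivial (Vec d) := ⟨x, 0, hx⟩
  have hev := hT.hasEigenvalue_iSup_of_finiteDimensional
  have hle := le_csSup (bddAbove_eigenvalues T) hev
  have hx2 : 0 < ‖x‖ ^ 2 := by positivity
  rw [← div_le_iff₀ hx2]
  refine le_trans ?_ hle
  have hb : BddAbove (Set.range fun y : {y : Vec d // y ≠ 0} =>
      RCLike.re ⟪(T : Vec d →ₗ[ℝ] Vec d) y, (y : Vec d)⟫_ℝ / ‖(y : Vec d)‖ ^ 2) := by
    refine ⟨‖T‖, ?_⟩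
    rintro _ ⟨y, rfl⟩
    have hy2 : 0 < ‖(y : Vec d)‖ ^ 2 := by have := norm_pos_iff.2 y.2; positivity
    rw [div_le_iff₀ hy2]
    refine (real_inner_le_norm (T (y : Vec d)) (y : Vec d)).trans ?_
    have := mul_le_mul_of_nonneg_right (T.le_opNorm y) (norm_nonneg (y : Vec d))
    exact this.trans_eq (by ring)
  exact le_ciSup hb (⟨x, hx⟩ : {y : Vec d // y ≠ 0})

lemma lambdaMax_le {T : Vec d →L[ℝ] Vec d} {c : ℝ} (hc : 0 ≤ c)
    (h : ∀ x, ⟪T x, x⟫_ℝ ≤ c * ‖x‖ ^ 2) : lambdaMax T ≤ c := by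
  refine Real.sSup_le (fun μ hμ => ?_) hc
  obtain ⟨v, hv⟩ := hμ.exists_hasEigenvector
  have h1 : T v = μ • v := hv.apply_eq_smul
  have h2 := h v
  rw [h1, inner_smul_left, real_inner_self_eq_norm_sq] at h2
  have : 0 < ‖v‖ ^ 2 := by have := norm_pos_iff.2 hv.2; positivity
  exact le_of_mul_le_mul_right h2 this

lemma lambdaMax_nonneg {T : Vec d →L[ℝ] Vec d} (h : ∀ x, 0 ≤ ⟪T x, x⟫_ℝ) : 0 ≤ lambdaMax T := by
  refine Real.sSup_nonneg fun μ hμ => ?_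
  obtain ⟨v, hv⟩ := hμ.exists_hasEigenvector
  have h1 : T v = μ • v := hv.apply_eq_smul
  have h2 := h v
  rw [h1, inner_smul_left, real_inner_self_eq_norm_sq] at h2
  have : 0 < ‖v‖ ^ 2 := by have := norm_pos_iff.2 hv.2; positivity
  exact nonneg_of_mul_nonneg_left h2 this

variable {t : ℕ} {κ : Type*} [Fintype κ] (A : κ → Vec t →L[ℝ] Vec d)

lemma inner_gram (x y : Vec d) : ⟪(∑ i, (A i) ∘L (A i).adjoint) x, y⟫_ℝ =
    ∑ i, ⟪(A i).adjoint x, (A i).adjoint y⟫_ℝ := by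
  rw [sum_apply, sum_inner]
  exact Finset.sum_congr rfl fun i _ => by
    rw [ContinuousLinearMap.comp_apply, ContinuousLinearMap.adjoint_inner_right]

lemma inner_gram_self (x : Vec d) : ⟪(∑ i, (A i) ∘L (A i).adjoint) x, x⟫_ℝ =
    ∑ i, ‖(A i).adjoint x‖ ^ 2 := by
  simp only [inner_gram, real_inner_self_eq_norm_sq]

lemma sum_norm_adjoint_sq_le (x : Vec d) : ∑ i, ‖(A i).adjoint x‖ ^ 2 ≤
    lambdaMax (∑ i, (A i) ∘L (A i).adjoint) * ‖x‖ ^ 2 := by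
  rw [← inner_gram_self]
  refine inner_le_lambdaMax _ (fun x y => ?_) x
  change ⟪(∑ i, (A i) ∘L (A i).adjoint) x, y⟫_ℝ = ⟪x, (∑ i, (A i) ∘L (A i).adjoint) y⟫_ℝ
  rw [inner_gram, real_inner_comm, inner_gram]
  exact Finset.sum_congr rfl fun i _ => real_inner_comm _ _

lemma lambdaMax_gram_nonneg : 0 ≤ lambdaMax (∑ i, (A i) ∘L (A i).adjoint) :=
  lambdaMax_nonneg fun x => by rw [inner_gram_self]; positivity

/-- For `x` the sum, `‖x‖² = ∑ ⟨v i, (A i)ᵀ x⟩`; Cauchy–Schwarz and the Gram bound give an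
inequality for `‖x‖⁴` from which one `‖x‖²` is cancelled. -/
lemma norm_sum_apply_sq_le (v : κ → Vec t) : ‖∑ i, A i (v i)‖ ^ 2 ≤
    lambdaMax (∑ i, (A i) ∘L (A i).adjoint) * ∑ i, ‖v i‖ ^ 2 := by
  set x := ∑ i, A i (v i) with hx
  have h1 : ‖x‖ ^ 2 = ∑ i, ⟪v i, (A i).adjoint x⟫_ℝ := by
    rw [← real_inner_self_eq_norm_sq]
    nth_rewrite 1 [hx]
    rw [sum_inner]
    exact Finset.sum_congr rfl fun i _ => (ContinuousLinearMap.adjoint_inner_right _ _ _).symm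
  have h2 : (‖x‖ ^ 2) ^ 2 ≤ (∑ i, ‖v i‖ ^ 2) * ∑ i, ‖(A i).adjoint x‖ ^ 2 := by
    refine le_trans ?_ (Finset.sum_mul_sq_le_sq_mul_sq _ _ _)
    refine pow_le_pow_left₀ (by positivity) ?_ 2
    rw [h1]
    exact Finset.sum_le_sum fun i _ => real_inner_le_norm _ _
  have h3 := h2.trans (mul_le_mul_of_nonneg_left (sum_norm_adjoint_sq_le A x)
    (Finset.sum_nonneg fun i _ => by positivity))
  rcases (sq_nonneg ‖x‖).eq_or_lt with h0 | h0
  · rw [← h0]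
    exact mul_nonneg (lambdaMax_gram_nonneg A) (Finset.sum_nonneg fun i _ => by positivity)
  · refine le_of_mul_le_mul_right ?_ h0
    nlinarith

lemma norm_sq_le_lambdaMax (i : κ) : ‖A i‖ ^ 2 ≤ lambdaMax (∑ i, (A i) ∘L (A i).adjoint) := by
  have h0 := lambdaMax_gram_nonneg A
  rw [← Real.le_sqrt (norm_nonneg _) h0, ← (ContinuousLinearMap.adjoint (𝕜 := ℝ)).norm_map (A i)]
  refine ContinuousLinearMap.opNorm_le_bound _ (Real.sqrt_nonneg _) fun x => ?_
  refine le_of_sq_le_sq ?_ (by positivity)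
  rw [mul_pow, Real.sq_sqrt h0]
  refine le_trans ?_ (sum_norm_adjoint_sq_le A x)
  exact Finset.single_le_sum (f := fun i => ‖(A i).adjoint x‖ ^ 2) (fun i _ => by positivity)
    (Finset.mem_univ i)

end Spectral

lemma coe_finset_sum {κ : Type*} (s : Finset κ) (f : κ → ℝ) :
    ((∑ i ∈ s, f i : ℝ) : EReal) = ∑ i ∈ s, (f i : EReal) := by
  classical
  induction s using Finset.induction_on with
  | empty => simp
  | insert a s ha ih => rw [Finset.sum_insert ha, Finset.sum_insert ha, EReal.coe_add, ih]

/-! ### The problem constants, and where the saddle function is finite. -/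

namespace Problem

variable {d t m n : ℕ} (P : Problem d t m n)

lemma norm_A_le (i : Fin m) (τ : Fin n) : ‖P.A i τ‖ ≤ P.Rm :=
  le_ciSup (f := fun p : Fin m × Fin n => ‖P.A p.1 p.2‖) (Set.finite_range _).bddAbove (i, τ)

lemma Rm_nonneg : 0 ≤ P.Rm := Real.iSup_nonneg fun _ => norm_nonneg _

lemma RbarSq_nonneg : 0 ≤ P.RbarSq :=
  Real.iSup_nonneg fun τ => mul_nonneg (by positivity) (lambdaMax_gram_nonneg _)

lemma gram_prod : (∑ τ : Fin n, ∑ i : Fin m, (P.A i τ) ∘L (P.A i τ).adjoint) =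
    ∑ q : Fin n × Fin m, (P.A q.2 q.1) ∘L (P.A q.2 q.1).adjoint := by
  rw [Fintype.sum_prod_type]

lemma RSq_nonneg : 0 ≤ P.RSq := by
  rw [RSq, gram_prod]
  exact mul_nonneg (by positivity) (lambdaMax_gram_nonneg _)

lemma le_RbarSq (τ : Fin n) :
    1 / (m : ℝ) * lambdaMax (∑ i : Fin m, (P.A i τ) ∘L (P.A i τ).adjoint) ≤ P.RbarSq :=
  le_ciSup (f := fun τ : Fin n =>
    1 / (m : ℝ) * lambdaMax (∑ i : Fin m, (P.A i τ) ∘L (P.A i τ).adjoint))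
    (Set.finite_range _).bddAbove τ

lemma norm_node_avg_sq_le (τ : Fin n) (v : Fin m → Vec t) :
    ‖(1 / (m : ℝ)) • ∑ i, P.A i τ (v i)‖ ^ 2 ≤ P.RbarSq * (1 / (m : ℝ) * ∑ i, ‖v i‖ ^ 2) := by
  rw [norm_smul, mul_pow, Real.norm_eq_abs, sq_abs]
  have h1 := norm_sum_apply_sq_le (fun i => P.A i τ) v
  have h2 := mul_le_mul_of_nonneg_left h1 (sq_nonneg (1 / (m : ℝ)))
  refine h2.trans ?_
  have h3 := mul_le_mul_of_nonneg_right (P.le_RbarSq τ)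
    (by positivity : 0 ≤ 1 / (m : ℝ) * ∑ i, ‖v i‖ ^ 2)
  refine le_trans (le_of_eq ?_) h3
  ring

lemma norm_total_avg_sq_le (v : Fin m → Fin n → Vec t) :
    ‖(1 / ((m : ℝ) * n)) • ∑ τ, ∑ i, P.A i τ (v i τ)‖ ^ 2 ≤
      P.RSq * (1 / ((m : ℝ) * n) * ∑ τ, ∑ i, ‖v i τ‖ ^ 2) := by
  rw [norm_smul, mul_pow, Real.norm_eq_abs, sq_abs]
  have h1 := norm_sum_apply_sq_le (fun q : Fin n × Fin m => P.A q.2 q.1) (fun q => v q.2 q.1)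
  rw [← gram_prod, Fintype.sum_prod_type, Fintype.sum_prod_type] at h1
  have h2 := mul_le_mul_of_nonneg_left h1 (sq_nonneg (1 / ((m : ℝ) * n)))
  refine h2.trans (le_of_eq ?_)
  rw [RSq]
  ring

/-- One block is dominated by the Gram operator of its node. This trades `R_m²/m` for `R̄²` in the
regime `1/m ≤ cδ₁`. -/
lemma Rm_sq_le (hm : 0 < m) (hn : 0 < n) : P.Rm ^ 2 ≤ m * P.RbarSq := by
  have : Nonempty (Fin m × Fin n) := ⟨(⟨0, hm⟩, ⟨0, hn⟩)⟩
  have hm' : (0 : ℝ) < m := by exact_mod_cast hm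
  rw [← Real.le_sqrt P.Rm_nonneg (mul_nonneg hm'.le P.RbarSq_nonneg)]
  refine ciSup_le fun p => ?_
  rw [Real.le_sqrt (norm_nonneg _) (mul_nonneg hm'.le P.RbarSq_nonneg)]
  refine (norm_sq_le_lambdaMax (fun i => P.A i p.2) p.1).trans ?_
  have := mul_le_mul_of_nonneg_left (P.le_RbarSq p.2) hm'.le
  rwa [← mul_assoc, mul_one_div_cancel hm'.ne', one_mul] at this

/-- The Gram operator of one node lies below the total one. This trades `R̄²/n` for `R²` in the
second part of the theorem. -/
lemma RbarSq_le (hm : 0 < m) (hn : 0 < n) : P.RbarSq ≤ n * P.RSq := by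
  have : Nonempty (Fin n) := ⟨⟨0, hn⟩⟩
  have hm' : (0 : ℝ) < m := by exact_mod_cast hm
  have hn' : (0 : ℝ) < n := by exact_mod_cast hn
  refine ciSup_le fun τ => ?_
  have e : (n : ℝ) * P.RSq = 1 / (m : ℝ) *
      lambdaMax (∑ q : Fin n × Fin m, (P.A q.2 q.1) ∘L (P.A q.2 q.1).adjoint) := by
    rw [RSq, gram_prod]
    field_simp
  rw [e]
  refine mul_le_mul_of_nonneg_left ?_ (by positivity)
  refine lambdaMax_le (lambdaMax_gram_nonneg _) fun x => ?_
  refine le_trans ?_ (sum_norm_adjoint_sq_le (fun q : Fin n × Fin m => P.A q.2 q.1) x)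
  rw [inner_gram_self, Fintype.sum_prod_type]
  exact Finset.single_le_sum (f := fun τ => ∑ i, ‖(P.A i τ).adjoint x‖ ^ 2)
    (fun i _ => Finset.sum_nonneg fun i _ => by positivity) (Finset.mem_univ τ)

/-- All conjugates are finite at `Y`. -/
def DualFinite (Y : Fin m → Fin n → Vec t) : Prop := ∀ i τ, conj (P.φ i τ) (Y i τ) ≠ ⊤

/-- The real value of the saddle function where the conjugates are finite. -/
def saddleReal (x : Vec d) (Y : Fin m → Fin n → Vec t) : ℝ :=
  P.g x + 1 / ((m : ℝ) * n) * ∑ τ : Fin n, ∑ i : Fin m,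
    (⟪Y i τ, (P.A i τ).adjoint x⟫_ℝ - (conj (P.φ i τ) (Y i τ)).toReal)

variable {P}

lemma saddle_eq_coe {Y : Fin m → Fin n → Vec t} (hY : P.DualFinite Y) (x : Vec d) :
    P.saddle x Y = (P.saddleReal x Y : EReal) := by
  rw [saddle, saddleReal, EReal.coe_add, EReal.coe_mul]
  congr 2
  rw [coe_finset_sum]
  refine Finset.sum_congr rfl fun τ _ => ?_
  rw [coe_finset_sum]
  refine Finset.sum_congr rfl fun i _ => ?_
  rw [EReal.coe_sub, EReal.coe_toReal (hY i τ) (conj_ne_bot _ _)]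

lemma saddle_eq_bot {Y : Fin m → Fin n → Vec t} (hY : ¬ P.DualFinite Y) (x : Vec d) :
    P.saddle x Y = ⊥ := by
  simp only [DualFinite, not_forall, not_not] at hY
  obtain ⟨i, τ, h⟩ := hY
  have hm : (0 : ℝ) < m := by exact_mod_cast i.pos
  have hn : (0 : ℝ) < n := by exact_mod_cast τ.pos
  have h1 : ∑ τ : Fin n, ∑ i : Fin m,
      (((⟪Y i τ, (P.A i τ).adjoint x⟫_ℝ : ℝ) : EReal) - conj (P.φ i τ) (Y i τ)) = ⊥ := by
    rw [← Finset.add_sum_erase _ _ (Finset.mem_univ τ), ← Finset.add_sum_erase _ _ (Finset.mem_univ i),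
      h, EReal.sub_top, EReal.bot_add, EReal.bot_add]
  rw [saddle, h1, EReal.coe_mul_bot_of_pos (by positivity), EReal.add_bot]

lemma exists_dualFinite {γ lam : ℝ} (hP : P.Regular γ lam) : ∃ Y, P.DualFinite Y :=
  ⟨fun i τ => gradient (P.φ i τ) 0, fun i τ =>
    conj_gradient_zero_ne_top (hP.convex_φ i τ) (hP.differentiable_φ i τ)⟩

/-- An infinite conjugate would give the value `⊥`, which is no maximum over `Y` because some `Y`
has a finite value. -/
lemma IsSaddlePoint.dualFinite {γ lam : ℝ} (hP : P.Regular γ lam) {xs : Vec d}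
    {Ys : Fin m → Fin n → Vec t} (h : P.IsSaddlePoint xs Ys) : P.DualFinite Ys := by
  by_contra hn
  obtain ⟨Y, hY⟩ := exists_dualFinite hP
  have := h.1 Y
  rw [saddle_eq_bot hn, saddle_eq_coe hY] at this
  exact EReal.coe_ne_bot _ (le_bot_iff.1 this)

variable (P) in
/-- The real value of the gap where the conjugates are finite. -/
def gapReal (xs : Vec d) (Ys : Fin m → Fin n → Vec t) (s : State d t m n) : ℝ :=
  (P.saddleReal s.x Ys - P.saddleReal xs Ys)
    + (m : ℝ) * (P.saddleReal xs Ys - P.saddleReal xs s.y)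

lemma gap_eq_coe {Ys : Fin m → Fin n → Vec t} (hYs : P.DualFinite Ys) (xs : Vec d)
    {s : State d t m n} (hs : P.DualFinite s.y) :
    P.gap xs Ys s = (P.gapReal xs Ys s : EReal) := by
  rw [gap, gapReal, saddle_eq_coe hYs, saddle_eq_coe hYs, saddle_eq_coe hs]
  push_cast
  rfl

lemma gap_eq_top (hm : 0 < m) {Ys : Fin m → Fin n → Vec t} (hYs : P.DualFinite Ys) (xs : Vec d)
    {s : State d t m n} (hs : ¬ P.DualFinite s.y) : P.gap xs Ys s = ⊤ := by
  have h1 : (m : EReal) * ⊤ = ⊤ := by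
    have := EReal.coe_mul_top_of_pos (x := (m : ℝ)) (by exact_mod_cast hm)
    simpa using this
  rw [gap, saddle_eq_coe hYs, saddle_eq_coe hYs, saddle_eq_bot hs, EReal.sub_bot (EReal.coe_ne_bot _), h1,
    ← EReal.coe_sub, EReal.coe_add_top]

lemma IsSaddlePoint.primal_nonneg {xs : Vec d} {Ys : Fin m → Fin n → Vec t}
    (h : P.IsSaddlePoint xs Ys) (hYs : P.DualFinite Ys) (x : Vec d) :
    0 ≤ P.saddleReal x Ys - P.saddleReal xs Ys := by
  have := h.2 x
  rw [saddle_eq_coe hYs, saddle_eq_coe hYs, EReal.coe_le_coe_iff] at this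
  linarith

lemma IsSaddlePoint.dual_nonneg {xs : Vec d} {Ys : Fin m → Fin n → Vec t}
    (h : P.IsSaddlePoint xs Ys) (hYs : P.DualFinite Ys) {Y : Fin m → Fin n → Vec t}
    (hY : P.DualFinite Y) : 0 ≤ P.saddleReal xs Ys - P.saddleReal xs Y := by
  have := h.1 Y
  rw [saddle_eq_coe hYs, saddle_eq_coe hY, EReal.coe_le_coe_iff] at this
  linarith

end Problem

/-! ### Second moments of sums of independent vectors. -/

section Independence

variable {κ : Type*} [Fintype κ] {X : κ → Type*} [∀ i, MeasurableSpace (X i)]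
  {ρ : ∀ i, Measure (X i)} [∀ i, IsProbabilityMeasure (ρ i)] {d : ℕ}

lemma integrable_norm_sq {α : Type*} [MeasurableSpace α] {μ : Measure α}
    {f : α → Vec d} (hf : MemLp f 2 μ) : Integrable (fun x => ‖f x‖ ^ 2) μ :=
  (memLp_two_iff_integrable_sq_norm hf.1).1 hf

lemma norm_integral_sq_le {α : Type*} [MeasurableSpace α] {μ : Measure α} [IsProbabilityMeasure μ]
    {f : α → Vec d} (hf : MemLp f 2 μ) : ‖∫ x, f x ∂μ‖ ^ 2 ≤ ∫ x, ‖f x‖ ^ 2 ∂μ := by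
  have hi : Integrable f μ := hf.integrable (by norm_num)
  set c := ∫ x, f x ∂μ with hc
  have h0 : 0 ≤ ∫ x, ‖f x - c‖ ^ 2 ∂μ := integral_nonneg fun x => by positivity
  have e : ∀ x, ‖f x - c‖ ^ 2 = ‖f x‖ ^ 2 - 2 * ⟪c, f x⟫_ℝ + ‖c‖ ^ 2 := by
    intro x
    rw [norm_sub_sq_real, real_inner_comm]
  simp only [e] at h0
  have hA : Integrable (fun x => ‖f x‖ ^ 2 - 2 * ⟪c, f x⟫_ℝ) μ :=
    (integrable_norm_sq hf).sub ((hi.const_inner c).const_mul 2)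
  rw [integral_add hA (integrable_const _), integral_sub (integrable_norm_sq hf) ((hi.const_inner c).const_mul 2),
    integral_const_mul, integral_inner hi, ← hc, real_inner_self_eq_norm_sq] at h0
  simp at h0
  linarith

/-- The second moment of a sum of independent vectors. -/
lemma integral_norm_sum_sq (f : ∀ i, X i → Vec d) (hf : ∀ i, MemLp (f i) 2 (ρ i)) :
    Integrable (fun x => ‖∑ i, f i (x i)‖ ^ 2) (Measure.pi ρ) ∧
    ∫ x, ‖∑ i, f i (x i)‖ ^ 2 ∂(Measure.pi ρ) =
      ‖∑ i, ∫ x, f i x ∂(ρ i)‖ ^ 2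
        + ∑ i, (∫ x, ‖f i x‖ ^ 2 ∂(ρ i) - ‖∫ x, f i x ∂(ρ i)‖ ^ 2) := by
  classical
  have hi : ∀ i, Integrable (f i) (ρ i) := fun i => (hf i).integrable (by norm_num)
  have hL : ∀ i, MemLp (fun x : ∀ i, X i => f i (x i)) 2 (Measure.pi ρ) := fun i =>
    (hf i).comp_measurePreserving (measurePreserving_eval ρ i)
  have hind : iIndepFun (fun i (x : ∀ i, X i) => f i (x i)) (Measure.pi ρ) :=
    iIndepFun_pi fun i => (hi i).aemeasurable
  have hij : ∀ i j, Integrable (fun x : ∀ i, X i => ⟪f i (x i), f j (x j)⟫_ℝ) (Measure.pi ρ) :=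
    fun i j => by
      have := MemLp.integrable_mul (hL i).norm (hL j).norm
      refine this.mono' ((hL i).1.inner (hL j).1) (ae_of_all _ fun x => ?_)
      exact norm_inner_le_norm _ _
  have hval : ∀ i j, ∫ x, ⟪f i (x i), f j (x j)⟫_ℝ ∂(Measure.pi ρ) =
      ⟪∫ x, f i x ∂(ρ i), ∫ x, f j x ∂(ρ j)⟫_ℝ +
        if i = j then (∫ x, ‖f i x‖ ^ 2 ∂(ρ i) - ‖∫ x, f i x ∂(ρ i)‖ ^ 2) else 0 := by
    intro i j
    by_cases h : i = j
    · subst h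
      simp only [real_inner_self_eq_norm_sq, if_true]
      rw [integral_comp_eval (f := fun x => ‖f i x‖ ^ 2) (integrable_norm_sq (hf i)).1]
      ring
    · rw [if_neg h, add_zero]
      have : ∫ x, ⟪f i (x i), f j (x j)⟫_ℝ ∂(Measure.pi ρ) =
          ⟪∫ x, f i (x i) ∂(Measure.pi ρ), ∫ x, f j (x j) ∂(Measure.pi ρ)⟫_ℝ :=
        (hind.indepFun h).integral_bilin (integrable_comp_eval (hi i))
        (integrable_comp_eval (hi j)) (innerSL ℝ)
      rw [this, integral_comp_eval (hi i).1, integral_comp_eval (hi j).1]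
  have e : ∀ x : ∀ i, X i, ‖∑ i, f i (x i)‖ ^ 2 = ∑ i, ∑ j, ⟪f i (x i), f j (x j)⟫_ℝ := by
    intro x
    rw [← real_inner_self_eq_norm_sq, sum_inner]
    simp only [inner_sum]
  have hInt : Integrable (fun x : ∀ i, X i => ∑ i, ∑ j, ⟪f i (x i), f j (x j)⟫_ℝ) (Measure.pi ρ) :=
    integrable_finsetSum _ fun i _ => integrable_finsetSum _ fun j _ => hij i j
  refine ⟨by simpa only [e] using hInt, ?_⟩
  simp only [e]
  rw [integral_finsetSum _ fun i _ => integrable_finsetSum _ fun j _ => hij i j]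
  have : ∀ i, ∫ x, ∑ j, ⟪f i (x i), f j (x j)⟫_ℝ ∂(Measure.pi ρ) =
      ∑ j, ⟪∫ x, f i x ∂(ρ i), ∫ x, f j x ∂(ρ j)⟫_ℝ +
        (∫ x, ‖f i x‖ ^ 2 ∂(ρ i) - ‖∫ x, f i x ∂(ρ i)‖ ^ 2) := by
    intro i
    rw [integral_finsetSum _ fun j _ => hij i j]
    simp only [hval, Finset.sum_add_distrib, Finset.sum_ite_eq, Finset.mem_univ, if_true]
  simp only [this, Finset.sum_add_distrib]
  rw [← real_inner_self_eq_norm_sq (∑ i, ∫ x, f i x ∂(ρ i)), sum_inner]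
  simp only [inner_sum]

end Independence

/-! ### The law of one node's draw, and means over a uniform index. -/

section NodeLaw

variable {S : Type*} [MeasurableSpace S] {d m : ℕ}

/-- The joint law of the index and the seed drawn by a node. -/
abbrev nodeLaw (m : ℕ) (ν : Measure S) : Measure (Fin m × S) :=
  (uniformOn (Set.univ : Set (Fin m))).prod ν

lemma isProbabilityMeasure_uniformOn_univ (hm : 0 < m) :
    IsProbabilityMeasure (uniformOn (Set.univ : Set (Fin m))) :=
  isProbabilityMeasure_uniformOn Set.finite_univ ⟨⟨0, hm⟩, Set.mem_univ _⟩

variable {F : Type*} [NormedAddCommGroup F]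

lemma integral_uniformOn_univ [NormedSpace ℝ F] [CompleteSpace F] (hm : 0 < m) (f : Fin m → F) :
    ∫ i, f i ∂(uniformOn (Set.univ : Set (Fin m))) = (1 / (m : ℝ)) • ∑ i, f i := by
  have := isProbabilityMeasure_uniformOn_univ hm
  rw [integral_fintype .of_finite, Finset.smul_sum]
  refine Finset.sum_congr rfl fun i _ => ?_
  congr 1
  rw [measureReal_def, uniformOn_univ, Measure.count_singleton]
  simp

variable {ν : Measure S} [IsProbabilityMeasure ν]

lemma integrable_nodeLaw (hm : 0 < m) {f : Fin m × S → F} (hf : AEStronglyMeasurable f (nodeLaw m ν))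
    (h : ∀ i, Integrable (fun s => f (i, s)) ν) : Integrable f (nodeLaw m ν) := by
  have := isProbabilityMeasure_uniformOn_univ hm
  rw [integrable_prod_iff hf]
  exact ⟨ae_of_all _ h, .of_finite⟩

lemma integral_nodeLaw [NormedSpace ℝ F] [CompleteSpace F] (hm : 0 < m) {f : Fin m × S → F}
    (hf : Integrable f (nodeLaw m ν)) :
    ∫ p, f p ∂(nodeLaw m ν) = (1 / (m : ℝ)) • ∑ i, ∫ s, f (i, s) ∂ν := by
  have := isProbabilityMeasure_uniformOn_univ hm
  rw [integral_prod f hf, integral_uniformOn_univ hm]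

/-- The mean of a finite family. -/
def mean (a : Fin m → Vec d) : Vec d := (1 / (m : ℝ)) • ∑ i, a i

/-- The mean of the squared norms of a finite family. -/
def meanSq {k : ℕ} (a : Fin m → Vec k) : ℝ := 1 / (m : ℝ) * ∑ i, ‖a i‖ ^ 2

lemma meanSq_nonneg {k : ℕ} (a : Fin m → Vec k) : 0 ≤ meanSq a := by unfold meanSq; positivity

lemma mean_add_const (hm : 0 < m) (a : Fin m → Vec d) (b : Vec d) :
    mean (fun i => a i + b) = mean a + b := by
  have hm' : (m : ℝ) ≠ 0 := by exact_mod_cast hm.ne'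
  simp only [mean, Finset.sum_add_distrib, Finset.sum_const, Finset.card_univ, Fintype.card_fin,
    smul_add]
  rw [← Nat.cast_smul_eq_nsmul ℝ, smul_smul, one_div_mul_cancel hm', one_smul]

/-- Bias–variance decomposition: a constant shift moves the mean and leaves the variance alone. -/
lemma meanSq_add_const (hm : 0 < m) (a : Fin m → Vec d) (b : Vec d) :
    meanSq (fun i => a i + b) = ‖mean a + b‖ ^ 2 + meanSq a - ‖mean a‖ ^ 2 := by
  have hm' : (m : ℝ) ≠ 0 := by exact_mod_cast hm.ne'
  have e1 : ⟪mean a, b⟫_ℝ = 1 / (m : ℝ) * ∑ i, ⟪a i, b⟫_ℝ := by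
    rw [mean, inner_smul_left, sum_inner]; simp
  rw [norm_add_sq_real, e1]
  simp only [meanSq, norm_add_sq_real, Finset.sum_add_distrib, ← Finset.mul_sum, Finset.sum_const,
    Finset.card_univ, Fintype.card_fin, nsmul_eq_mul]
  field_simp
  ring

lemma norm_mean_sq_le (hm : 0 < m) (a : Fin m → Vec d) : ‖mean a‖ ^ 2 ≤ meanSq a := by
  have h1 := meanSq_add_const hm a (-mean a)
  have h2 := meanSq_nonneg (fun i => a i + -mean a)
  rw [h1, add_neg_cancel, norm_zero] at h2
  linarith

end NodeLaw

/-! ### Moments of the compression error and of the lag of the shift. -/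

section Compression

variable {S : Type*} [MeasurableSpace S] {d m : ℕ} {ν : Measure S}
  {Q : S → Vec d → Vec d} {δ : ℝ}

lemma IsContractionCompressor.measurable_apply (hQ : IsContractionCompressor ν Q δ) (x : Vec d) :
    Measurable (fun s => Q s x) :=
  hQ.measurable.comp (measurable_id.prodMk measurable_const)

lemma IsContractionCompressor.integrable_sq (hQ : IsContractionCompressor ν Q δ) (x : Vec d) :
    Integrable (fun s => ‖x - Q s x‖ ^ 2) ν := by
  have hmeas : Measurable (fun s => ‖x - Q s x‖ ^ 2) :=
    ((measurable_const.sub (hQ.measurable_apply x)).norm).pow_const 2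
  refine ⟨hmeas.aestronglyMeasurable, ?_⟩
  rw [hasFiniteIntegral_iff_ofReal (ae_of_all _ fun s => by positivity)]
  exact lt_of_le_of_lt (hQ.contraction x) ENNReal.ofReal_lt_top

lemma IsContractionCompressor.memLp (hQ : IsContractionCompressor ν Q δ) (x : Vec d) :
    MemLp (fun s => x - Q s x) 2 ν :=
  (memLp_two_iff_integrable_sq_norm
    (measurable_const.sub (hQ.measurable_apply x)).aestronglyMeasurable).2 (hQ.integrable_sq x)

lemma IsContractionCompressor.integral_sq_le (hQ : IsContractionCompressor ν Q δ) (x : Vec d) :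
    ∫ s, ‖x - Q s x‖ ^ 2 ∂ν ≤ (1 - δ) * ‖x‖ ^ 2 := by
  have h1 : 0 ≤ (1 - δ) * ‖x‖ ^ 2 := mul_nonneg (by linarith [hQ.le_one]) (by positivity)
  rw [← ENNReal.ofReal_le_ofReal_iff h1,
    ofReal_integral_eq_lintegral_ofReal (hQ.integrable_sq x) (ae_of_all _ fun s => by positivity)]
  exact hQ.contraction x

variable [IsProbabilityMeasure ν]

lemma IsContractionCompressor.integral_sub (hQ : IsContractionCompressor ν Q δ)
    (hs : ScalesInMean ν Q δ) (x : Vec d) : ∫ s, (x - Q s x) ∂ν = (1 - δ) • x := by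
  have h1 : Integrable (fun s => x - Q s x) ν := (hQ.memLp x).integrable (by norm_num)
  have h2 : Integrable (fun s => Q s x) ν := by
    have := (integrable_const x).sub h1
    refine this.congr (ae_of_all _ fun s => ?_)
    simp
  rw [MeasureTheory.integral_sub (integrable_const x) h2, hs x]
  simp [sub_smul]

/-- The compression error of a message `a i + b`. -/
def compErr (Q : S → Vec d → Vec d) (a : Fin m → Vec d) (b : Vec d) (p : Fin m × S) : Vec d :=
  (a p.1 + b) - Q p.2 (a p.1 + b)

lemma memLp_compErr (hm : 0 < m) (hQ : IsContractionCompressor ν Q δ) (a : Fin m → Vec d)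
    (b : Vec d) : MemLp (compErr Q a b) 2 (nodeLaw m ν) := by
  have hx : Measurable (fun p : Fin m × S => a p.1 + b) :=
    ((measurable_of_finite a).comp measurable_fst).add_const b
  have hmeas : Measurable (compErr Q a b) := hx.sub (hQ.measurable.comp (measurable_snd.prodMk hx))
  rw [memLp_two_iff_integrable_sq_norm hmeas.aestronglyMeasurable]
  exact integrable_nodeLaw hm (hmeas.norm.pow_const 2).aestronglyMeasurable
    fun i => hQ.integrable_sq (a i + b)

/-- For a fixed index the contraction applies to the message `a i + b`; averaging over the index
then separates the shifted mean from the variance of `a`. -/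
lemma integral_compErr_sq_le (hm : 0 < m) (hQ : IsContractionCompressor ν Q δ) (a : Fin m → Vec d)
    (b : Vec d) : ∫ p, ‖compErr Q a b p‖ ^ 2 ∂(nodeLaw m ν) ≤
      (1 - δ) * (‖mean a + b‖ ^ 2 + meanSq a - ‖mean a‖ ^ 2) := by
  rw [integral_nodeLaw hm (integrable_norm_sq (memLp_compErr hm hQ a b)), ← meanSq_add_const hm,
    meanSq, smul_eq_mul, mul_left_comm (1 - δ)]
  refine mul_le_mul_of_nonneg_left ?_ (by positivity)
  rw [Finset.mul_sum]
  exact Finset.sum_le_sum fun i _ => hQ.integral_sq_le (a i + b)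

lemma integral_compErr (hm : 0 < m) (hQ : IsContractionCompressor ν Q δ) (hs : ScalesInMean ν Q δ)
    (a : Fin m → Vec d) (b : Vec d) :
    ∫ p, compErr Q a b p ∂(nodeLaw m ν) = (1 - δ) • (mean a + b) := by
  have := isProbabilityMeasure_uniformOn_univ hm
  have e : ∀ i, ∫ s, compErr Q a b (i, s) ∂ν = (1 - δ) • (a i + b) := fun i =>
    hQ.integral_sub hs (a i + b)
  rw [integral_nodeLaw hm ((memLp_compErr hm hQ a b).integrable (by norm_num)),
    ← mean_add_const hm, mean]
  simp only [e]
  rw [← Finset.smul_sum, smul_comm]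

/-- The new lag `u - h` of the shift `h`, from the old lag `v` and the increment `a i` of `m u`. -/
def lagErr (Q : S → Vec d → Vec d) (a : Fin m → Vec d) (v : Vec d) (p : Fin m × S) : Vec d :=
  (v - Q p.2 v) + (1 / (m : ℝ)) • a p.1

lemma memLp_lagErr (hm : 0 < m) (hQ : IsContractionCompressor ν Q δ) (a : Fin m → Vec d)
    (v : Vec d) : MemLp (lagErr Q a v) 2 (nodeLaw m ν) := by
  have := isProbabilityMeasure_uniformOn_univ hm
  have h1 : MemLp (fun p : Fin m × S => v - Q p.2 v) 2 (nodeLaw m ν) :=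
    (hQ.memLp v).comp_measurePreserving measurePreserving_snd
  have h2 : MemLp (fun p : Fin m × S => (1 / (m : ℝ)) • a p.1) 2 (nodeLaw m ν) :=
    (MemLp.of_discrete (f := fun i => (1 / (m : ℝ)) • a i)
      (μ := uniformOn (Set.univ : Set (Fin m)))).comp_measurePreserving measurePreserving_fst
  exact h1.add h2

/-- The index is independent of the seed, so the cross term factors into an inner product of two
means. -/
lemma integral_lagErr_sq (hm : 0 < m) (hQ : IsContractionCompressor ν Q δ) (a : Fin m → Vec d)
    (v : Vec d) : ∫ p, ‖lagErr Q a v p‖ ^ 2 ∂(nodeLaw m ν) =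
      ∫ s, ‖v - Q s v‖ ^ 2 ∂ν + 2 * ⟪∫ s, (v - Q s v) ∂ν, (1 / (m : ℝ)) • mean a⟫_ℝ
        + meanSq a / (m : ℝ) ^ 2 := by
  have hm' : (m : ℝ) ≠ 0 := by exact_mod_cast hm.ne'
  have hi : Integrable (fun s => v - Q s v) ν := (hQ.memLp v).integrable (by norm_num)
  rw [integral_nodeLaw hm (integrable_norm_sq (memLp_lagErr hm hQ a v))]
  have e : ∀ i, ∫ s, ‖lagErr Q a v (i, s)‖ ^ 2 ∂ν = ∫ s, ‖v - Q s v‖ ^ 2 ∂ν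
      + 2 / (m : ℝ) * ⟪∫ s, (v - Q s v) ∂ν, a i⟫_ℝ + ‖a i‖ ^ 2 / (m : ℝ) ^ 2 := by
    intro i
    have e1 : ∀ s, ‖lagErr Q a v (i, s)‖ ^ 2 = ‖v - Q s v‖ ^ 2
        + 2 / (m : ℝ) * ⟪a i, v - Q s v⟫_ℝ + ‖a i‖ ^ 2 / (m : ℝ) ^ 2 := by
      intro s
      rw [lagErr, norm_add_sq_real, inner_smul_right, norm_smul, mul_pow, real_inner_comm]
      simp only [Real.norm_eq_abs, sq_abs]
      ring
    simp only [e1]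
    have hA : Integrable (fun s => ‖v - Q s v‖ ^ 2 + 2 / (m : ℝ) * ⟪a i, v - Q s v⟫_ℝ) ν :=
      (hQ.integrable_sq v).add ((hi.const_inner _).const_mul _)
    rw [integral_add hA (integrable_const _), integral_add (hQ.integrable_sq v) ((hi.const_inner _).const_mul _),
      integral_const_mul, integral_inner hi, real_inner_comm]
    simp
  simp only [e, Finset.sum_add_distrib, ← Finset.mul_sum, ← inner_sum, ← Finset.sum_div, mean, meanSq,
    inner_smul_right, smul_eq_mul, Finset.sum_const, Finset.card_univ, Fintype.card_fin, nsmul_eq_mul]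
  field_simp

/-- The mean compression error has norm at most `√(1 - δ) ‖v‖` by Jensen, so its product with the
mean jump can be split by Young's inequality at the expense of half the contraction. -/
lemma integral_lagErr_sq_le (hm : 0 < m) (hQ : IsContractionCompressor ν Q δ) (a : Fin m → Vec d)
    (v : Vec d) : ∫ p, ‖lagErr Q a v p‖ ^ 2 ∂(nodeLaw m ν) ≤
      (1 - δ / 2) * ‖v‖ ^ 2 + 2 * (1 - δ) / δ * (‖mean a‖ ^ 2 / (m : ℝ) ^ 2)
        + meanSq a / (m : ℝ) ^ 2 := by
  rw [integral_lagErr_sq hm hQ]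
  have h1 := hQ.integral_sq_le v
  have h2 := (norm_integral_sq_le (hQ.memLp v)).trans h1
  have hδ := hQ.pos
  have hδ1 := hQ.le_one
  set w := ∫ s, (v - Q s v) ∂ν
  have h3 : ⟪w, (1 / (m : ℝ)) • mean a⟫_ℝ ≤ ‖w‖ * (‖mean a‖ / m) := by
    refine (real_inner_le_norm _ _).trans_eq ?_
    rw [norm_smul]
    simp only [one_div, norm_inv, RCLike.norm_natCast]
    ring
  set q := ‖mean a‖ / (m : ℝ) with hq
  have hq0 : 0 ≤ q := by positivity
  have e : ‖mean a‖ ^ 2 / (m : ℝ) ^ 2 = q ^ 2 := by rw [hq, div_pow]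
  rw [e]
  set r := √(1 - δ) with hr
  have hr2 : r ^ 2 = 1 - δ := Real.sq_sqrt (by linarith)
  have hr0 : 0 ≤ r := Real.sqrt_nonneg _
  have h4 : ‖w‖ ≤ r * ‖v‖ := by
    refine le_of_sq_le_sq ?_ (by positivity)
    rw [mul_pow, hr2]
    exact h2
  have h5 : 2 * (‖w‖ * q) ≤ δ / 2 * ‖v‖ ^ 2 + 2 * (1 - δ) / δ * q ^ 2 := by
    have h6 : ‖w‖ * q ≤ r * ‖v‖ * q := mul_le_mul_of_nonneg_right h4 hq0
    have h7 : δ / 2 * ‖v‖ ^ 2 + 2 * (1 - δ) / δ * q ^ 2 - 2 * (r * ‖v‖ * q) =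
        1 / (2 * δ) * (δ * ‖v‖ - 2 * r * q) ^ 2 := by
      rw [← hr2]
      field_simp
      ring
    have h8 : 0 ≤ 1 / (2 * δ) * (δ * ‖v‖ - 2 * r * q) ^ 2 := by positivity
    linarith
  nlinarith

lemma integral_lagErr (hm : 0 < m) (hQ : IsContractionCompressor ν Q δ) (hs : ScalesInMean ν Q δ)
    (a : Fin m → Vec d) (v : Vec d) :
    ∫ p, lagErr Q a v p ∂(nodeLaw m ν) = (1 - δ) • v + (1 / (m : ℝ)) • mean a := by
  have hm' : (m : ℝ) ≠ 0 := by exact_mod_cast hm.ne'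
  have := isProbabilityMeasure_uniformOn_univ hm
  have hi : Integrable (fun s => v - Q s v) ν := (hQ.memLp v).integrable (by norm_num)
  rw [integral_nodeLaw hm ((memLp_lagErr hm hQ a v).integrable (by norm_num))]
  have e : ∀ i, ∫ s, lagErr Q a v (i, s) ∂ν = (1 / (m : ℝ)) • a i + (1 - δ) • v := by
    intro i
    simp only [lagErr]
    rw [integral_add hi (integrable_const _), hQ.integral_sub hs]
    simp [add_comm]
  simp only [e]
  have := mean_add_const hm (fun i => (1 / (m : ℝ)) • a i) ((1 - δ) • v)
  simp only [mean] at this ⊢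
  rw [this, ← Finset.smul_sum, add_comm]

end Compression

/-! ### Measurability of the state and of the one-step map. -/

section StateSpace

variable {d t m n : ℕ}

/-- The components of a state as a tuple. -/
def State.toTuple (s : State d t m n) : Vec d × Vec d × (Fin m → Fin n → Vec t) ×
    (Fin n → Vec d) × (Fin n → Vec d) × (Fin n → Vec d) := (s.x, s.z, s.y, s.u, s.h, s.e)

instance : MeasurableSpace (State d t m n) := MeasurableSpace.comap State.toTuple inferInstance

lemma State.measurable_toTuple : Measurable (State.toTuple (d := d) (t := t) (m := m) (n := n)) :=
  comap_measurable _

lemma State.measurable_x : Measurable (State.x (d := d) (t := t) (m := m) (n := n)) :=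
  measurable_fst.comp measurable_toTuple

lemma State.measurable_z : Measurable (State.z (d := d) (t := t) (m := m) (n := n)) :=
  measurable_fst.comp (measurable_snd.comp measurable_toTuple)

lemma State.measurable_y (i : Fin m) (τ : Fin n) :
    Measurable (fun s : State d t m n => s.y i τ) :=
  (measurable_pi_apply τ).comp ((measurable_pi_apply i).comp
    (measurable_fst.comp (measurable_snd.comp (measurable_snd.comp measurable_toTuple))))

lemma State.measurable_u (τ : Fin n) : Measurable (fun s : State d t m n => s.u τ) :=
  (measurable_pi_apply τ).comp (measurable_fst.comp (measurable_snd.comp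
    (measurable_snd.comp (measurable_snd.comp measurable_toTuple))))

lemma State.measurable_h (τ : Fin n) : Measurable (fun s : State d t m n => s.h τ) :=
  (measurable_pi_apply τ).comp (measurable_fst.comp (measurable_snd.comp (measurable_snd.comp
    (measurable_snd.comp (measurable_snd.comp measurable_toTuple)))))

lemma State.measurable_e (τ : Fin n) : Measurable (fun s : State d t m n => s.e τ) :=
  (measurable_pi_apply τ).comp (measurable_snd.comp (measurable_snd.comp (measurable_snd.comp
    (measurable_snd.comp (measurable_snd.comp measurable_toTuple)))))

lemma State.measurable_mk {α : Type*} [MeasurableSpace α] {f : α → State d t m n}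
    (hx : Measurable fun a => (f a).x) (hz : Measurable fun a => (f a).z)
    (hy : ∀ i τ, Measurable fun a => (f a).y i τ) (hu : ∀ τ, Measurable fun a => (f a).u τ)
    (hh : ∀ τ, Measurable fun a => (f a).h τ) (he : ∀ τ, Measurable fun a => (f a).e τ) :
    Measurable f := by
  refine measurable_comap_iff.2 ?_
  exact hx.prodMk (hz.prodMk ((measurable_pi_lambda _ fun i => measurable_pi_lambda _ (hy i)).prodMk
    ((measurable_pi_lambda _ hu).prodMk
      ((measurable_pi_lambda _ hh).prodMk (measurable_pi_lambda _ he)))))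

lemma measurable_avg {α : Type*} [MeasurableSpace α] {f : α → Fin n → Vec d}
    (hf : ∀ τ, Measurable fun a => f a τ) : Measurable fun a => avg (f a) := by
  unfold avg
  exact (Finset.measurable_sum _ fun τ _ => hf τ).const_smul (1 / (n : ℝ))

lemma measurable_comp₂ {α : Type*} [MeasurableSpace α] {F : Vec d × Vec d → Vec d}
    (hF : Continuous F) {f g : α → Vec d} (hf : Measurable f) (hg : Measurable g) :
    Measurable fun a => F (f a, g a) := by
  have h1 : Measurable F := hF.measurable
  exact h1.comp (hf.prodMk hg)

lemma IsProxable.measurable_prox {α : Type*} [MeasurableSpace α] {h : Vec d → EReal} {κ η : ℝ}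
    (hh : IsProxable h κ) (hη : 0 < η) {f g : α → Vec d} (hf : Measurable f) (hg : Measurable g) :
    Measurable fun a => prox h η (f a) (g a) :=
  measurable_comp₂ (F := fun q : Vec d × Vec d => prox h η q.1 q.2) (hh.continuous_prox hη) hf hg

end StateSpace

namespace Problem

variable {d t m n : ℕ} (P : Problem d t m n) {γ lam : ℝ}

lemma Regular.isProxable_conj {P : Problem d t m n} (hP : P.Regular γ lam) (hγ : 0 < γ)
    (i : Fin m) (τ : Fin n) : IsProxable (conj (P.φ i τ)) γ :=
  ECSPDC.isProxable_conj hγ (hP.convex_φ i τ) (hP.differentiable_φ i τ) (hP.smooth_φ i τ)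

lemma Regular.isProxable_g {P : Problem d t m n} (hP : P.Regular γ lam) (hlam : 0 < lam) :
    IsProxable (fun x => (P.g x : EReal)) lam :=
  isProxable_coe hlam.le hP.strongConvex_g

/-- The dual proximal update of the block `(i, τ)`. -/
def dualProx (σ : ℝ) (s : State d t m n) (i : Fin m) (τ : Fin n) : Vec t :=
  prox (conj (P.φ i τ)) σ (-(P.A i τ).adjoint s.z) (s.y i τ)

/-- The increment produced at node `τ` when it draws the index `i`. -/
def jump (σ : ℝ) (s : State d t m n) (τ : Fin n) (i : Fin m) : Vec d :=
  P.A i τ (P.dualProx σ s i τ - s.y i τ)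

variable {S : Type*} (Q Q₁ : S → Vec d → Vec d) (σ η θ : ℝ)

/-- The tilt of the primal proximal step. -/
def tilt (s : State d t m n) (p : Fin n → Fin m × S) : Vec d :=
  avg s.h + avg fun τ =>
    Q (p τ).2 (P.jump σ s τ (p τ).1 + (s.u τ - s.h τ + s.e τ))

/-- The state reached from `s` in one iteration with the draws `p`. -/
def next (s : State d t m n) (p : Fin n → Fin m × S) : State d t m n where
  x := prox (fun x => (P.g x : EReal)) η (P.tilt Q σ s p) s.x
  z := prox (fun x => (P.g x : EReal)) η (P.tilt Q σ s p) s.x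
    + θ • (prox (fun x => (P.g x : EReal)) η (P.tilt Q σ s p) s.x - s.x)
  y := fun i τ => if i = (p τ).1 then P.dualProx σ s i τ else s.y i τ
  u := fun τ => s.u τ + (1 / (m : ℝ)) • P.jump σ s τ (p τ).1
  h := fun τ => s.h τ + Q₁ (p τ).2 (s.u τ - s.h τ)
  e := fun τ => compErr Q (P.jump σ s τ) (s.u τ - s.h τ + s.e τ) (p τ)

variable {P Q Q₁ σ η θ}

/-- Both optimality conditions of an iteration are proximal problems with unique solutions. The
relation `Step` therefore determines the new state, and all later arguments concern the map `next`.
-/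
lemma Step.eq_next (hP : P.Regular γ lam) (hγ : 0 < γ) (hlam : 0 < lam) (hσ : 0 < σ) (hη : 0 < η)
    {idx : Fin n → Fin m} {sd : Fin n → S} {s s' : State d t m n}
    (h : P.Step Q Q₁ σ η θ idx sd s s') :
    s' = P.next Q Q₁ σ η θ s (fun τ => (idx τ, sd τ)) := by
  have hy1 : ∀ τ, s'.y (idx τ) τ = P.dualProx σ s (idx τ) τ := by
    intro τ
    refine (hP.isProxable_conj hγ (idx τ) τ).eq_prox hσ fun y _ => ?_
    have h1 := h.y_sampled τ (Set.mem_univ y)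
    have h2 := EReal.neg_le_neg_iff.2 h1
    have e : ∀ v : Vec t, proxObj (conj (P.φ (idx τ) τ)) σ (-(P.A (idx τ) τ).adjoint s.z)
        (s.y (idx τ) τ) v = -((((⟪v, (P.A (idx τ) τ).adjoint s.z⟫_ℝ
          - 1 / (2 * σ) * ‖v - s.y (idx τ) τ‖ ^ 2 : ℝ) : EReal)) - conj (P.φ (idx τ) τ) v) := by
      intro v
      rw [EReal.neg_sub (Or.inl (EReal.coe_ne_bot _)) (Or.inl (EReal.coe_ne_top _)), proxObj, add_comm,
        ← EReal.coe_neg]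
      congr 2
      rw [inner_neg_left, real_inner_comm]
      ring
    change proxObj _ _ _ _ _ ≤ proxObj _ _ _ _ _
    rw [e, e]
    exact h2
  have hinc : ∀ τ, P.incr idx s s' τ = P.jump σ s τ (idx τ) := fun τ => by
    rw [incr, jump, hy1]
  have hmsg : ∀ τ, P.message idx s s' τ =
      P.jump σ s τ (idx τ) + (s.u τ - s.h τ + s.e τ) := fun τ => by
    rw [message, hinc]
    abel
  have hx : s'.x = prox (fun x => (P.g x : EReal)) η
      (P.tilt Q σ s (fun τ => (idx τ, sd τ))) s.x := by
    refine (hP.isProxable_g hlam).eq_prox hη fun x _ => ?_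
    have h1 := h.x_step (Set.mem_univ x)
    simp only [hmsg, Set.mem_ofPred_eq] at h1
    change proxObj _ _ _ _ _ ≤ proxObj _ _ _ _ _
    simp only [proxObj, ← EReal.coe_add, EReal.coe_le_coe_iff, tilt, ← add_assoc]
    simpa only [← add_assoc] using h1
  have hz := h.z_step
  rw [hx] at hz
  obtain ⟨x', z', y', u', h', e'⟩ := s'
  simp only [next, State.mk.injEq]
  refine ⟨hx, hz, ?_, ?_, ?_, ?_⟩
  · funext i τ
    by_cases hi : i = idx τ
    · rw [if_pos hi, hi]; exact hy1 τ
    · rw [if_neg hi]; exact h.y_other τ i hi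
  · funext τ
    rw [← hinc]; exact h.u_step τ
  · funext τ
    exact h.h_step τ
  · funext τ
    have := h.e_step τ
    rw [hmsg] at this
    exact this

lemma measurable_dualProx (hP : P.Regular γ lam) (hγ : 0 < γ) (hσ : 0 < σ) (i : Fin m) (τ : Fin n) :
    Measurable fun s : State d t m n => P.dualProx σ s i τ := by
  have h1 : Measurable fun s : State d t m n => -(P.A i τ).adjoint s.z :=
    ((P.A i τ).adjoint.continuous.measurable.comp State.measurable_z).neg
  exact (hP.isProxable_conj hγ i τ).measurable_prox hσ h1 (State.measurable_y i τ)

lemma measurable_jump (hP : P.Regular γ lam) (hγ : 0 < γ) (hσ : 0 < σ) (τ : Fin n) (i : Fin m) :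
    Measurable fun s : State d t m n => P.jump σ s τ i :=
  (P.A i τ).continuous.measurable.comp
    ((measurable_dualProx hP hγ hσ i τ).sub (State.measurable_y i τ))

variable [MeasurableSpace S]

lemma measurable_next (hP : P.Regular γ lam) (hγ : 0 < γ) (hlam : 0 < lam) (hσ : 0 < σ) (hη : 0 < η)
    (hQ : Measurable fun p : S × Vec d => Q p.1 p.2)
    (hQ₁ : Measurable fun p : S × Vec d => Q₁ p.1 p.2) :
    Measurable fun q : State d t m n × (Fin n → Fin m × S) => P.next Q Q₁ σ η θ q.1 q.2 := by
  have hp : ∀ τ, Measurable fun q : State d t m n × (Fin n → Fin m × S) => q.2 τ := fun τ =>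
    (measurable_pi_apply τ).comp measurable_snd
  have hidx : ∀ τ, Measurable fun q : State d t m n × (Fin n → Fin m × S) => (q.2 τ).1 := fun τ =>
    measurable_fst.comp (hp τ)
  have hsd : ∀ τ, Measurable fun q : State d t m n × (Fin n → Fin m × S) => (q.2 τ).2 := fun τ =>
    measurable_snd.comp (hp τ)
  have hj : ∀ τ, Measurable fun q : State d t m n × (Fin n → Fin m × S) =>
      P.jump σ q.1 τ (q.2 τ).1 := fun τ => by
    -- The index ranges over a countable set, so measurability in the state for each fixed index
    -- suffices.
    have h1 : Measurable fun r : Fin m × State d t m n => P.jump σ r.2 τ r.1 :=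
      measurable_from_prod_countable_right fun i => measurable_jump hP hγ hσ τ i
    exact h1.comp ((hidx τ).prodMk measurable_fst)
  have hu : ∀ τ, Measurable fun q : State d t m n × (Fin n → Fin m × S) => q.1.u τ := fun τ =>
    (State.measurable_u τ).comp measurable_fst
  have hh : ∀ τ, Measurable fun q : State d t m n × (Fin n → Fin m × S) => q.1.h τ := fun τ =>
    (State.measurable_h τ).comp measurable_fst
  have he : ∀ τ, Measurable fun q : State d t m n × (Fin n → Fin m × S) => q.1.e τ := fun τ =>
    (State.measurable_e τ).comp measurable_fst
  have hmsg : ∀ τ, Measurable fun q : State d t m n × (Fin n → Fin m × S) =>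
      P.jump σ q.1 τ (q.2 τ).1 + (q.1.u τ - q.1.h τ + q.1.e τ) := fun τ =>
    (hj τ).add (((hu τ).sub (hh τ)).add (he τ))
  have hQm : ∀ τ, Measurable fun q : State d t m n × (Fin n → Fin m × S) =>
      Q (q.2 τ).2 (P.jump σ q.1 τ (q.2 τ).1 + (q.1.u τ - q.1.h τ + q.1.e τ)) := fun τ =>
    hQ.comp ((hsd τ).prodMk (hmsg τ))
  have htilt : Measurable fun q : State d t m n × (Fin n → Fin m × S) => P.tilt Q σ q.1 q.2 :=
    (measurable_avg hh).add (measurable_avg hQm)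
  have hx0 : Measurable fun q : State d t m n × (Fin n → Fin m × S) => q.1.x :=
    State.measurable_x.comp measurable_fst
  have hx : Measurable fun q : State d t m n × (Fin n → Fin m × S) =>
      prox (fun x => (P.g x : EReal)) η (P.tilt Q σ q.1 q.2) q.1.x :=
    (hP.isProxable_g hlam).measurable_prox hη htilt hx0
  refine State.measurable_mk hx (hx.add ((hx.sub hx0).const_smul θ)) (fun i τ => ?_) (fun τ => ?_)
    (fun τ => ?_) fun τ => ?_
  · refine Measurable.ite ?_ ((measurable_dualProx hP hγ hσ i τ).comp measurable_fst)
      ((State.measurable_y i τ).comp measurable_fst)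
    exact (hidx τ) (measurableSet_eq_fun measurable_const measurable_id : MeasurableSet {j | i = j})
  · exact (hu τ).add ((hj τ).const_smul (1 / (m : ℝ)))
  · exact (hh τ).add (hQ₁.comp ((hsd τ).prodMk ((hu τ).sub (hh τ))))
  · exact (hmsg τ).sub (hQm τ)

end Problem

/-! ### The history of the draws and its independence of the fresh ones. -/

section Sampling

variable {Ω S : Type*} [MeasurableSpace S] {m n : ℕ} {ι : ℕ → Fin n → Ω → Fin m} {ξ : ℕ → Fin n → Ω → S}

/-- The draws of all nodes in iteration `k`. -/
def draw (ι : ℕ → Fin n → Ω → Fin m) (ξ : ℕ → Fin n → Ω → S) (k : ℕ) (ω : Ω) :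
    Fin n → Fin m × S := fun τ => (ι k τ ω, ξ k τ ω)

/-- The σ-algebra generated by the draws of the iterations `< k`. -/
@[reducible]
def history (ι : ℕ → Fin n → Ω → Fin m) (ξ : ℕ → Fin n → Ω → S) (k : ℕ) : MeasurableSpace Ω :=
  ⨆ p ∈ {p : ℕ × Fin n | p.1 < k},
    MeasurableSpace.comap (fun ω => (ι p.1 p.2 ω, ξ p.1 p.2 ω)) inferInstance

lemma history_mono {j k : ℕ} (hjk : j ≤ k) : history ι ξ j ≤ history ι ξ k :=
  biSup_mono fun _ hp => lt_of_lt_of_le hp hjk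

lemma measurable_draw_history (k : ℕ) : Measurable[history ι ξ (k + 1)] (draw ι ξ k) := by
  refine @measurable_pi_lambda _ _ _ (history ι ξ (k + 1)) _ _ fun τ => ?_
  refine Measurable.mono (comap_measurable _) ?_ le_rfl
  exact le_biSup (fun p : ℕ × Fin n =>
    MeasurableSpace.comap (fun ω => (ι p.1 p.2 ω, ξ p.1 p.2 ω)) inferInstance)
    (show (k, τ) ∈ {p : ℕ × Fin n | p.1 < k + 1} from Nat.lt_succ_self k)

variable [MeasurableSpace Ω] {μ : Measure Ω} {ν : Measure S}

lemma IsSampling.measurable_pair (h : IsSampling μ ν ι ξ) (k : ℕ) (τ : Fin n) :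
    Measurable fun ω => (ι k τ ω, ξ k τ ω) :=
  (h.measurable_index k τ).prodMk (h.measurable_seed k τ)

lemma IsSampling.measurable_draw (h : IsSampling μ ν ι ξ) (k : ℕ) : Measurable (draw ι ξ k) :=
  measurable_pi_lambda _ fun τ => h.measurable_pair k τ

lemma IsSampling.history_le (h : IsSampling μ ν ι ξ) (k : ℕ) : history ι ξ k ≤ ‹MeasurableSpace Ω› :=
  iSup₂_le fun p _ => (h.measurable_pair p.1 p.2).comap_le

/-- Draws before `k` and draws at `k` are indexed by disjoint sets of pairs, and disjoint groups of
an independent family generate independent σ-algebras. -/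
lemma IsSampling.indepFun_draw (h : IsSampling μ ν ι ξ) (k : ℕ) {E : Type*} [MeasurableSpace E]
    {f : Ω → E} (hf : Measurable[history ι ξ k] f) : IndepFun f (draw ι ξ k) μ := by
  have h1 := indep_iSup_of_disjoint (S := {p : ℕ × Fin n | p.1 < k})
    (T := {p : ℕ × Fin n | p.1 = k}) (fun p => (h.measurable_pair p.1 p.2).comap_le)
    ((iIndepFun_iff_iIndep _ _ _).1 h.indep)
    (Set.disjoint_left.2 fun p hp hq => absurd hq (ne_of_lt hp))
  rw [IndepFun_iff_Indep]
  refine indep_of_indep_of_le_left (indep_of_indep_of_le_right h1 ?_) hf.comap_le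
  refine Measurable.comap_le ?_
  refine @measurable_pi_lambda _ _ _ (_) _ _ fun τ => ?_
  refine Measurable.mono (comap_measurable _) ?_ le_rfl
  exact le_biSup (fun p : ℕ × Fin n =>
    MeasurableSpace.comap (fun ω => (ι p.1 p.2 ω, ξ p.1 p.2 ω)) inferInstance)
    (show (k, τ) ∈ {p : ℕ × Fin n | p.1 = k} from rfl)

variable [IsProbabilityMeasure μ]

lemma IsSampling.map_draw (h : IsSampling μ ν ι ξ) (k : ℕ) :
    μ.map (draw ι ξ k) = Measure.pi fun _ : Fin n => nodeLaw m ν := by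
  have h1 : iIndepFun (fun (τ : Fin n) ω => (ι k τ ω, ξ k τ ω)) μ :=
    h.indep.precomp (g := fun τ : Fin n => (k, τ)) (fun a b hab => by simpa using hab)
  have h2 := (iIndepFun_iff_map_fun_eq_pi_map
    fun τ => (h.measurable_pair k τ).aemeasurable).1 h1
  simp only [h.law] at h2
  exact h2

/-- Averaging over the fresh draws for an independent past. -/
lemma IsSampling.lintegral_comp_draw (h : IsSampling μ ν ι ξ) [IsProbabilityMeasure ν] (hm : 0 < m)
    (k : ℕ) {E : Type*} [MeasurableSpace E]
    {f : Ω → E} (hf : Measurable[history ι ξ k] f) {F : E × (Fin n → Fin m × S) → ℝ≥0∞}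
    (hF : Measurable F) :
    ∫⁻ ω, F (f ω, draw ι ξ k ω) ∂μ =
      ∫⁻ ω, ∫⁻ p, F (f ω, p) ∂(Measure.pi fun _ : Fin n => nodeLaw m ν) ∂μ := by
  have := isProbabilityMeasure_uniformOn_univ hm
  have hf' : Measurable f := hf.mono (h.history_le k) le_rfl
  have hd := h.measurable_draw k
  have h1 := (indepFun_iff_map_prod_eq_prod_map_map hf'.aemeasurable hd.aemeasurable).1
    (h.indepFun_draw k hf)
  rw [← lintegral_map hF (hf'.prodMk hd), h1, h.map_draw, lintegral_prod _ hF.aemeasurable,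
    lintegral_map hF.lintegral_prod_right' hf']

end Sampling

namespace Problem

variable {Ω S : Type*} {d t m n : ℕ} {ι : ℕ → Fin n → Ω → Fin m}
  {ξ : ℕ → Fin n → Ω → S} {P : Problem d t m n} {γ lam σ η θ : ℝ} {Q Q₁ : S → Vec d → Vec d}
  {s0 : State d t m n} {s : ℕ → Ω → State d t m n}

lemma IsRun.eq_next (hP : P.Regular γ lam) (hγ : 0 < γ) (hlam : 0 < lam) (hσ : 0 < σ) (hη : 0 < η)
    (hs : P.IsRun Q Q₁ σ η θ ι ξ s0 s) (k : ℕ) (ω : Ω) :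
    s (k + 1) ω = P.next Q Q₁ σ η θ (s k ω) (draw ι ξ k ω) :=
  (hs.step k ω).eq_next hP hγ hlam hσ hη

variable [MeasurableSpace S]

lemma IsRun.measurable_history (hP : P.Regular γ lam) (hγ : 0 < γ) (hlam : 0 < lam) (hσ : 0 < σ)
    (hη : 0 < η) (hQ : Measurable fun p : S × Vec d => Q p.1 p.2)
    (hQ₁ : Measurable fun p : S × Vec d => Q₁ p.1 p.2)
    (hs : P.IsRun Q Q₁ σ η θ ι ξ s0 s) (k : ℕ) : Measurable[history ι ξ k] (s k) := by
  induction k with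
  | zero =>
    have : s 0 = fun _ => s0 := funext hs.start
    rw [this]
    exact measurable_const
  | succ k ih =>
    have h1 : s (k + 1) = fun ω => P.next Q Q₁ σ η θ (s k ω) (draw ι ξ k ω) :=
      funext (hs.eq_next hP hγ hlam hσ hη k)
    rw [h1]
    have h2 : Measurable[history ι ξ (k + 1)] (s k) := ih.mono (history_mono k.le_succ) le_rfl
    have h3 : ∀ F : State d t m n × (Fin n → Fin m × S) → State d t m n, Measurable F →
        Measurable[history ι ξ (k + 1)] fun ω => F (s k ω, draw ι ξ k ω) := fun F hF =>
      hF.comp (h2.prodMk (measurable_draw_history k))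
    exact h3 _ (measurable_next hP hγ hlam hσ hη hQ hQ₁)

variable [MeasurableSpace Ω] {μ : Measure Ω} {ν : Measure S}

lemma IsRun.measurable (hP : P.Regular γ lam) (hγ : 0 < γ) (hlam : 0 < lam) (hσ : 0 < σ)
    (hη : 0 < η) (hQ : Measurable fun p : S × Vec d => Q p.1 p.2)
    (hQ₁ : Measurable fun p : S × Vec d => Q₁ p.1 p.2) (hsamp : IsSampling μ ν ι ξ)
    (hs : P.IsRun Q Q₁ σ η θ ι ξ s0 s) (k : ℕ) : Measurable (s k) :=
  (hs.measurable_history hP hγ hlam hσ hη hQ hQ₁ k).mono (hsamp.history_le k) le_rfl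

variable [IsProbabilityMeasure μ] [IsProbabilityMeasure ν]

/-- A drift inequality for one step gives geometric decay along the run. -/
lemma IsRun.lintegral_le (hm : 0 < m) (hP : P.Regular γ lam) (hγ : 0 < γ) (hlam : 0 < lam)
    (hσ : 0 < σ) (hη : 0 < η) (hQ : Measurable fun p : S × Vec d => Q p.1 p.2)
    (hQ₁ : Measurable fun p : S × Vec d => Q₁ p.1 p.2) (hsamp : IsSampling μ ν ι ξ)
    (hs : P.IsRun Q Q₁ σ η θ ι ξ s0 s) {F : State d t m n → ℝ≥0∞} (hF : Measurable F) {c : ℝ≥0∞}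
    (hdrift : ∀ k ω, ∫⁻ p, F (P.next Q Q₁ σ η θ (s k ω) p)
      ∂(Measure.pi fun _ : Fin n => nodeLaw m ν) ≤ c * F (s k ω)) (k : ℕ) :
    ∫⁻ ω, F (s k ω) ∂μ ≤ c ^ k * F s0 := by
  induction k with
  | zero =>
    simp only [hs.start]
    simp
  | succ k ih =>
    have hmeas := hs.measurable_history hP hγ hlam hσ hη hQ hQ₁ k
    have hFn : Measurable fun q : State d t m n × (Fin n → Fin m × S) =>
        F (P.next Q Q₁ σ η θ q.1 q.2) := hF.comp (measurable_next hP hγ hlam hσ hη hQ hQ₁)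
    simp only [hs.eq_next hP hγ hlam hσ hη k]
    rw [hsamp.lintegral_comp_draw hm k hmeas hFn]
    calc _ ≤ ∫⁻ ω, c * F (s k ω) ∂μ := lintegral_mono fun ω => hdrift k ω
      _ = c * ∫⁻ ω, F (s k ω) ∂μ :=
        lintegral_const_mul _ (hF.comp (hs.measurable hP hγ hlam hσ hη hQ hQ₁ hsamp k))
      _ ≤ c * (c ^ k * F s0) := by gcongr
      _ = _ := by rw [pow_succ]; ring

end Problem

/-! ### Averages over nodes and over the draws of one iteration. -/

section Averages

variable {d n : ℕ}

lemma avg_add (v w : Fin n → Vec d) : avg (fun τ => v τ + w τ) = avg v + avg w := by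
  simp only [avg, Finset.sum_add_distrib, smul_add]

lemma avg_sub (v w : Fin n → Vec d) : avg (fun τ => v τ - w τ) = avg v - avg w := by
  simp only [avg, Finset.sum_sub_distrib, smul_sub]

lemma avg_smul (c : ℝ) (v : Fin n → Vec d) : avg (fun τ => c • v τ) = c • avg v := by
  simp only [avg, ← Finset.smul_sum, smul_comm c]

lemma inner_avg (v : Fin n → Vec d) (x : Vec d) :
    ⟪avg v, x⟫_ℝ = 1 / (n : ℝ) * ∑ τ, ⟪v τ, x⟫_ℝ := by
  rw [avg, inner_smul_left, sum_inner]
  simp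

lemma norm_avg_sq (v : Fin n → Vec d) :
    ‖avg v‖ ^ 2 = 1 / (n : ℝ) ^ 2 * ‖∑ τ, v τ‖ ^ 2 := by
  rw [avg, norm_smul, mul_pow, Real.norm_eq_abs, sq_abs]
  simp

lemma norm_avg_sq_le (hn : 0 < n) (v : Fin n → Vec d) :
    ‖avg v‖ ^ 2 ≤ 1 / (n : ℝ) * ∑ τ, ‖v τ‖ ^ 2 :=
  norm_mean_sq_le hn v

/-- The second moment of an average of independent vectors. -/
lemma integral_norm_avg_sq {X : Type*} [MeasurableSpace X] {ρ : Measure X} [IsProbabilityMeasure ρ]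
    (f : Fin n → X → Vec d) (hf : ∀ τ, MemLp (f τ) 2 ρ) :
    Integrable (fun p : Fin n → X => ‖avg fun τ => f τ (p τ)‖ ^ 2) (Measure.pi fun _ => ρ) ∧
    ∫ p, ‖avg fun τ => f τ (p τ)‖ ^ 2 ∂(Measure.pi fun _ : Fin n => ρ) =
      ‖avg fun τ => ∫ x, f τ x ∂ρ‖ ^ 2
        + 1 / (n : ℝ) ^ 2 * ∑ τ, (∫ x, ‖f τ x‖ ^ 2 ∂ρ - ‖∫ x, f τ x ∂ρ‖ ^ 2) := by
  obtain ⟨h1, h2⟩ := integral_norm_sum_sq (ρ := fun _ : Fin n => ρ) f hf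
  simp only [norm_avg_sq]
  refine ⟨h1.const_mul _, ?_⟩
  rw [integral_const_mul, h2]
  ring

end Averages

section Draws

variable {S : Type*} [MeasurableSpace S] {ν : Measure S} [IsProbabilityMeasure ν] {d m n : ℕ}

/-- The joint law of the draws of all nodes in one iteration. -/
abbrev drawLaw (m n : ℕ) (ν : Measure S) : Measure (Fin n → Fin m × S) :=
  Measure.pi fun _ : Fin n => nodeLaw m ν

lemma integrable_index (hm : 0 < m) (f : Fin m → ℝ) (τ : Fin n) :
    Integrable (fun p : Fin n → Fin m × S => f (p τ).1) (drawLaw m n ν) := by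
  have := isProbabilityMeasure_uniformOn_univ hm
  refine integrable_comp_eval (X := fun _ : Fin n => Fin m × S) (f := fun q : Fin m × S => f q.1) ?_
  exact Integrable.comp_fst .of_finite ν

lemma integral_index (hm : 0 < m) (f : Fin m → ℝ) (τ : Fin n) :
    ∫ p : Fin n → Fin m × S, f (p τ).1 ∂(drawLaw m n ν) = 1 / (m : ℝ) * ∑ i, f i := by
  have := isProbabilityMeasure_uniformOn_univ hm
  have hi : Integrable (fun q : Fin m × S => f q.1) (nodeLaw m ν) :=
    Integrable.comp_fst .of_finite ν
  rw [integral_comp_eval (X := fun _ : Fin n => Fin m × S) (f := fun q : Fin m × S => f q.1) hi.1,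
    integral_nodeLaw hm hi]
  simp

lemma memLp_index (hm : 0 < m) (a : Fin m → Vec d) :
    MemLp (fun q : Fin m × S => a q.1) 2 (nodeLaw m ν) := by
  have := isProbabilityMeasure_uniformOn_univ hm
  exact (MemLp.of_discrete (f := a)
    (μ := uniformOn (Set.univ : Set (Fin m)))).comp_measurePreserving measurePreserving_fst

/-- The second moment of the average of independent uniformly drawn vectors. -/
lemma integral_norm_avg_index_sq_le (hm : 0 < m) (a : Fin n → Fin m → Vec d) :
    Integrable (fun p : Fin n → Fin m × S => ‖avg fun τ => a τ (p τ).1‖ ^ 2) (drawLaw m n ν) ∧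
    ∫ p, ‖avg fun τ => a τ (p τ).1‖ ^ 2 ∂(drawLaw m n ν) ≤
      ‖avg fun τ => mean (a τ)‖ ^ 2 + 1 / (n : ℝ) ^ 2 * ∑ τ, meanSq (a τ) := by
  have := isProbabilityMeasure_uniformOn_univ hm
  have hL : ∀ τ, MemLp (fun q : Fin m × S => a τ q.1) 2 (nodeLaw m ν) := fun τ =>
    memLp_index hm (a τ)
  obtain ⟨h1, h2⟩ := integral_norm_avg_sq (ρ := nodeLaw m ν) (fun τ q => a τ q.1) hL
  refine ⟨h1, ?_⟩
  rw [h2]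
  have e1 : ∀ τ, ∫ q : Fin m × S, a τ q.1 ∂(nodeLaw m ν) = mean (a τ) := fun τ => by
    rw [integral_nodeLaw hm ((hL τ).integrable (by norm_num))]
    simp [mean]
  have e2 : ∀ τ, ∫ q : Fin m × S, ‖a τ q.1‖ ^ 2 ∂(nodeLaw m ν) = meanSq (a τ) := fun τ => by
    rw [integral_nodeLaw hm (integrable_norm_sq (hL τ))]
    simp [meanSq]
  simp only [e1, e2]
  gcongr with τ
  have := sq_nonneg ‖mean (a τ)‖
  linarith

end Draws

/-! ### The Lyapunov function and its contraction in one step. -/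

namespace Problem

variable {d t m n : ℕ} (P : Problem d t m n)

/-- The average dual direction `(1/N) ∑ A_{iτ} y_{iτ}`. -/
def dualAvg (Y : Fin m → Fin n → Vec t) : Vec d :=
  (1 / ((m : ℝ) * n)) • ∑ τ, ∑ i, P.A i τ (Y i τ)

/-- The contribution of the block `(i, τ)` to the dual part of the Lyapunov function. -/
def blockPotential (γ σ : ℝ) (xs : Vec d) (Ys : Fin m → Fin n → Vec t) (i : Fin m) (τ : Fin n)
    (y : Vec t) : ℝ :=
  (1 / (2 * σ) + γ / 2) * ‖y - Ys i τ‖ ^ 2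
    + ((conj (P.φ i τ) y).toReal - (conj (P.φ i τ) (Ys i τ)).toReal
      - ⟪y - Ys i τ, (P.A i τ).adjoint xs⟫_ℝ)

/-- The squared length of the full dual proximal move at node `τ`, averaged over the indices. -/
def moveSq (σ : ℝ) (s : State d t m n) (τ : Fin n) : ℝ :=
  meanSq fun i => P.dualProx σ s i τ - s.y i τ

/-- The states reachable from an initial state with finite conjugates. -/
structure Admissible (s : State d t m n) : Prop where
  finite : P.DualFinite s.y
  u_eq : ∀ τ, s.u τ = (1 / (m : ℝ)) • ∑ i, P.A i τ (s.y i τ)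

/-- The difference `x^k - x^{k-1}` recovered from a state. -/
def momentum (θ : ℝ) (s : State d t m n) : Vec d := θ⁻¹ • (s.z - s.x)

/-- The part of the Lyapunov function that appears in the conclusion, with error potential `V`. -/
def basePotential (γ lam σ η : ℝ) (V : State d t m n → ℝ) (xs : Vec d) (Ys : Fin m → Fin n → Vec t)
    (s : State d t m n) : ℝ :=
  (1 / (2 * η) + lam / 4) * ‖s.x - η • avg s.e - xs‖ ^ 2
    + (1 / (4 * σ) + γ / 2) * (1 / n) * dualDist Ys s + V s + P.gapReal xs Ys s

/-- The Lyapunov function that contracts in expectation. -/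
def lyapunov (γ lam σ η θ : ℝ) (V : State d t m n → ℝ) (xs : Vec d) (Ys : Fin m → Fin n → Vec t)
    (s : State d t m n) : ℝ :=
  (1 / (2 * η) + lam / 4) * ‖s.x - η • avg s.e - xs‖ ^ 2
    + (1 / (2 * σ) + γ / 2) * (1 / n) * dualDist Ys s + V s + P.gapReal xs Ys s
    + ⟪avg s.u - P.dualAvg Ys, momentum θ s⟫_ℝ + 1 / (8 * η) * ‖momentum θ s‖ ^ 2

variable {P}

lemma meanSq_jump_le (σ : ℝ) (s : State d t m n) (τ : Fin n) :
    meanSq (P.jump σ s τ) ≤ P.Rm ^ 2 * P.moveSq σ s τ := by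
  rw [moveSq, meanSq, meanSq, mul_left_comm, Finset.mul_sum (a := P.Rm ^ 2)]
  refine mul_le_mul_of_nonneg_left (Finset.sum_le_sum fun i _ => ?_) (by positivity)
  rw [← mul_pow]
  refine pow_le_pow_left₀ (norm_nonneg _) ?_ 2
  exact ((P.A i τ).le_opNorm _).trans
    (mul_le_mul_of_nonneg_right (P.norm_A_le i τ) (norm_nonneg _))

lemma norm_mean_jump_sq_le (σ : ℝ) (s : State d t m n) (τ : Fin n) :
    ‖mean (P.jump σ s τ)‖ ^ 2 ≤ P.RbarSq * P.moveSq σ s τ :=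
  P.norm_node_avg_sq_le τ fun i => P.dualProx σ s i τ - s.y i τ

lemma moveSq_nonneg (σ : ℝ) (s : State d t m n) (τ : Fin n) : 0 ≤ P.moveSq σ s τ :=
  meanSq_nonneg _

lemma dualAvg_eq_avg (Y : Fin m → Fin n → Vec t) :
    P.dualAvg Y = avg fun τ => mean fun i => P.A i τ (Y i τ) := by
  simp only [dualAvg, avg, mean, ← Finset.smul_sum, smul_smul]
  congr 1
  rw [one_div_mul_one_div, mul_comm (n : ℝ)]

lemma dualAvg_sub (Y Y' : Fin m → Fin n → Vec t) :
    P.dualAvg (fun i τ => Y i τ - Y' i τ) = P.dualAvg Y - P.dualAvg Y' := by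
  simp only [dualAvg, map_sub, Finset.sum_sub_distrib, smul_sub]

lemma norm_dualAvg_sq_le (Y : Fin m → Fin n → Vec t) :
    ‖P.dualAvg Y‖ ^ 2 ≤ P.RSq * (1 / (n : ℝ) * ∑ τ, meanSq fun i => Y i τ) := by
  refine (P.norm_total_avg_sq_le Y).trans_eq ?_
  simp only [meanSq, ← Finset.mul_sum]
  rw [← mul_assoc (1 / (n : ℝ)), one_div_mul_one_div, mul_comm (n : ℝ)]

lemma norm_avg_mean_jump_sq_le (σ : ℝ) (s : State d t m n) :
    ‖avg fun τ => mean (P.jump σ s τ)‖ ^ 2 ≤ P.RSq * (1 / (n : ℝ) * ∑ τ, P.moveSq σ s τ) := by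
  have h := norm_dualAvg_sq_le (P := P) fun i τ => P.dualProx σ s i τ - s.y i τ
  rw [dualAvg_eq_avg] at h
  exact h

lemma Admissible.avg_u {s : State d t m n} (hs : P.Admissible s) : avg s.u = P.dualAvg s.y := by
  rw [dualAvg_eq_avg]
  congr 1
  funext τ
  exact hs.u_eq τ

lemma saddleReal_sub_primal (x xs : Vec d) (Y : Fin m → Fin n → Vec t) :
    P.saddleReal x Y - P.saddleReal xs Y = P.g x - P.g xs + ⟪P.dualAvg Y, x - xs⟫_ℝ := by
  have e : ∀ x : Vec d, ⟪P.dualAvg Y, x⟫_ℝ =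
      1 / ((m : ℝ) * n) * ∑ τ, ∑ i, ⟪Y i τ, (P.A i τ).adjoint x⟫_ℝ := by
    intro x
    rw [dualAvg, inner_smul_left, sum_inner]
    simp only [sum_inner, ContinuousLinearMap.adjoint_inner_right]
    simp
  rw [inner_sub_right, e, e, saddleReal, saddleReal]
  simp only [Finset.sum_sub_distrib]
  ring

/-- The factor `m` cancels the `1/m` inside the saddle function, leaving `1/n` times a sum of
separate block terms. In this form the random update of one block per node can be averaged
blockwise. -/
lemma saddleReal_sub_dual (hm : 0 < m) (γ σ : ℝ) (xs : Vec d) (Ys : Fin m → Fin n → Vec t)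
    (s : State d t m n) :
    (1 / (2 * σ) + γ / 2) * (1 / n) * dualDist Ys s
      + m * (P.saddleReal xs Ys - P.saddleReal xs s.y) =
    1 / (n : ℝ) * ∑ τ, ∑ i, P.blockPotential γ σ xs Ys i τ (s.y i τ) := by
  have hm' : (m : ℝ) ≠ 0 := by exact_mod_cast hm.ne'
  have e : (m : ℝ) * (P.saddleReal xs Ys - P.saddleReal xs s.y) = 1 / (n : ℝ) *
      (∑ τ, ∑ i, (⟪Ys i τ, (P.A i τ).adjoint xs⟫_ℝ - (conj (P.φ i τ) (Ys i τ)).toReal)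
        - ∑ τ, ∑ i, (⟪s.y i τ, (P.A i τ).adjoint xs⟫_ℝ - (conj (P.φ i τ) (s.y i τ)).toReal)) := by
    rw [saddleReal, saddleReal]
    field_simp
    ring
  rw [e, dualDist]
  simp only [blockPotential, inner_sub_left, Finset.sum_sub_distrib, Finset.sum_add_distrib,
    ← Finset.mul_sum]
  ring

/-- Quadratic growth of the dual proximal step tested at the saddle point; strong convexity of the
conjugate provides the `γ/2` inside `blockPotential`. -/
lemma growth_dual {γ lam σ : ℝ} (hP : P.Regular γ lam) (hγ : 0 < γ) (hσ : 0 < σ) (xs : Vec d)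
    {Ys : Fin m → Fin n → Vec t} (hYs : P.DualFinite Ys) (s : State d t m n) (i : Fin m)
    (τ : Fin n) : P.blockPotential γ σ xs Ys i τ (P.dualProx σ s i τ) ≤
      1 / (2 * σ) * ‖s.y i τ - Ys i τ‖ ^ 2 - 1 / (2 * σ) * ‖P.dualProx σ s i τ - s.y i τ‖ ^ 2
        + ⟪P.A i τ (P.dualProx σ s i τ - Ys i τ), s.z - xs⟫_ℝ := by
  have hh := hP.isProxable_conj hγ i τ
  set y' := P.dualProx σ s i τ with hy'
  have h : (conj (P.φ i τ) y').toReal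
      + (⟪-(P.A i τ).adjoint s.z, y'⟫_ℝ + ‖y' - s.y i τ‖ ^ 2 / (2 * σ))
      + (γ / 2 + 1 / (2 * σ)) * ‖y' - Ys i τ‖ ^ 2 ≤ (conj (P.φ i τ) (Ys i τ)).toReal
      + (⟪-(P.A i τ).adjoint s.z, Ys i τ⟫_ℝ + ‖Ys i τ - s.y i τ‖ ^ 2 / (2 * σ)) :=
    hh.growth hσ (hh.isMinOn_prox hσ (-(P.A i τ).adjoint s.z) (s.y i τ)) (hYs i τ)
  rw [inner_neg_left, inner_neg_left, ContinuousLinearMap.adjoint_inner_left,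
    ContinuousLinearMap.adjoint_inner_left, norm_sub_rev (Ys i τ)] at h
  rw [blockPotential, ContinuousLinearMap.adjoint_inner_right, inner_sub_right, map_sub,
    inner_sub_left, inner_sub_left, real_inner_comm s.z, real_inner_comm s.z]
  have e1 : ‖y' - s.y i τ‖ ^ 2 / (2 * σ) = 1 / (2 * σ) * ‖y' - s.y i τ‖ ^ 2 := by ring
  have e2 : ‖s.y i τ - Ys i τ‖ ^ 2 / (2 * σ) = 1 / (2 * σ) * ‖s.y i τ - Ys i τ‖ ^ 2 := by ring
  rw [e1, e2] at h
  linarith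

section Next

variable {S : Type*} {Q Q₁ : S → Vec d → Vec d} {γ lam σ η θ : ℝ}

lemma dualFinite_next (hP : P.Regular γ lam) (hγ : 0 < γ) (hσ : 0 < σ) {s : State d t m n}
    (hs : P.DualFinite s.y) (p : Fin n → Fin m × S) :
    P.DualFinite (P.next Q Q₁ σ η θ s p).y := by
  intro i τ
  simp only [next]
  split_ifs with h
  · have hh := hP.isProxable_conj hγ i τ
    exact hh.ne_top_of_isMinOn (hh.isMinOn_prox hσ _ _)
  · exact hs i τ

lemma Admissible.next (hP : P.Regular γ lam) (hγ : 0 < γ) (hσ : 0 < σ) {s : State d t m n}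
    (hs : P.Admissible s) (p : Fin n → Fin m × S) :
    P.Admissible (P.next Q Q₁ σ η θ s p) := by
  refine ⟨dualFinite_next hP hγ hσ hs.finite p, fun τ => ?_⟩
  have e : ∑ i, P.A i τ ((P.next Q Q₁ σ η θ s p).y i τ) =
      ∑ i, P.A i τ (s.y i τ) + P.jump σ s τ (p τ).1 := by
    rw [← Finset.add_sum_erase _ _ (Finset.mem_univ (p τ).1),
      ← Finset.add_sum_erase _ (fun i => P.A i τ (s.y i τ)) (Finset.mem_univ (p τ).1)]
    have h1 : ∀ i ∈ Finset.univ.erase (p τ).1, P.A i τ ((P.next Q Q₁ σ η θ s p).y i τ) =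
        P.A i τ (s.y i τ) := fun i hi => by
      simp only [Problem.next]
      rw [if_neg (Finset.ne_of_mem_erase hi)]
    rw [Finset.sum_congr rfl h1]
    simp only [Problem.next, if_true, jump, map_sub]
    abel
  rw [e, smul_add, ← hs.u_eq τ]
  rfl

/-- Each compressed message is the message minus the new error, and the `-h` in the message cancels
the `h` added by the server. Compression thus perturbs the direction only by `e - e'`, the discrete
derivative of the error. -/
lemma tilt_eq (s : State d t m n) (p : Fin n → Fin m × S) :
    P.tilt Q σ s p = avg s.u + (avg fun τ => P.jump σ s τ (p τ).1) + avg s.e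
      - avg (P.next Q Q₁ σ η θ s p).e := by
  have e : (fun τ => Q (p τ).2 (P.jump σ s τ (p τ).1 + (s.u τ - s.h τ + s.e τ))) =
      fun τ => (P.jump σ s τ (p τ).1 + ((s.u τ - s.h τ) + s.e τ))
        - (P.next Q Q₁ σ η θ s p).e τ := by
    funext τ
    simp only [next, compErr]
    abel
  rw [tilt, e, avg_sub, avg_add, avg_add, avg_sub]
  abel

lemma avg_u_next (s : State d t m n) (p : Fin n → Fin m × S) :
    avg (P.next Q Q₁ σ η θ s p).u =
      avg s.u + (1 / (m : ℝ)) • avg fun τ => P.jump σ s τ (p τ).1 := by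
  rw [← avg_smul, ← avg_add]
  rfl

lemma momentum_next (hθ : θ ≠ 0) (s : State d t m n) (p : Fin n → Fin m × S) :
    momentum θ (P.next Q Q₁ σ η θ s p) = (P.next Q Q₁ σ η θ s p).x - s.x := by
  simp only [momentum, next]
  rw [add_sub_cancel_left, smul_smul, inv_mul_cancel₀ hθ, one_smul]

end Next

/-- Passing from `X` to `X - ηe'` and from `Y` to `Y - ηe` removes `⟨e', X⟩` and leaves `⟨e, X -
Y⟩`. The square of `(X - Y) + 2ηe` pays for the latter with half of the `‖X - Y‖²` term. The square
of `X + ηe'` moves the `lam` term to the virtual point, which halves it and creates the `lam * η²`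
cost. -/
lemma perturbed_prox_le {η lam Δ : ℝ} (hη : 0 < η) (hlam : 0 ≤ lam) (w e e' X Y : Vec d)
    (h : Δ + ⟪w + e - e', X⟫_ℝ + 1 / (2 * η) * ‖X - Y‖ ^ 2 + (lam / 2 + 1 / (2 * η)) * ‖X‖ ^ 2 ≤
      1 / (2 * η) * ‖Y‖ ^ 2) :
    (1 / (2 * η) + lam / 4) * ‖X - η • e'‖ ^ 2 + Δ + ⟪w, X⟫_ℝ + 1 / (4 * η) * ‖X - Y‖ ^ 2 ≤
      1 / (2 * η) * ‖Y - η • e‖ ^ 2 + η / 2 * ‖e‖ ^ 2 + (η / 2 + lam * η ^ 2 / 2) * ‖e'‖ ^ 2 := by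
  have h1 : ‖X - η • e'‖ ^ 2 = ‖X‖ ^ 2 - 2 * η * ⟪e', X⟫_ℝ + η ^ 2 * ‖e'‖ ^ 2 := by
    rw [norm_sub_sq_real, inner_smul_right, norm_smul, mul_pow, Real.norm_eq_abs, sq_abs,
      real_inner_comm]
    ring
  have h2 : ‖Y - η • e‖ ^ 2 = ‖Y‖ ^ 2 - 2 * η * ⟪e, Y⟫_ℝ + η ^ 2 * ‖e‖ ^ 2 := by
    rw [norm_sub_sq_real, inner_smul_right, norm_smul, mul_pow, Real.norm_eq_abs, sq_abs,
      real_inner_comm]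
    ring
  have h3 : 0 ≤ 1 / (4 * η) * ‖(X - Y) + (2 * η) • e‖ ^ 2 := by positivity
  have h3' : 1 / (4 * η) * ‖(X - Y) + (2 * η) • e‖ ^ 2 =
      1 / (4 * η) * ‖X - Y‖ ^ 2 + (⟪e, X⟫_ℝ - ⟪e, Y⟫_ℝ) + η * ‖e‖ ^ 2 := by
    rw [norm_add_sq_real, inner_smul_right, norm_smul, mul_pow, Real.norm_eq_abs, sq_abs,
      real_inner_comm, inner_sub_right]
    field_simp
    ring
  have h4 : 0 ≤ lam / 4 * ‖X + η • e'‖ ^ 2 := by positivity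
  have h4' : ‖X + η • e'‖ ^ 2 = ‖X‖ ^ 2 + 2 * η * ⟪e', X⟫_ℝ + η ^ 2 * ‖e'‖ ^ 2 := by
    rw [norm_add_sq_real, inner_smul_right, norm_smul, mul_pow, Real.norm_eq_abs, sq_abs,
      real_inner_comm]
    ring
  rw [h3'] at h3
  rw [h4'] at h4
  rw [inner_sub_left, inner_add_left] at h
  have h5 : 1 / (2 * η) * ‖X - Y‖ ^ 2 = 2 * (1 / (4 * η) * ‖X - Y‖ ^ 2) := by field_simp; ring
  have h6 : (1 / (2 * η) + lam / 4) * ‖X - η • e'‖ ^ 2 =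
      1 / (2 * η) * ‖X‖ ^ 2 - ⟪e', X⟫_ℝ + η / 2 * ‖e'‖ ^ 2
        + lam / 4 * (‖X‖ ^ 2 - 2 * η * ⟪e', X⟫_ℝ + η ^ 2 * ‖e'‖ ^ 2) := by
    rw [h1]
    field_simp
  have h7 : 1 / (2 * η) * ‖Y - η • e‖ ^ 2 =
      1 / (2 * η) * ‖Y‖ ^ 2 - ⟪e, Y⟫_ℝ + η / 2 * ‖e‖ ^ 2 := by
    rw [h2]
    field_simp
  rw [h6, h7]
  rw [h5] at h
  linarith

/-- The weight `1/(8η)` is half of the `1/(4η)` left on the primal displacement by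
`perturbed_prox_le`. -/
lemma young_inner_le {η : ℝ} (hη : 0 < η) (a b : Vec d) :
    ⟪a, b⟫_ℝ ≤ 2 * η * ‖a‖ ^ 2 + 1 / (8 * η) * ‖b‖ ^ 2 := by
  refine (real_inner_le_norm a b).trans ?_
  have h : 2 * η * ‖a‖ ^ 2 + 1 / (8 * η) * ‖b‖ ^ 2 - ‖a‖ * ‖b‖ =
      1 / (8 * η) * (4 * η * ‖a‖ - ‖b‖) ^ 2 := by
    field_simp
    ring
  have : 0 ≤ 1 / (8 * η) * (4 * η * ‖a‖ - ‖b‖) ^ 2 := by positivity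
  linarith

end Problem

namespace Problem

variable {d t m n : ℕ} {P : Problem d t m n} {S : Type*} {Q Q₁ : S → Vec d → Vec d}
  {γ lam σ η θ : ℝ}

/-- A pathwise bound for the Lyapunov function after one step which is free of the new primal
iterate. -/
lemma lyapunov_next_le (hm : 0 < m) (hP : P.Regular γ lam) (hlam : 0 < lam) (hη : 0 < η)
    (hθ : θ ≠ 0) (V : State d t m n → ℝ) (xs : Vec d) (Ys : Fin m → Fin n → Vec t)
    (s : State d t m n) (p : Fin n → Fin m × S) :
    P.lyapunov γ lam σ η θ V xs Ys (P.next Q Q₁ σ η θ s p) ≤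
      1 / (2 * η) * ‖s.x - η • avg s.e - xs‖ ^ 2
      + (η + lam * η ^ 2) / 2 * ‖avg s.e‖ ^ 2
      + (V (P.next Q Q₁ σ η θ s p)
        + (η + lam * η ^ 2) / 2 * ‖avg (P.next Q Q₁ σ η θ s p).e‖ ^ 2)
      + 2 * η * ‖avg fun τ => P.jump σ s τ (p τ).1‖ ^ 2
      - ⟪avg s.u - P.dualAvg Ys, s.x - xs⟫_ℝ
      - ⟪avg fun τ => P.jump σ s τ (p τ).1, s.x - xs⟫_ℝ
      + 1 / (n : ℝ) * ∑ τ, ∑ i,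
        P.blockPotential γ σ xs Ys i τ ((P.next Q Q₁ σ η θ s p).y i τ) := by
  have hm1 : (1 : ℝ) ≤ m := by exact_mod_cast hm
  set s' := P.next Q Q₁ σ η θ s p with hs'
  set a := avg fun τ => P.jump σ s τ (p τ).1 with ha
  have hgr : P.g s'.x + (⟪P.tilt Q σ s p, s'.x⟫_ℝ + ‖s'.x - s.x‖ ^ 2 / (2 * η))
      + (lam / 2 + 1 / (2 * η)) * ‖s'.x - xs‖ ^ 2 ≤
      P.g xs + (⟪P.tilt Q σ s p, xs⟫_ℝ + ‖xs - s.x‖ ^ 2 / (2 * η)) :=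
    (hP.isProxable_g hlam).growth hη ((hP.isProxable_g hlam).isMinOn_prox hη _ _)
      (EReal.coe_ne_top _)
  rw [tilt_eq (Q₁ := Q₁) (η := η) (θ := θ), ← hs', ← ha] at hgr
  have hXY : (s'.x - xs) - (s.x - xs) = s'.x - s.x := by abel
  have hpp := perturbed_prox_le (Δ := P.g s'.x - P.g xs) hη hlam.le (avg s.u + a) (avg s.e)
    (avg s'.e) (s'.x - xs) (s.x - xs) (by
      rw [hXY, inner_sub_right, norm_sub_rev s.x xs]
      have e1 : ‖s'.x - s.x‖ ^ 2 / (2 * η) = 1 / (2 * η) * ‖s'.x - s.x‖ ^ 2 := by ring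
      have e2 : ‖xs - s.x‖ ^ 2 / (2 * η) = 1 / (2 * η) * ‖xs - s.x‖ ^ 2 := by ring
      rw [e1, e2] at hgr
      linarith)
  rw [hXY] at hpp
  have e3 : s'.x - xs - η • avg s'.e = s'.x - η • avg s'.e - xs := by abel
  have e4 : s.x - xs - η • avg s.e = s.x - η • avg s.e - xs := by abel
  rw [e3, e4] at hpp
  have hdual := saddleReal_sub_dual hm γ σ xs Ys s' (P := P)
  have hprim := saddleReal_sub_primal s'.x xs Ys (P := P)
  have hmom := momentum_next (P := P) (Q := Q) (Q₁ := Q₁) (σ := σ) (η := η) hθ s p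
  have hu := avg_u_next (P := P) (Q := Q) (Q₁ := Q₁) (σ := σ) (η := η) (θ := θ) s p
  rw [← hs'] at hmom hu
  rw [← ha] at hu
  rw [lyapunov, gapReal, hprim, hmom, hu]
  have hy := young_inner_le hη (-a) (s'.x - s.x)
  rw [norm_neg, inner_neg_left] at hy
  have hB : 0 ≤ 2 * η * ‖a‖ ^ 2 + 1 / (8 * η) * ‖s'.x - s.x‖ ^ 2 := by positivity
  have hk0 : 0 ≤ 1 - 1 / (m : ℝ) := by
    rw [sub_nonneg, div_le_one (by linarith)]; exact hm1
  have hk1 : 1 - 1 / (m : ℝ) ≤ 1 := by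
    have : 0 ≤ 1 / (m : ℝ) := by positivity
    linarith
  -- The primal direction contains the whole jump `a`, but the new `u` only `a / m`; the remaining
  -- fraction `1 - 1/m` of the inner product has to be paid for.
  have hy2 : (1 - 1 / (m : ℝ)) * -⟪a, s'.x - s.x⟫_ℝ ≤
      2 * η * ‖a‖ ^ 2 + 1 / (8 * η) * ‖s'.x - s.x‖ ^ 2 :=
    (mul_le_mul_of_nonneg_left hy hk0).trans (mul_le_of_le_one_left hB hk1)
  have e5 : ⟪avg s.u + (1 / (m : ℝ)) • a - P.dualAvg Ys, s'.x - s.x⟫_ℝ =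
      ⟪avg s.u, s'.x - s.x⟫_ℝ + 1 / (m : ℝ) * ⟪a, s'.x - s.x⟫_ℝ
        - ⟪P.dualAvg Ys, s'.x - s.x⟫_ℝ := by
    rw [inner_sub_left, inner_add_left, real_inner_smul_left]
  have e6 : ∀ v : Vec d, ⟪v, s'.x - xs⟫_ℝ = ⟪v, s'.x - s.x⟫_ℝ + ⟪v, s.x - xs⟫_ℝ := by
    intro v
    rw [← inner_add_right, sub_add_sub_cancel]
  rw [inner_add_left, e6, e6] at hpp
  rw [e5, e6 (P.dualAvg Ys), inner_sub_left]
  -- One half becomes the momentum square of the new Lyapunov value, the other half pays for `hy2`.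
  have e7 : 1 / (4 * η) * ‖s'.x - s.x‖ ^ 2 = 2 * (1 / (8 * η) * ‖s'.x - s.x‖ ^ 2) := by
    field_simp
    ring
  rw [e7] at hpp
  have e8 : 0 ≤ lam * η ^ 2 / 2 * ‖avg s.e‖ ^ 2 := by positivity
  rw [← hdual]
  linarith

/-- The momentum product is split by Young's inequality. Its dual part is at most `D/(4σn)`, since
`8ησR² ≤ 1`; this is the reserve between the weights `1/(2σ)` and `1/(4σ)`. -/
lemma basePotential_le_lyapunov (hm : 0 < m) {s : State d t m n} (hs : P.Admissible s)
    (hσ : 0 < σ) (hη : 0 < η) (hR : 8 * η * σ * P.RSq ≤ 1) (V : State d t m n → ℝ) (xs : Vec d)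
    (Ys : Fin m → Fin n → Vec t) :
    P.basePotential γ lam σ η V xs Ys s ≤ P.lyapunov γ lam σ η θ V xs Ys s := by
  have hm1 : (1 : ℝ) ≤ m := by exact_mod_cast hm
  have h1 := young_inner_le hη (-(avg s.u - P.dualAvg Ys)) (momentum θ s)
  rw [norm_neg, inner_neg_left, hs.avg_u, ← dualAvg_sub] at h1
  have h2 : ‖P.dualAvg fun i τ => s.y i τ - Ys i τ‖ ^ 2 ≤
      P.RSq * (1 / (m : ℝ) * (1 / n * dualDist Ys s)) := by
    refine (norm_dualAvg_sq_le _).trans_eq ?_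
    simp only [meanSq, dualDist, ← Finset.mul_sum]
    ring
  have hD : 0 ≤ dualDist Ys s := by unfold dualDist; positivity
  have h3 : 2 * η * ‖P.dualAvg fun i τ => s.y i τ - Ys i τ‖ ^ 2 ≤
      1 / (4 * σ) * (1 / n) * dualDist Ys s := by
    have h4 : 1 / (m : ℝ) ≤ 1 := by rw [div_le_one (by linarith)]; exact hm1
    set D := 1 / (n : ℝ) * dualDist Ys s with hDd
    have hD' : 0 ≤ D := by positivity
    have hRS := P.RSq_nonneg
    have h5 : P.RSq * (1 / (m : ℝ) * D) ≤ P.RSq * D :=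
      mul_le_mul_of_nonneg_left (mul_le_of_le_one_left hD' h4) hRS
    have h6 : 2 * η * (P.RSq * D) = 8 * η * σ * P.RSq * (1 / (4 * σ) * D) := by
      field_simp
      ring
    have h7 : 8 * η * σ * P.RSq * (1 / (4 * σ) * D) ≤ 1 / (4 * σ) * D :=
      mul_le_of_le_one_left (by positivity) hR
    calc _ ≤ 2 * η * (P.RSq * D) := by
          refine mul_le_mul_of_nonneg_left (h2.trans h5) (by positivity)
      _ ≤ 1 / (4 * σ) * D := h6.trans_le h7
      _ = _ := by rw [hDd]; ring
  rw [basePotential, lyapunov, hs.avg_u, ← dualAvg_sub]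
  have e : 1 / (2 * σ) = 2 * (1 / (4 * σ)) := by field_simp; ring
  rw [e]
  linarith

/-- Without momentum only the reserve in the dual weight distinguishes the two functions. It is the
extra `D⁰` term in the theorem. -/
lemma lyapunov_eq_of_z_eq_x {s : State d t m n} (hz : s.z = s.x) (hσ : 0 < σ)
    (V : State d t m n → ℝ) (xs : Vec d) (Ys : Fin m → Fin n → Vec t) :
    P.lyapunov γ lam σ η θ V xs Ys s = P.basePotential γ lam σ η V xs Ys s
      + 1 / (4 * σ * n) * dualDist Ys s := by
  have e : 1 / (2 * σ) = 2 * (1 / (4 * σ)) := by field_simp; ring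
  have e2 : 1 / (4 * σ * n) = 1 / (4 * σ) * (1 / n) := by rw [one_div_mul_one_div]
  simp only [lyapunov, basePotential, momentum, hz, sub_self, smul_zero, inner_zero_right, norm_zero]
  rw [e, e2]
  ring

variable [MeasurableSpace S] {ν : Measure S} [IsProbabilityMeasure ν]

lemma integral_blockPotential_next (hm : 0 < m) (xs : Vec d) (Ys : Fin m → Fin n → Vec t)
    (s : State d t m n) (i : Fin m) (τ : Fin n) :
    Integrable (fun p : Fin n → Fin m × S =>
      P.blockPotential γ σ xs Ys i τ ((P.next Q Q₁ σ η θ s p).y i τ)) (drawLaw m n ν) ∧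
    ∫ p, P.blockPotential γ σ xs Ys i τ ((P.next Q Q₁ σ η θ s p).y i τ) ∂(drawLaw m n ν) =
      1 / (m : ℝ) * P.blockPotential γ σ xs Ys i τ (P.dualProx σ s i τ)
        + (1 - 1 / (m : ℝ)) * P.blockPotential γ σ xs Ys i τ (s.y i τ) := by
  have hm' : (m : ℝ) ≠ 0 := by exact_mod_cast hm.ne'
  set f : Fin m → ℝ := fun j =>
    P.blockPotential γ σ xs Ys i τ (if i = j then P.dualProx σ s i τ else s.y i τ) with hf
  have h1 := integrable_index (ν := ν) hm f τ
  have h2 := integral_index (ν := ν) hm f τ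
  refine ⟨h1, ?_⟩
  have e : ∀ p : Fin n → Fin m × S,
      P.blockPotential γ σ xs Ys i τ ((P.next Q Q₁ σ η θ s p).y i τ) = f (p τ).1 := fun p => rfl
  simp only [e]
  rw [h2]
  have h3 : ∀ j, f j = P.blockPotential γ σ xs Ys i τ (s.y i τ) + if i = j then
      P.blockPotential γ σ xs Ys i τ (P.dualProx σ s i τ)
        - P.blockPotential γ σ xs Ys i τ (s.y i τ) else 0 := by
    intro j
    simp only [hf]
    split_ifs <;> ring
  simp only [h3, Finset.sum_add_distrib, Finset.sum_const, Finset.card_univ, Fintype.card_fin,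
    Finset.sum_ite_eq, Finset.mem_univ, if_true, nsmul_eq_mul]
  field_simp
  ring

/-- The expected dual potential after one step. -/
lemma dual_drift (hm : 0 < m) (hn : 0 < n) (hP : P.Regular γ lam) (hγ : 0 < γ) (hσ : 0 < σ)
    {xs : Vec d} {Ys : Fin m → Fin n → Vec t} (hYs : P.DualFinite Ys)
    {s : State d t m n} (hs : P.Admissible s) :
    1 / (n : ℝ) * ∑ τ, ∑ i, (1 / (m : ℝ) * P.blockPotential γ σ xs Ys i τ (P.dualProx σ s i τ)
        + (1 - 1 / (m : ℝ)) * P.blockPotential γ σ xs Ys i τ (s.y i τ)) ≤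
      (1 - 1 / (m : ℝ)) * ((1 / (2 * σ) + γ / 2) * (1 / n) * dualDist Ys s
        + m * (P.saddleReal xs Ys - P.saddleReal xs s.y))
      + 1 / (2 * σ) * (1 / (m : ℝ)) * (1 / n * dualDist Ys s)
      - 1 / (2 * σ) * (1 / (n : ℝ) * ∑ τ, P.moveSq σ s τ)
      + ⟪avg s.u - P.dualAvg Ys + avg fun τ => mean (P.jump σ s τ), s.z - xs⟫_ℝ := by
  have h1 : ∑ τ, ∑ i, P.blockPotential γ σ xs Ys i τ (P.dualProx σ s i τ) ≤
      ∑ τ, ∑ i, (1 / (2 * σ) * ‖s.y i τ - Ys i τ‖ ^ 2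
        - 1 / (2 * σ) * ‖P.dualProx σ s i τ - s.y i τ‖ ^ 2
        + ⟪P.A i τ (P.dualProx σ s i τ - Ys i τ), s.z - xs⟫_ℝ) :=
    Finset.sum_le_sum fun τ _ => Finset.sum_le_sum fun i _ =>
      growth_dual hP hγ hσ xs hYs s i τ
  have h2 : avg s.u - P.dualAvg Ys + avg (fun τ => mean (P.jump σ s τ)) =
      -- By admissibility `avg s.u` is the dual average of the current blocks, so adding the mean
      -- jump gives the dual average of the fully updated ones.
      P.dualAvg fun i τ => P.dualProx σ s i τ - Ys i τ := by
    have h3 : avg (fun τ => mean (P.jump σ s τ)) =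
        P.dualAvg fun i τ => P.dualProx σ s i τ - s.y i τ := by
      rw [dualAvg_eq_avg]; rfl
    rw [h3, hs.avg_u, dualAvg_sub, dualAvg_sub]
    abel
  have h4 : ⟪P.dualAvg fun i τ => P.dualProx σ s i τ - Ys i τ, s.z - xs⟫_ℝ =
      1 / (m : ℝ) * (1 / n * ∑ τ, ∑ i, ⟪P.A i τ (P.dualProx σ s i τ - Ys i τ), s.z - xs⟫_ℝ) := by
    rw [dualAvg, real_inner_smul_left, sum_inner]
    simp only [sum_inner]
    rw [← mul_assoc (1 / (m : ℝ)), one_div_mul_one_div]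
  have h5 := mul_le_mul_of_nonneg_left h1 (by positivity : 0 ≤ 1 / (m : ℝ) * (1 / n))
  rw [h2, h4, saddleReal_sub_dual hm γ σ xs Ys s]
  simp only [Finset.sum_add_distrib, Finset.sum_sub_distrib, ← Finset.mul_sum] at h5 ⊢
  have h6 : ∑ τ, P.moveSq σ s τ =
      1 / (m : ℝ) * ∑ τ, ∑ i, ‖P.dualProx σ s i τ - s.y i τ‖ ^ 2 := by
    simp only [moveSq, meanSq, ← Finset.mul_sum]
  rw [h6, dualDist]
  linarith

/-- One step contracts the Lyapunov function in expectation if the error potential `V` drifts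
downwards. -/
theorem lintegral_lyapunov_next_le (hm : 0 < m) (hn : 0 < n) (hP : P.Regular γ lam) (hγ : 0 < γ)
    (hlam : 0 < lam) (hσ : 0 < σ) (hη : 0 < η) (hθ0 : 0 < θ) (hθ1 : θ ≤ 1)
    (hθx : 1 / (2 * η) ≤ θ * (1 / (2 * η) + lam / 4)) (hθm : 1 - 1 / (m : ℝ) ≤ θ)
    (hθy : (1 / (2 * σ) + γ / 2) * (1 - θ) ≤ γ / 2 * (1 / m))
    {κ : ℝ} (hκ : 4 * η * (P.RSq + P.Rm ^ 2 / n) + κ ≤ 1 / (2 * σ))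
    {xs : Vec d} {Ys : Fin m → Fin n → Vec t} (hsad : P.IsSaddlePoint xs Ys)
    {s : State d t m n} (hs : P.Admissible s) {V : State d t m n → ℝ}
    (hVi : Integrable (fun p => V (P.next Q Q₁ σ η θ s p)
      + (η + lam * η ^ 2) / 2 * ‖avg (P.next Q Q₁ σ η θ s p).e‖ ^ 2) (drawLaw m n ν))
    (hV : ∫ p, (V (P.next Q Q₁ σ η θ s p)
      + (η + lam * η ^ 2) / 2 * ‖avg (P.next Q Q₁ σ η θ s p).e‖ ^ 2) ∂(drawLaw m n ν)
      + (η + lam * η ^ 2) / 2 * ‖avg s.e‖ ^ 2 ≤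
      θ * V s + κ * (1 / n * ∑ τ, P.moveSq σ s τ))
    (hnn : ∀ p : Fin n → Fin m × S, 0 ≤ P.lyapunov γ lam σ η θ V xs Ys (P.next Q Q₁ σ η θ s p)) :
    ∫⁻ p, ENNReal.ofReal (P.lyapunov γ lam σ η θ V xs Ys (P.next Q Q₁ σ η θ s p))
      ∂(drawLaw m n ν) ≤ ENNReal.ofReal θ * ENNReal.ofReal (P.lyapunov γ lam σ η θ V xs Ys s) := by
  have := isProbabilityMeasure_uniformOn_univ hm
  have hYs := hsad.dualFinite hP
  set a : (Fin n → Fin m × S) → Vec d := fun p => avg fun τ => P.jump σ s τ (p τ).1 with ha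
  set abar : Vec d := avg fun τ => mean (P.jump σ s τ) with habar
  set W : (Fin n → Fin m × S) → ℝ := fun p => V (P.next Q Q₁ σ η θ s p)
      + (η + lam * η ^ 2) / 2 * ‖avg (P.next Q Q₁ σ η θ s p).e‖ ^ 2 with hW
  set Ψ : (Fin n → Fin m × S) → ℝ := fun p => 1 / (n : ℝ) * ∑ τ, ∑ i,
    P.blockPotential γ σ xs Ys i τ ((P.next Q Q₁ σ η θ s p).y i τ) with hΨ
  set c : ℝ := 1 / (2 * η) * ‖s.x - η • avg s.e - xs‖ ^ 2
      + (η + lam * η ^ 2) / 2 * ‖avg s.e‖ ^ 2 - ⟪avg s.u - P.dualAvg Ys, s.x - xs⟫_ℝ with hc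
  have hpt : ∀ p, P.lyapunov γ lam σ η θ V xs Ys (P.next Q Q₁ σ η θ s p) ≤
      (((c + W p) + 2 * η * ‖a p‖ ^ 2) - ⟪a p, s.x - xs⟫_ℝ) + Ψ p := by
    intro p
    refine (lyapunov_next_le hm hP hlam hη hθ0.ne' V xs Ys s p).trans_eq ?_
    simp only [hc, hW, hΨ, ha]
    ring
  obtain ⟨ia, hainteg⟩ := integral_norm_avg_index_sq_le (ν := ν) hm fun τ => P.jump σ s τ
  have iin : ∀ τ, Integrable (fun p : Fin n → Fin m × S =>
      ⟪P.jump σ s τ (p τ).1, s.x - xs⟫_ℝ) (drawLaw m n ν) := fun τ =>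
    integrable_index hm (fun i => ⟪P.jump σ s τ i, s.x - xs⟫_ℝ) τ
  have iip : Integrable (fun p => ⟪a p, s.x - xs⟫_ℝ) (drawLaw m n ν) := by
    simp only [ha, inner_avg]
    exact (integrable_finsetSum _ fun τ _ => iin τ).const_mul _
  have hip : ∫ p, ⟪a p, s.x - xs⟫_ℝ ∂(drawLaw m n ν) = ⟪abar, s.x - xs⟫_ℝ := by
    simp only [ha, habar, inner_avg]
    rw [integral_const_mul, integral_finsetSum _ fun τ _ => iin τ]
    congr 1
    refine Finset.sum_congr rfl fun τ _ => ?_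
    rw [integral_index hm (fun i => ⟪P.jump σ s τ i, s.x - xs⟫_ℝ) τ, mean, real_inner_smul_left,
      sum_inner]
  have iΨ' := fun τ i => (integral_blockPotential_next (P := P) (Q := Q) (Q₁ := Q₁) (γ := γ)
    (σ := σ) (η := η) (θ := θ) (ν := ν) hm xs Ys s i τ)
  have iΨ : Integrable Ψ (drawLaw m n ν) :=
    (integrable_finsetSum _ fun τ _ => integrable_finsetSum _ fun i _ => (iΨ' τ i).1).const_mul _
  have hΨint : ∫ p, Ψ p ∂(drawLaw m n ν) = 1 / (n : ℝ) * ∑ τ, ∑ i,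
      (1 / (m : ℝ) * P.blockPotential γ σ xs Ys i τ (P.dualProx σ s i τ)
        + (1 - 1 / (m : ℝ)) * P.blockPotential γ σ xs Ys i τ (s.y i τ)) := by
    simp only [hΨ]
    rw [integral_const_mul, integral_finsetSum _ fun τ _ =>
      integrable_finsetSum _ fun i _ => (iΨ' τ i).1]
    congr 1
    refine Finset.sum_congr rfl fun τ _ => ?_
    rw [integral_finsetSum _ fun i _ => (iΨ' τ i).1]
    exact Finset.sum_congr rfl fun i _ => (iΨ' τ i).2
  have i1 : Integrable (fun p => c + W p) (drawLaw m n ν) := (integrable_const c).add hVi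
  have i2 : Integrable (fun p => 2 * η * ‖a p‖ ^ 2) (drawLaw m n ν) := ia.const_mul _
  have i3 : Integrable (fun p => (c + W p) + 2 * η * ‖a p‖ ^ 2) (drawLaw m n ν) := i1.add i2
  have i4 : Integrable (fun p => ((c + W p) + 2 * η * ‖a p‖ ^ 2) - ⟪a p, s.x - xs⟫_ℝ)
    (drawLaw m n ν) := i3.sub iip
  have i5 : Integrable (fun p => (((c + W p) + 2 * η * ‖a p‖ ^ 2) - ⟪a p, s.x - xs⟫_ℝ) + Ψ p)
    (drawLaw m n ν) := i4.add iΨ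
  calc _ ≤ ∫⁻ p, ENNReal.ofReal ((((c + W p) + 2 * η * ‖a p‖ ^ 2) - ⟪a p, s.x - xs⟫_ℝ) + Ψ p)
        ∂(drawLaw m n ν) := lintegral_mono fun p => ENNReal.ofReal_le_ofReal (hpt p)
    _ = ENNReal.ofReal (∫ p, (((c + W p) + 2 * η * ‖a p‖ ^ 2) - ⟪a p, s.x - xs⟫_ℝ) + Ψ p
        ∂(drawLaw m n ν)) :=
      (ofReal_integral_eq_lintegral_ofReal i5 (ae_of_all _ fun p => (hnn p).trans (hpt p))).symm
    _ ≤ ENNReal.ofReal (θ * P.lyapunov γ lam σ η θ V xs Ys s) := ENNReal.ofReal_le_ofReal ?_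
    _ = _ := ENNReal.ofReal_mul hθ0.le
  rw [integral_add i4 iΨ, integral_sub i3 iip, integral_add i1 i2,
    integral_add (integrable_const c) hVi, integral_const_mul, hip, hΨint]
  simp only [integral_const, probReal_univ, one_smul]
  have hdd := dual_drift hm hn hP hγ hσ hYs hs (xs := xs)
  rw [← habar] at hdd
  have hMS := norm_avg_mean_jump_sq_le (P := P) σ s
  rw [← habar] at hMS
  set M := 1 / (n : ℝ) * ∑ τ, P.moveSq σ s τ with hM
  have hn' : (0 : ℝ) < n := by exact_mod_cast hn
  have hM0 : 0 ≤ M := mul_nonneg (by positivity) (Finset.sum_nonneg fun τ _ => moveSq_nonneg σ s τ)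
  have hmsq : 1 / (n : ℝ) ^ 2 * ∑ τ, meanSq (P.jump σ s τ) ≤ P.Rm ^ 2 / n * M := by
    have h1 : ∑ τ, meanSq (P.jump σ s τ) ≤ P.Rm ^ 2 * ∑ τ, P.moveSq σ s τ := by
      rw [Finset.mul_sum]
      exact Finset.sum_le_sum fun τ _ => meanSq_jump_le σ s τ
    refine (mul_le_mul_of_nonneg_left h1 (by positivity)).trans_eq ?_
    rw [hM]
    field_simp
  have hE : ∫ p, ‖a p‖ ^ 2 ∂(drawLaw m n ν) ≤ (P.RSq + P.Rm ^ 2 / n) * M :=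
    (hainteg.trans (add_le_add hMS hmsq)).trans_eq (by ring)
  have hA : ‖abar‖ ^ 2 ≤ (P.RSq + P.Rm ^ 2 / n) * M := by
    have : 0 ≤ P.Rm ^ 2 / n * M := by positivity
    linarith
  have hmom : s.z = s.x + θ • momentum θ s := by
    rw [momentum, smul_smul, mul_inv_cancel₀ hθ0.ne', one_smul]
    abel
  -- Splitting `z - x*` makes the inner products with `x - x*` cancel against those of the primal
  -- bound. Only `θ` times the products with the momentum survive, the first of which is already in
  -- the old Lyapunov value.
  have hzx : ∀ v : Vec d, ⟪v, s.z - xs⟫_ℝ = ⟪v, s.x - xs⟫_ℝ + θ * ⟪v, momentum θ s⟫_ℝ := by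
    intro v
    rw [hmom, ← real_inner_smul_right, ← inner_add_right]
    congr 1
    abel
  rw [inner_add_left, hzx, hzx] at hdd
  have hy := young_inner_le hη abar (momentum θ s)
  have hy2 : θ * ⟪abar, momentum θ s⟫_ℝ ≤
      2 * η * ‖abar‖ ^ 2 + θ * (1 / (8 * η) * ‖momentum θ s‖ ^ 2) := by
    have h1 := mul_le_mul_of_nonneg_left hy hθ0.le
    have h2 : θ * (2 * η * ‖abar‖ ^ 2) ≤ 2 * η * ‖abar‖ ^ 2 :=
      mul_le_of_le_one_left (by positivity) hθ1
    linarith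
  have hpn := hsad.primal_nonneg hYs s.x
  have hdn := hsad.dual_nonneg hYs hs.finite
  have hD : 0 ≤ 1 / (n : ℝ) * dualDist Ys s := by unfold dualDist; positivity
  have hx2 := mul_le_mul_of_nonneg_right hθx (sq_nonneg ‖s.x - η • avg s.e - xs‖)
  have hE2 := mul_le_mul_of_nonneg_left hE (by positivity : 0 ≤ 2 * η)
  have hA2 := mul_le_mul_of_nonneg_left hA (by positivity : 0 ≤ 2 * η)
  have hκ2 := mul_le_mul_of_nonneg_right hκ hM0
  have hg : (1 - 1 / (m : ℝ)) * (m * (P.saddleReal xs Ys - P.saddleReal xs s.y)) ≤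
      θ * (m * (P.saddleReal xs Ys - P.saddleReal xs s.y)) :=
    mul_le_mul_of_nonneg_right hθm (by positivity)
  -- The left coefficient equals `1/(2σ) + γ/2 - γ/(2m)`: a block gains `γ/2` only when drawn, which
  -- `hθy` compares with `1 - θ`.
  have hdist : ((1 - 1 / (m : ℝ)) * (1 / (2 * σ) + γ / 2) + 1 / (2 * σ) * (1 / m))
      * (1 / n * dualDist Ys s) ≤ θ * (1 / (2 * σ) + γ / 2) * (1 / n * dualDist Ys s) := by
    refine mul_le_mul_of_nonneg_right ?_ hD
    linarith
  -- The old primal gap does not occur in the upper bound, because the proximal step compares the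
  -- new point directly with `xs`; nonnegativity is enough.
  have hgp : 0 ≤ θ * (P.saddleReal s.x Ys - P.saddleReal xs Ys) := mul_nonneg hθ0.le hpn
  rw [lyapunov, gapReal, hc]
  linarith

end Problem

/-! ### Young-type bounds for the errors at one node. -/

section NodeBounds

variable {d m : ℕ} {δ : ℝ}

lemma norm_add_sq_le_two (x y : Vec d) : ‖x + y‖ ^ 2 ≤ 2 * ‖x‖ ^ 2 + 2 * ‖y‖ ^ 2 := by
  have h := norm_add_le x y
  nlinarith [norm_nonneg (x + y), sq_nonneg (‖x‖ - ‖y‖)]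

lemma contraction_young (hδ : 0 < δ) (hδ1 : δ ≤ 1) (x y : Vec d) :
    (1 - δ) * ‖x + y‖ ^ 2 ≤ (1 - δ / 2) * ‖x‖ ^ 2 + 2 * (1 - δ) / δ * ‖y‖ ^ 2 := by
  have h := norm_add_le x y
  have h1 : ‖x + y‖ ^ 2 ≤ (‖x‖ + ‖y‖) ^ 2 := pow_le_pow_left₀ (norm_nonneg _) h 2
  have h2 := mul_le_mul_of_nonneg_left h1 (by linarith : 0 ≤ 1 - δ)
  refine h2.trans ?_
  set a := ‖x‖
  set b := ‖y‖
  have e : (1 - δ / 2) * a ^ 2 + 2 * (1 - δ) / δ * b ^ 2 - (1 - δ) * (a + b) ^ 2 =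
      1 / (2 * δ) * ((δ * a - 2 * (1 - δ) * b) ^ 2 + 2 * δ * (1 - δ) * b ^ 2) := by
    field_simp
    ring
  have h3 : 0 ≤ 1 / (2 * δ) * ((δ * a - 2 * (1 - δ) * b) ^ 2 + 2 * δ * (1 - δ) * b ^ 2) := by
    have : 0 ≤ 1 - δ := by linarith
    positivity
  linarith

/-- The factor `(1 - δ)²` obtained when the compressor scales in mean is small enough for Young's
inequality to keep the full rate `1 - δ`, in place of `1 - δ / 2`. -/
lemma lag_young (hδ : 0 < δ) (hδ1 : δ ≤ 1) (x y : Vec d) :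
    ‖(1 - δ) • x + y‖ ^ 2 ≤ (1 - δ) * ‖x‖ ^ 2 + 1 / δ * ‖y‖ ^ 2 := by
  have h : ‖(1 - δ) • x + y‖ ≤ (1 - δ) * ‖x‖ + ‖y‖ := by
    refine (norm_add_le _ _).trans_eq ?_
    rw [norm_smul, Real.norm_of_nonneg (by linarith)]
  refine (pow_le_pow_left₀ (norm_nonneg _) h 2).trans ?_
  have e : (1 - δ) * ‖x‖ ^ 2 + 1 / δ * ‖y‖ ^ 2 - ((1 - δ) * ‖x‖ + ‖y‖) ^ 2 =
      (1 - δ) / δ * (δ * ‖x‖ - ‖y‖) ^ 2 := by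
    field_simp
    ring
  have h3 : 0 ≤ (1 - δ) / δ * (δ * ‖x‖ - ‖y‖) ^ 2 :=
    mul_nonneg (div_nonneg (by linarith) hδ.le) (sq_nonneg _)
  linarith

lemma contraction_young_add (hδ : 0 < δ) (hδ1 : δ ≤ 1) (a v e : Vec d) :
    (1 - δ) * ‖a + (v + e)‖ ^ 2 ≤
      (1 - δ / 2) * ‖e‖ ^ 2 + 4 * (1 - δ) / δ * (‖a‖ ^ 2 + ‖v‖ ^ 2) := by
  have h1 := contraction_young hδ hδ1 e (a + v)
  have h2 := norm_add_sq_le_two a v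
  have h3 : 0 ≤ 2 * (1 - δ) / δ := div_nonneg (by linarith) hδ.le
  have h4 := mul_le_mul_of_nonneg_left h2 h3
  have e1 : a + (v + e) = e + (a + v) := by abel
  have e2 : 2 * (1 - δ) / δ * (2 * ‖a‖ ^ 2 + 2 * ‖v‖ ^ 2) =
      4 * (1 - δ) / δ * (‖a‖ ^ 2 + ‖v‖ ^ 2) := by ring
  rw [e1]
  linarith

variable {S : Type*} [MeasurableSpace S] {ν : Measure S} [IsProbabilityMeasure ν]
  {Q : S → Vec d → Vec d}

lemma integral_compErr_sq_le' (hm : 0 < m) (hQ : IsContractionCompressor ν Q δ) (a : Fin m → Vec d)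
    (v e : Vec d) : ∫ p, ‖compErr Q a (v + e) p‖ ^ 2 ∂(nodeLaw m ν) ≤
      (1 - δ / 2) * ‖e‖ ^ 2 + 4 * (1 - δ) / δ * (‖mean a‖ ^ 2 + ‖v‖ ^ 2)
        + (1 - δ) * meanSq a := by
  have h1 := integral_compErr_sq_le hm hQ a (v + e)
  have h2 := contraction_young_add hQ.pos hQ.le_one (mean a) v e
  have h3 : 0 ≤ (1 - δ) * ‖mean a‖ ^ 2 := mul_nonneg (by linarith [hQ.le_one]) (sq_nonneg _)
  linarith

/-- Subtracting the squared mean, with factor `(1 - δ)²`, from the second moment, with factor `1 -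
δ`, leaves `δ(1 - δ)`. The additional `δ` spares the fluctuations the `1/δ` loss of the
second-moment bound. -/
lemma variance_compErr_le (hm : 0 < m) (hQ : IsContractionCompressor ν Q δ)
    (hs : ScalesInMean ν Q δ) (a : Fin m → Vec d) (v e : Vec d) :
    ∫ p, ‖compErr Q a (v + e) p‖ ^ 2 ∂(nodeLaw m ν)
        - ‖∫ p, compErr Q a (v + e) p ∂(nodeLaw m ν)‖ ^ 2 ≤
      (1 - δ) * meanSq a
        + δ * (1 - δ) * (2 * ‖e‖ ^ 2 + 4 * ‖mean a‖ ^ 2 + 4 * ‖v‖ ^ 2) := by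
  have h0 : 0 ≤ 1 - δ := by linarith [hQ.le_one]
  have h1 := integral_compErr_sq_le hm hQ a (v + e)
  rw [integral_compErr hm hQ hs, norm_smul, mul_pow, Real.norm_eq_abs, sq_abs]
  have h3 : 0 ≤ (1 - δ) * ‖mean a‖ ^ 2 := mul_nonneg h0 (sq_nonneg _)
  have h4 : ‖mean a + (v + e)‖ ^ 2 ≤ 2 * ‖e‖ ^ 2 + 4 * ‖mean a‖ ^ 2 + 4 * ‖v‖ ^ 2 := by
    have e1 : mean a + (v + e) = (mean a + v) + e := by abel
    rw [e1]
    linarith [norm_add_sq_le_two (mean a + v) e, norm_add_sq_le_two (mean a) v]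
  have h5 := mul_le_mul_of_nonneg_left h4 (mul_nonneg hQ.pos.le h0)
  linarith

/-- The inner product of `v` with the mean jump occurs equally in the second moment and in the
squared mean, so no Young inequality is needed. -/
lemma variance_lagErr_le (hm : 0 < m) (hQ : IsContractionCompressor ν Q δ)
    (hs : ScalesInMean ν Q δ) (a : Fin m → Vec d) (v : Vec d) :
    ∫ p, ‖lagErr Q a v p‖ ^ 2 ∂(nodeLaw m ν) - ‖∫ p, lagErr Q a v p ∂(nodeLaw m ν)‖ ^ 2 ≤
      meanSq a / (m : ℝ) ^ 2 + δ * (1 - δ) * ‖v‖ ^ 2 := by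
  rw [integral_lagErr hm hQ hs, integral_lagErr_sq hm hQ, hQ.integral_sub hs, norm_add_sq_real]
  have h1 := hQ.integral_sq_le v
  have h2 : ‖(1 - δ) • v‖ ^ 2 = (1 - δ) ^ 2 * ‖v‖ ^ 2 := by
    rw [norm_smul, mul_pow, Real.norm_eq_abs, sq_abs]
  have h3 := sq_nonneg ‖(1 / (m : ℝ)) • mean a‖
  rw [h2]
  linarith

end NodeBounds

/-! ### Weights and drift of the error potentials. -/

namespace Problem

variable {d t m n : ℕ} (P : Problem d t m n)

/-- The error part of the Lyapunov function `Φ₂`. -/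
def errPotential (lam δ δ₁ η : ℝ) (s : State d t m n) : ℝ :=
  3 * (η + lam * η ^ 2) / (δ * n) * ∑ τ : Fin n, ‖s.e τ‖ ^ 2
    + 42 * (1 - δ) * (η + lam * η ^ 2) / (δ ^ 2 * δ₁ * n) * ∑ τ : Fin n, ‖s.h τ - s.u τ‖ ^ 2

/-- The error part of the Lyapunov function `Ψ₂`. -/
def errPotentialMean (lam δ δ₁ η : ℝ) (s : State d t m n) : ℝ :=
  3 * (η + lam * η ^ 2) / δ * ‖avg s.e‖ ^ 2
    + 21 * (1 - δ) * (η + lam * η ^ 2) / (δ * (n : ℝ) ^ 2) * ∑ τ : Fin n, ‖s.e τ‖ ^ 2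
    + 84 * (1 - δ) * (η + lam * η ^ 2) / (5 * δ ^ 2 * δ₁) * ‖avg s.h - avg s.u‖ ^ 2
    + 1512 * (1 - δ) * (η + lam * η ^ 2) / (5 * δ ^ 2 * δ₁ * (n : ℝ) ^ 2)
        * ∑ τ : Fin n, ‖s.h τ - s.u τ‖ ^ 2

/-- The compression part of `𝓡₂²`, up to the factor `3 / 4`. -/
def compSq (δ δ₁ : ℝ) : ℝ :=
  (1 - δ) * (14 * P.RbarSq / δ ^ 2 + 7 * P.Rm ^ 2 / (2 * δ)
    + 84 * (1 - δ₁) * P.RbarSq / (δ ^ 2 * δ₁ ^ 2 * (m : ℝ) ^ 2)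
    + 42 * P.Rm ^ 2 / (δ ^ 2 * δ₁ * (m : ℝ) ^ 2))

/-- The compression part of `𝓡₃²`, up to the factor `3 / 4`. -/
def compSqMean (δ δ₁ : ℝ) : ℝ :=
  7 * (1 - δ) * (2 * P.RSq / δ ^ 2 + 11 * P.Rm ^ 2 / (2 * δ * n)
    + 12 * (1 - δ) * P.RbarSq / (δ ^ 2 * n)
    + 12 * P.RSq / (5 * δ ^ 2 * δ₁ ^ 2 * (m : ℝ) ^ 2)
    + 228 * P.Rm ^ 2 / (5 * δ ^ 2 * δ₁ * (m : ℝ) ^ 2 * n)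
    + 432 * (1 - δ₁) * P.RbarSq / (5 * δ ^ 2 * δ₁ ^ 2 * (m : ℝ) ^ 2 * n))

variable {P}

/-- The two summands `1/2` are the costs of the new and the old error in the perturbed proximal
inequality. The weight `3/δ` is large enough for the rate `1 - δ/2` to cover both and still leave `1
- δ/6`. -/
lemma coeff_error_le {δ θ : ℝ} (hδ : 0 < δ) (hθ : 1 - δ / 6 ≤ θ) :
    (3 / δ + 1 / 2) * (1 - δ / 2) + 1 / 2 ≤ θ * (3 / δ) := by
  have h1 := mul_le_mul_of_nonneg_right hθ (by positivity : 0 ≤ 3 / δ)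
  have e1 : (1 - δ / 6) * (3 / δ) = 3 / δ - 1 / 2 := by field_simp; ring
  have e2 : (3 / δ + 1 / 2) * (1 - δ / 2) + 1 / 2 = 3 / δ - 1 / 2 - δ / 4 := by field_simp; ring
  linarith

lemma coeff_three_le {δ : ℝ} (hδ : 0 < δ) (hδ1 : δ ≤ 1) : 3 / δ + 1 / 2 ≤ 7 / (2 * δ) := by
  have e : 7 / (2 * δ) - (3 / δ + 1 / 2) = (1 - δ) / (2 * δ) := by field_simp; ring
  have : 0 ≤ (1 - δ) / (2 * δ) := div_nonneg (by linarith) (by positivity)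
  linarith

/-- The scalar inequality behind the drift of `errPotential`. -/
lemma scalar_drift {δ δ₁ θ M E H A q : ℝ} (hδ : 0 < δ) (hδ1 : δ ≤ 1) (hδ₁ : 0 < δ₁)
    (hθ : 1 - δ / 6 ≤ θ) (hθ₁ : 1 - δ₁ / 6 ≤ θ) (hM : 0 < M) (hE : 0 ≤ E)
    (hH : 0 ≤ H) (hA : 0 ≤ A) (hq : 0 ≤ q) :
    (3 / δ + 1 / 2) * ((1 - δ / 2) * E + 4 * (1 - δ) / δ * (A + H) + (1 - δ) * q)
      + 42 * (1 - δ) / (δ ^ 2 * δ₁) *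
        ((1 - δ₁ / 2) * H + 2 * (1 - δ₁) / δ₁ * (A / M ^ 2) + q / M ^ 2) + 1 / 2 * E ≤
    θ * (3 / δ * E + 42 * (1 - δ) / (δ ^ 2 * δ₁) * H)
      + (1 - δ) * ((14 / δ ^ 2 + 84 * (1 - δ₁) / (δ ^ 2 * δ₁ ^ 2 * M ^ 2)) * A
        + (7 / (2 * δ) + 42 / (δ ^ 2 * δ₁ * M ^ 2)) * q) := by
  have h0 : 0 ≤ 1 - δ := by linarith
  have c1 := mul_le_mul_of_nonneg_right (coeff_error_le hδ hθ) hE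
  have hX : 0 ≤ 4 * (1 - δ) / δ * (A + H) + (1 - δ) * q := by positivity
  have c2 := mul_le_mul_of_nonneg_right (coeff_three_le hδ hδ1) hX
  have c3 := mul_le_mul_of_nonneg_right hθ₁
    (by positivity : 0 ≤ 42 * (1 - δ) / (δ ^ 2 * δ₁) * H)
  have e1 : 7 / (2 * δ) * (4 * (1 - δ) / δ * (A + H) + (1 - δ) * q) =
      (1 - δ) * (14 / δ ^ 2 * A + 7 / (2 * δ) * q) + 14 * (1 - δ) / δ ^ 2 * H := by
    field_simp
    ring
  -- Origin of `42`: the gap between the rates `1 - δ₁/2` and `1 - δ₁/6` is `δ₁/3`, and a third of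
  -- `42` is the `14` by which the lag feeds the error in `e1`.
  have e2 : 42 * (1 - δ) / (δ ^ 2 * δ₁) *
        ((1 - δ₁ / 2) * H + 2 * (1 - δ₁) / δ₁ * (A / M ^ 2) + q / M ^ 2) =
      (1 - δ₁ / 6) * (42 * (1 - δ) / (δ ^ 2 * δ₁) * H) - 14 * (1 - δ) / δ ^ 2 * H
      + (1 - δ) * (84 * (1 - δ₁) / (δ ^ 2 * δ₁ ^ 2 * M ^ 2) * A
        + 42 / (δ ^ 2 * δ₁ * M ^ 2) * q) := by
    field_simp
    ring
  rw [e1] at c2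
  rw [e2]
  linarith

/-- The scalar inequality behind the drift of `errPotentialMean`, averaged variables. -/
lemma scalar_drift_avg {δ δ₁ θ M E H A : ℝ} (hδ : 0 < δ) (hδ1 : δ ≤ 1) (hδ₁ : 0 < δ₁)
    (hθ : 1 - δ / 6 ≤ θ) (hθ₁ : 1 - δ₁ / 6 ≤ θ) (hM : 0 < M) (hE : 0 ≤ E)
    (hH : 0 ≤ H) (hA : 0 ≤ A) :
    (3 / δ + 1 / 2) * ((1 - δ / 2) * E + 4 * (1 - δ) / δ * (A + H))
      + 84 * (1 - δ) / (5 * δ ^ 2 * δ₁) * ((1 - δ₁) * H + 1 / δ₁ * (A / M ^ 2)) + 1 / 2 * E ≤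
    θ * (3 / δ * E + 84 * (1 - δ) / (5 * δ ^ 2 * δ₁) * H)
      + 7 * (1 - δ) * ((2 / δ ^ 2 + 12 / (5 * δ ^ 2 * δ₁ ^ 2 * M ^ 2)) * A) := by
  have h0 : 0 ≤ 1 - δ := by linarith
  have c1 := mul_le_mul_of_nonneg_right (coeff_error_le hδ hθ) hE
  have hX : 0 ≤ 4 * (1 - δ) / δ * (A + H) := by positivity
  have c2 := mul_le_mul_of_nonneg_right (coeff_three_le hδ hδ1) hX
  have c3 := mul_le_mul_of_nonneg_right hθ₁
    (by positivity : 0 ≤ 84 * (1 - δ) / (5 * δ ^ 2 * δ₁) * H)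
  have e1 : 7 / (2 * δ) * (4 * (1 - δ) / δ * (A + H)) =
      7 * (1 - δ) * (2 / δ ^ 2 * A) + 14 * (1 - δ) / δ ^ 2 * H := by
    field_simp
    ring
  -- Here the averaged lag contracts at the full rate, so the gap is `5δ₁/6`, and `84/5` is what
  -- again produces `14`.
  have e2 : 84 * (1 - δ) / (5 * δ ^ 2 * δ₁) * ((1 - δ₁) * H + 1 / δ₁ * (A / M ^ 2)) =
      (1 - δ₁ / 6) * (84 * (1 - δ) / (5 * δ ^ 2 * δ₁) * H) - 14 * (1 - δ) / δ ^ 2 * H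
      + 7 * (1 - δ) * (12 / (5 * δ ^ 2 * δ₁ ^ 2 * M ^ 2) * A) := by
    field_simp
    ring
  rw [e1] at c2
  rw [e2]
  linarith

/-- The scalar inequality behind the drift of `errPotentialMean`, variables of one node. -/
lemma scalar_drift_node {δ δ₁ θ M E H A q : ℝ} (hδ : 0 < δ) (hδ1 : δ ≤ 1) (hδ₁ : 0 < δ₁)
    (hδ₁1 : δ₁ ≤ 1) (hθ : 1 - δ / 6 ≤ θ) (hθ₁ : 1 - δ₁ / 6 ≤ θ) (hM : 0 < M) (hE : 0 ≤ E)
    (hH : 0 ≤ H) (hA : 0 ≤ A) (hAq : A ≤ q) :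
    (3 / δ + 1 / 2) * ((1 - δ) * q + δ * (1 - δ) * (2 * E + 4 * A + 4 * H))
      + 21 * (1 - δ) / δ *
        ((1 - δ / 2) * E + 4 * (1 - δ) / δ * (A + H) + (1 - δ) * q)
      + 84 * (1 - δ) / (5 * δ ^ 2 * δ₁) * (q / M ^ 2 + δ₁ * (1 - δ₁) * H)
      + 1512 * (1 - δ) / (5 * δ ^ 2 * δ₁) *
        ((1 - δ₁ / 2) * H + 2 * (1 - δ₁) / δ₁ * (A / M ^ 2) + q / M ^ 2) ≤
    θ * (21 * (1 - δ) / δ * E + 1512 * (1 - δ) / (5 * δ ^ 2 * δ₁) * H)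
      + 7 * (1 - δ) * ((11 / (2 * δ) + 228 / (5 * δ ^ 2 * δ₁ * M ^ 2)) * q
        + (12 * (1 - δ) / δ ^ 2 + 432 * (1 - δ₁) / (5 * δ ^ 2 * δ₁ ^ 2 * M ^ 2)) * A) := by
  have h0 : 0 ≤ 1 - δ := by linarith
  have h01 : 0 ≤ 1 - δ₁ := by linarith
  have hq : 0 ≤ q := hA.trans hAq
  have hX : 0 ≤ (1 - δ) * q + δ * (1 - δ) * (2 * E + 4 * A + 4 * H) := by positivity
  have c2 := mul_le_mul_of_nonneg_right (coeff_three_le hδ hδ1) hX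
  have c3 := mul_le_mul_of_nonneg_right hθ₁
    (by positivity : 0 ≤ 1512 * (1 - δ) / (5 * δ ^ 2 * δ₁) * H)
  have c4 := mul_le_mul_of_nonneg_right hθ (by positivity : 0 ≤ 21 * (1 - δ) / δ * E)
  have e1 : 7 / (2 * δ) * ((1 - δ) * q + δ * (1 - δ) * (2 * E + 4 * A + 4 * H)) =
      (1 - δ) * (7 / (2 * δ) * q + 7 * E + 14 * A + 14 * H) := by
    field_simp
    ring
  -- The weight `21` yields `-7 * E`, which cancels the `7 * E` caused by the fluctuations in `e1`.
  have e2 : 21 * (1 - δ) / δ *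
        ((1 - δ / 2) * E + 4 * (1 - δ) / δ * (A + H) + (1 - δ) * q) =
      (1 - δ / 6) * (21 * (1 - δ) / δ * E) + (1 - δ) * (-(7 * E) + 84 * (1 - δ) / δ ^ 2 * A
        + 84 * (1 - δ) / δ ^ 2 * H + 21 * (1 - δ) / δ * q) := by
    field_simp
    ring
  have e3 : 84 * (1 - δ) / (5 * δ ^ 2 * δ₁) * (q / M ^ 2 + δ₁ * (1 - δ₁) * H) =
      (1 - δ) * (84 / (5 * δ ^ 2 * δ₁ * M ^ 2) * q + 84 * (1 - δ₁) / (5 * δ ^ 2) * H) := by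
    field_simp
  have e4 : 1512 * (1 - δ) / (5 * δ ^ 2 * δ₁) *
        ((1 - δ₁ / 2) * H + 2 * (1 - δ₁) / δ₁ * (A / M ^ 2) + q / M ^ 2) =
      (1 - δ₁ / 6) * (1512 * (1 - δ) / (5 * δ ^ 2 * δ₁) * H)
      + (1 - δ) * (-(504 / (5 * δ ^ 2) * H)
        + 3024 * (1 - δ₁) / (5 * δ ^ 2 * δ₁ ^ 2 * M ^ 2) * A
        + 1512 / (5 * δ ^ 2 * δ₁ * M ^ 2) * q) := by
    field_simp
    ring
  -- All three sources of lag must fit into a third of the weight `1512/5`, namely `504/5 = 84 +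
  -- 84/5`; this is tight as `δ` and `δ₁` tend to `0`.
  have k1 : 14 + 84 * (1 - δ) / δ ^ 2 + 84 * (1 - δ₁) / (5 * δ ^ 2) ≤ 504 / (5 * δ ^ 2) := by
    have e : 504 / (5 * δ ^ 2) - (14 + 84 * (1 - δ) / δ ^ 2 + 84 * (1 - δ₁) / (5 * δ ^ 2)) =
        (70 * δ * (1 - δ) + 350 * δ + 84 * δ₁) / (5 * δ ^ 2) := by field_simp; ring
    have : 0 ≤ (70 * δ * (1 - δ) + 350 * δ + 84 * δ₁) / (5 * δ ^ 2) := by positivity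
    linarith
  have k2 : 7 / (2 * δ) + 21 * (1 - δ) / δ + 14 ≤ 77 / (2 * δ) := by
    have e : 77 / (2 * δ) - (7 / (2 * δ) + 21 * (1 - δ) / δ + 14) = (14 + 7 * δ) / δ := by
      field_simp; ring
    have : 0 ≤ (14 + 7 * δ) / δ := by positivity
    linarith
  have m1 := mul_le_mul_of_nonneg_right k1 hH
  have m2 := mul_le_mul_of_nonneg_right k2 hq
  have e5 : 7 * (1 - δ) * ((11 / (2 * δ) + 228 / (5 * δ ^ 2 * δ₁ * M ^ 2)) * q
        + (12 * (1 - δ) / δ ^ 2 + 432 * (1 - δ₁) / (5 * δ ^ 2 * δ₁ ^ 2 * M ^ 2)) * A) =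
      (1 - δ) * (77 / (2 * δ) * q + 84 / (5 * δ ^ 2 * δ₁ * M ^ 2) * q
        + 1512 / (5 * δ ^ 2 * δ₁ * M ^ 2) * q + 84 * (1 - δ) / δ ^ 2 * A
        + 3024 * (1 - δ₁) / (5 * δ ^ 2 * δ₁ ^ 2 * M ^ 2) * A) := by
    field_simp
    ring
  have m3 : (1 - δ) * (7 / (2 * δ) * q + 14 * A + 14 * H + 84 * (1 - δ) / δ ^ 2 * H
      + 21 * (1 - δ) / δ * q + 84 * (1 - δ₁) / (5 * δ ^ 2) * H - 504 / (5 * δ ^ 2) * H) ≤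
      (1 - δ) * (77 / (2 * δ) * q) := mul_le_mul_of_nonneg_left (by linarith) h0
  rw [e1] at c2
  rw [e2, e3, e4, e5]
  linarith

end Problem

namespace Problem

variable {d t m n : ℕ} {P : Problem d t m n} {S : Type*} {Q Q₁ : S → Vec d → Vec d}
  {lam δ δ₁ σ η θ : ℝ}

lemma h_sub_u_next (s : State d t m n) (p : Fin n → Fin m × S) (τ : Fin n) :
    (P.next Q Q₁ σ η θ s p).h τ - (P.next Q Q₁ σ η θ s p).u τ =
      -lagErr Q₁ (P.jump σ s τ) (s.u τ - s.h τ) (p τ) := by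
  simp only [next, lagErr]
  abel

lemma avg_h_sub_avg_u_next (s : State d t m n) (p : Fin n → Fin m × S) :
    avg (P.next Q Q₁ σ η θ s p).h - avg (P.next Q Q₁ σ η θ s p).u =
      -avg fun τ => lagErr Q₁ (P.jump σ s τ) (s.u τ - s.h τ) (p τ) := by
  rw [← avg_sub]
  simp only [h_sub_u_next]
  simp only [avg, Finset.sum_neg_distrib, smul_neg]

variable [MeasurableSpace S] {ν : Measure S} [IsProbabilityMeasure ν]

lemma integrable_compErr_sq (hm : 0 < m) (hQ : IsContractionCompressor ν Q δ) (a : Fin m → Vec d)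
    (b : Vec d) (τ : Fin n) :
    Integrable (fun p : Fin n → Fin m × S => ‖compErr Q a b (p τ)‖ ^ 2) (drawLaw m n ν) := by
  have := isProbabilityMeasure_uniformOn_univ hm
  exact integrable_comp_eval (X := fun _ : Fin n => Fin m × S)
    (f := fun q => ‖compErr Q a b q‖ ^ 2) (integrable_norm_sq (memLp_compErr hm hQ a b))

lemma integral_eval_compErr_sq (hm : 0 < m) (hQ : IsContractionCompressor ν Q δ)
    (a : Fin m → Vec d) (b : Vec d) (τ : Fin n) :
    ∫ p : Fin n → Fin m × S, ‖compErr Q a b (p τ)‖ ^ 2 ∂(drawLaw m n ν) =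
      ∫ q, ‖compErr Q a b q‖ ^ 2 ∂(nodeLaw m ν) := by
  have := isProbabilityMeasure_uniformOn_univ hm
  exact integral_comp_eval (X := fun _ : Fin n => Fin m × S)
    (f := fun q => ‖compErr Q a b q‖ ^ 2) (integrable_norm_sq (memLp_compErr hm hQ a b)).1

lemma integrable_lagErr_sq (hm : 0 < m) (hQ₁ : IsContractionCompressor ν Q₁ δ₁)
    (a : Fin m → Vec d) (v : Vec d) (τ : Fin n) :
    Integrable (fun p : Fin n → Fin m × S => ‖lagErr Q₁ a v (p τ)‖ ^ 2) (drawLaw m n ν) := by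
  have := isProbabilityMeasure_uniformOn_univ hm
  exact integrable_comp_eval (X := fun _ : Fin n => Fin m × S)
    (f := fun q => ‖lagErr Q₁ a v q‖ ^ 2) (integrable_norm_sq (memLp_lagErr hm hQ₁ a v))

lemma integral_eval_lagErr_sq (hm : 0 < m) (hQ₁ : IsContractionCompressor ν Q₁ δ₁)
    (a : Fin m → Vec d) (v : Vec d) (τ : Fin n) :
    ∫ p : Fin n → Fin m × S, ‖lagErr Q₁ a v (p τ)‖ ^ 2 ∂(drawLaw m n ν) =
      ∫ q, ‖lagErr Q₁ a v q‖ ^ 2 ∂(nodeLaw m ν) := by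
  have := isProbabilityMeasure_uniformOn_univ hm
  exact integral_comp_eval (X := fun _ : Fin n => Fin m × S)
    (f := fun q => ‖lagErr Q₁ a v q‖ ^ 2) (integrable_norm_sq (memLp_lagErr hm hQ₁ a v)).1

/-- The drift of the error potential for contraction compressors. -/
theorem errPotential_drift (hm : 0 < m) (hn : 0 < n) (hQ : IsContractionCompressor ν Q δ)
    (hQ₁ : IsContractionCompressor ν Q₁ δ₁) (hlam : 0 < lam) (hη : 0 < η) (hθ : 1 - δ / 6 ≤ θ)
    (hθ₁ : 1 - δ₁ / 6 ≤ θ) (s : State d t m n) :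
    Integrable (fun p => errPotential lam δ δ₁ η (P.next Q Q₁ σ η θ s p)
      + (η + lam * η ^ 2) / 2 * ‖avg (P.next Q Q₁ σ η θ s p).e‖ ^ 2) (drawLaw m n ν) ∧
    ∫ p, (errPotential lam δ δ₁ η (P.next Q Q₁ σ η θ s p)
      + (η + lam * η ^ 2) / 2 * ‖avg (P.next Q Q₁ σ η θ s p).e‖ ^ 2) ∂(drawLaw m n ν)
      + (η + lam * η ^ 2) / 2 * ‖avg s.e‖ ^ 2 ≤
      θ * errPotential lam δ δ₁ η s
        + (η + lam * η ^ 2) * P.compSq δ δ₁ * (1 / n * ∑ τ, P.moveSq σ s τ) := by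
  have := isProbabilityMeasure_uniformOn_univ hm
  have hm' : (0 : ℝ) < m := by exact_mod_cast hm
  have hn' : (0 : ℝ) < n := by exact_mod_cast hn
  have hδ := hQ.pos
  have hδ1 := hQ.le_one
  have hδ₁ := hQ₁.pos
  have hδ₁1 := hQ₁.le_one
  have h0 : 0 ≤ 1 - δ := by linarith
  have h01 : 0 ≤ 1 - δ₁ := by linarith
  set g := η + lam * η ^ 2 with hg
  have hg0 : 0 < g := by positivity
  set ce : Fin n → Fin m × S → Vec d := fun τ =>
    compErr Q (P.jump σ s τ) (s.u τ - s.h τ + s.e τ) with hce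
  set le : Fin n → Fin m × S → Vec d := fun τ => lagErr Q₁ (P.jump σ s τ) (s.u τ - s.h τ) with hle
  have hiE : ∀ τ, Integrable (fun p : Fin n → Fin m × S => ‖ce τ (p τ)‖ ^ 2) (drawLaw m n ν) :=
    fun τ => integrable_compErr_sq hm hQ _ _ τ
  have hiL : ∀ τ, Integrable (fun p : Fin n → Fin m × S => ‖le τ (p τ)‖ ^ 2) (drawLaw m n ν) :=
    fun τ => integrable_lagErr_sq hm hQ₁ _ _ τ
  obtain ⟨hiA, -⟩ := integral_norm_avg_sq (ρ := nodeLaw m ν) ce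
    (fun τ => memLp_compErr hm hQ _ _)
  have hW : ∀ p, errPotential lam δ δ₁ η (P.next Q Q₁ σ η θ s p)
      + g / 2 * ‖avg (P.next Q Q₁ σ η θ s p).e‖ ^ 2 =
      (3 * g / (δ * n) * ∑ τ, ‖ce τ (p τ)‖ ^ 2
        + 42 * (1 - δ) * g / (δ ^ 2 * δ₁ * n) * ∑ τ, ‖le τ (p τ)‖ ^ 2)
        + g / 2 * ‖avg fun τ => ce τ (p τ)‖ ^ 2 := by
    intro p
    simp only [errPotential, h_sub_u_next, norm_neg]
    rfl
  simp only [hW]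
  have i1 : Integrable (fun p : Fin n → Fin m × S => 3 * g / (δ * n) * ∑ τ, ‖ce τ (p τ)‖ ^ 2)
    (drawLaw m n ν) := (integrable_finsetSum _ fun τ _ => hiE τ).const_mul _
  have i2 : Integrable (fun p : Fin n → Fin m × S =>
      42 * (1 - δ) * g / (δ ^ 2 * δ₁ * n) * ∑ τ, ‖le τ (p τ)‖ ^ 2) (drawLaw m n ν) :=
    (integrable_finsetSum _ fun τ _ => hiL τ).const_mul _
  have i3 : Integrable (fun p : Fin n → Fin m × S => 3 * g / (δ * n) * ∑ τ, ‖ce τ (p τ)‖ ^ 2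
      + 42 * (1 - δ) * g / (δ ^ 2 * δ₁ * n) * ∑ τ, ‖le τ (p τ)‖ ^ 2) (drawLaw m n ν) := i1.add i2
  have i4 : Integrable (fun p : Fin n → Fin m × S => g / 2 * ‖avg fun τ => ce τ (p τ)‖ ^ 2)
    (drawLaw m n ν) := hiA.const_mul _
  refine ⟨i3.add i4, ?_⟩
  rw [integral_add i3 i4, integral_add i1 i2, integral_const_mul, integral_const_mul,
    integral_const_mul, integral_finsetSum _ fun τ _ => hiE τ, integral_finsetSum _ fun τ _ => hiL τ]
  -- For compressors without a mean condition the averaged error is bounded only by convexity, with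
  -- no gain from the number of nodes.
  have hAle : ∫ p : Fin n → Fin m × S, ‖avg fun τ => ce τ (p τ)‖ ^ 2 ∂(drawLaw m n ν) ≤
      1 / (n : ℝ) * ∑ τ, ∫ q, ‖ce τ q‖ ^ 2 ∂(nodeLaw m ν) := by
    have h1 : ∫ p : Fin n → Fin m × S, ‖avg fun τ => ce τ (p τ)‖ ^ 2 ∂(drawLaw m n ν) ≤
        ∫ p : Fin n → Fin m × S, 1 / (n : ℝ) * ∑ τ, ‖ce τ (p τ)‖ ^ 2 ∂(drawLaw m n ν) :=
      integral_mono hiA ((integrable_finsetSum _ fun τ _ => hiE τ).const_mul _)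
        fun p => norm_avg_sq_le hn fun τ => ce τ (p τ)
    rw [integral_const_mul, integral_finsetSum _ fun τ _ => hiE τ] at h1
    refine h1.trans_eq ?_
    congr 1
    exact Finset.sum_congr rfl fun τ _ => integral_eval_compErr_sq hm hQ _ _ τ
  have eE : ∀ τ, ∫ p : Fin n → Fin m × S, ‖ce τ (p τ)‖ ^ 2 ∂(drawLaw m n ν) =
      ∫ q, ‖ce τ q‖ ^ 2 ∂(nodeLaw m ν) := fun τ => integral_eval_compErr_sq hm hQ _ _ τ
  have eL : ∀ τ, ∫ p : Fin n → Fin m × S, ‖le τ (p τ)‖ ^ 2 ∂(drawLaw m n ν) =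
      ∫ q, ‖le τ q‖ ^ 2 ∂(nodeLaw m ν) := fun τ => integral_eval_lagErr_sq hm hQ₁ _ _ τ
  simp only [eE, eL]
  have hnode : ∀ τ, (3 / δ + 1 / 2) * ∫ q, ‖ce τ q‖ ^ 2 ∂(nodeLaw m ν)
      + 42 * (1 - δ) / (δ ^ 2 * δ₁) * ∫ q, ‖le τ q‖ ^ 2 ∂(nodeLaw m ν) + 1 / 2 * ‖s.e τ‖ ^ 2 ≤
      θ * (3 / δ * ‖s.e τ‖ ^ 2 + 42 * (1 - δ) / (δ ^ 2 * δ₁) * ‖s.h τ - s.u τ‖ ^ 2)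
        + P.compSq δ δ₁ * P.moveSq σ s τ := by
    intro τ
    have b1 := integral_compErr_sq_le' hm hQ (P.jump σ s τ) (s.u τ - s.h τ) (s.e τ)
    have b2 := integral_lagErr_sq_le hm hQ₁ (P.jump σ s τ) (s.u τ - s.h τ)
    have b3 := scalar_drift hδ hδ1 hδ₁ hθ hθ₁ hm' (sq_nonneg ‖s.e τ‖)
      (sq_nonneg ‖s.u τ - s.h τ‖) (sq_nonneg ‖mean (P.jump σ s τ)‖)
      (meanSq_nonneg (P.jump σ s τ))
    have b4 := mul_le_mul_of_nonneg_left b1 (by positivity : 0 ≤ 3 / δ + 1 / 2)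
    have b5 := mul_le_mul_of_nonneg_left b2 (by positivity : 0 ≤ 42 * (1 - δ) / (δ ^ 2 * δ₁))
    have b6 := mul_le_mul_of_nonneg_left (norm_mean_jump_sq_le (P := P) σ s τ)
      (by positivity : 0 ≤ 14 / δ ^ 2 + 84 * (1 - δ₁) / (δ ^ 2 * δ₁ ^ 2 * (m : ℝ) ^ 2))
    have b7 := mul_le_mul_of_nonneg_left (meanSq_jump_le (P := P) σ s τ)
      (by positivity : 0 ≤ 7 / (2 * δ) + 42 / (δ ^ 2 * δ₁ * (m : ℝ) ^ 2))
    have b8 := mul_le_mul_of_nonneg_left (add_le_add b6 b7) h0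
    have e1 : P.compSq δ δ₁ * P.moveSq σ s τ = (1 - δ) *
        ((14 / δ ^ 2 + 84 * (1 - δ₁) / (δ ^ 2 * δ₁ ^ 2 * (m : ℝ) ^ 2))
          * (P.RbarSq * P.moveSq σ s τ)
        + (7 / (2 * δ) + 42 / (δ ^ 2 * δ₁ * (m : ℝ) ^ 2)) * (P.Rm ^ 2 * P.moveSq σ s τ)) := by
      rw [compSq]
      ring
    rw [norm_sub_rev (s.h τ), e1]
    simp only [hce, hle]
    linarith
  have hsum := Finset.sum_le_sum fun τ (_ : τ ∈ Finset.univ) => hnode τ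
  simp only [Finset.sum_add_distrib, ← Finset.mul_sum] at hsum
  have hsum2 := mul_le_mul_of_nonneg_left hsum (by positivity : 0 ≤ g / n)
  have hAle2 := mul_le_mul_of_nonneg_left hAle (by positivity : 0 ≤ g / 2)
  have hav := mul_le_mul_of_nonneg_left (norm_avg_sq_le hn s.e) (by positivity : 0 ≤ g / 2)
  rw [errPotential, ← hg]
  set A1 := ∑ τ, ∫ q, ‖ce τ q‖ ^ 2 ∂(nodeLaw m ν)
  set A2 := ∑ τ, ∫ q, ‖le τ q‖ ^ 2 ∂(nodeLaw m ν)
  set A3 := ∑ τ, ‖s.e τ‖ ^ 2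
  set A4 := ∑ τ, ‖s.h τ - s.u τ‖ ^ 2
  have f1 : 3 * g / (δ * n) = g / n * (3 / δ) := by field_simp
  have f2 : 42 * (1 - δ) * g / (δ ^ 2 * δ₁ * n) = g / n * (42 * (1 - δ) / (δ ^ 2 * δ₁)) := by
    field_simp
  have f3 : g / 2 * (1 / n * A1) = g / n * (1 / 2 * A1) := by field_simp
  have f4 : g / 2 * (1 / n * A3) = g / n * (1 / 2 * A3) := by field_simp
  have f5 : g * P.compSq δ δ₁ * (1 / n * ∑ τ, P.moveSq σ s τ) =
      g / n * (P.compSq δ δ₁ * ∑ τ, P.moveSq σ s τ) := by field_simp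
  rw [f3] at hAle2
  rw [f4] at hav
  rw [f1, f2, f5]
  linarith

/-- The drift of the error potential for compressors that scale in mean. -/
theorem errPotentialMean_drift (hm : 0 < m) (hn : 0 < n) (hQ : IsContractionCompressor ν Q δ)
    (hQ₁ : IsContractionCompressor ν Q₁ δ₁) (hs : ScalesInMean ν Q δ) (hs₁ : ScalesInMean ν Q₁ δ₁)
    (hlam : 0 < lam) (hη : 0 < η) (hθ : 1 - δ / 6 ≤ θ)
    (hθ₁ : 1 - δ₁ / 6 ≤ θ) (s : State d t m n) :
    Integrable (fun p => errPotentialMean lam δ δ₁ η (P.next Q Q₁ σ η θ s p)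
      + (η + lam * η ^ 2) / 2 * ‖avg (P.next Q Q₁ σ η θ s p).e‖ ^ 2) (drawLaw m n ν) ∧
    ∫ p, (errPotentialMean lam δ δ₁ η (P.next Q Q₁ σ η θ s p)
      + (η + lam * η ^ 2) / 2 * ‖avg (P.next Q Q₁ σ η θ s p).e‖ ^ 2) ∂(drawLaw m n ν)
      + (η + lam * η ^ 2) / 2 * ‖avg s.e‖ ^ 2 ≤
      θ * errPotentialMean lam δ δ₁ η s
        + (η + lam * η ^ 2) * P.compSqMean δ δ₁ * (1 / n * ∑ τ, P.moveSq σ s τ) := by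
  have := isProbabilityMeasure_uniformOn_univ hm
  have hm' : (0 : ℝ) < m := by exact_mod_cast hm
  have hn' : (0 : ℝ) < n := by exact_mod_cast hn
  have hδ := hQ.pos
  have hδ1 := hQ.le_one
  have hδ₁ := hQ₁.pos
  have hδ₁1 := hQ₁.le_one
  have h0 : 0 ≤ 1 - δ := by linarith
  have h01 : 0 ≤ 1 - δ₁ := by linarith
  set g := η + lam * η ^ 2 with hg
  have hg0 : 0 < g := by positivity
  set ce : Fin n → Fin m × S → Vec d := fun τ =>
    compErr Q (P.jump σ s τ) (s.u τ - s.h τ + s.e τ) with hce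
  set le : Fin n → Fin m × S → Vec d := fun τ => lagErr Q₁ (P.jump σ s τ) (s.u τ - s.h τ) with hle
  have hiE : ∀ τ, Integrable (fun p : Fin n → Fin m × S => ‖ce τ (p τ)‖ ^ 2) (drawLaw m n ν) :=
    fun τ => integrable_compErr_sq hm hQ _ _ τ
  have hiL : ∀ τ, Integrable (fun p : Fin n → Fin m × S => ‖le τ (p τ)‖ ^ 2) (drawLaw m n ν) :=
    fun τ => integrable_lagErr_sq hm hQ₁ _ _ τ
  obtain ⟨hiA, hAeq⟩ := integral_norm_avg_sq (ρ := nodeLaw m ν) ce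
    (fun τ => memLp_compErr hm hQ _ _)
  obtain ⟨hiB, hBeq⟩ := integral_norm_avg_sq (ρ := nodeLaw m ν) le
    (fun τ => memLp_lagErr hm hQ₁ _ _)
  have hW : ∀ p, errPotentialMean lam δ δ₁ η (P.next Q Q₁ σ η θ s p)
      + g / 2 * ‖avg (P.next Q Q₁ σ η θ s p).e‖ ^ 2 =
      (g * (3 / δ + 1 / 2) * ‖avg fun τ => ce τ (p τ)‖ ^ 2
        + 21 * (1 - δ) * g / (δ * (n : ℝ) ^ 2) * ∑ τ, ‖ce τ (p τ)‖ ^ 2)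
      + (84 * (1 - δ) * g / (5 * δ ^ 2 * δ₁) * ‖avg fun τ => le τ (p τ)‖ ^ 2
        + 1512 * (1 - δ) * g / (5 * δ ^ 2 * δ₁ * (n : ℝ) ^ 2) * ∑ τ, ‖le τ (p τ)‖ ^ 2) := by
    intro p
    have e1 : ∀ τ, (P.next Q Q₁ σ η θ s p).e τ = ce τ (p τ) := fun τ => rfl
    have e2 : avg (P.next Q Q₁ σ η θ s p).e = avg fun τ => ce τ (p τ) := rfl
    simp only [errPotentialMean, h_sub_u_next, avg_h_sub_avg_u_next, norm_neg, e1, e2, ← hg]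
    ring
  simp only [hW]
  have i1 : Integrable (fun p : Fin n → Fin m × S =>
      g * (3 / δ + 1 / 2) * ‖avg fun τ => ce τ (p τ)‖ ^ 2) (drawLaw m n ν) := hiA.const_mul _
  have i2 : Integrable (fun p : Fin n → Fin m × S =>
      21 * (1 - δ) * g / (δ * (n : ℝ) ^ 2) * ∑ τ, ‖ce τ (p τ)‖ ^ 2) (drawLaw m n ν) :=
    (integrable_finsetSum _ fun τ _ => hiE τ).const_mul _
  have i3 : Integrable (fun p : Fin n → Fin m × S =>
      84 * (1 - δ) * g / (5 * δ ^ 2 * δ₁) * ‖avg fun τ => le τ (p τ)‖ ^ 2) (drawLaw m n ν) :=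
    hiB.const_mul _
  have i4 : Integrable (fun p : Fin n → Fin m × S =>
      1512 * (1 - δ) * g / (5 * δ ^ 2 * δ₁ * (n : ℝ) ^ 2) * ∑ τ, ‖le τ (p τ)‖ ^ 2)
      (drawLaw m n ν) := (integrable_finsetSum _ fun τ _ => hiL τ).const_mul _
  have i12 : Integrable (fun p : Fin n → Fin m × S =>
      g * (3 / δ + 1 / 2) * ‖avg fun τ => ce τ (p τ)‖ ^ 2
        + 21 * (1 - δ) * g / (δ * (n : ℝ) ^ 2) * ∑ τ, ‖ce τ (p τ)‖ ^ 2) (drawLaw m n ν) := i1.add i2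
  have i34 : Integrable (fun p : Fin n → Fin m × S =>
      84 * (1 - δ) * g / (5 * δ ^ 2 * δ₁) * ‖avg fun τ => le τ (p τ)‖ ^ 2
        + 1512 * (1 - δ) * g / (5 * δ ^ 2 * δ₁ * (n : ℝ) ^ 2) * ∑ τ, ‖le τ (p τ)‖ ^ 2)
      (drawLaw m n ν) := i3.add i4
  refine ⟨i12.add i34, ?_⟩
  rw [integral_add i12 i34, integral_add i1 i2, integral_add i3 i4, integral_const_mul,
    integral_const_mul, integral_const_mul, integral_const_mul,
    integral_finsetSum _ fun τ _ => hiE τ, integral_finsetSum _ fun τ _ => hiL τ, hAeq, hBeq]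
  have eE : ∀ τ, ∫ p : Fin n → Fin m × S, ‖ce τ (p τ)‖ ^ 2 ∂(drawLaw m n ν) =
      ∫ q, ‖ce τ q‖ ^ 2 ∂(nodeLaw m ν) := fun τ => integral_eval_compErr_sq hm hQ _ _ τ
  have eL : ∀ τ, ∫ p : Fin n → Fin m × S, ‖le τ (p τ)‖ ^ 2 ∂(drawLaw m n ν) =
      ∫ q, ‖le τ q‖ ^ 2 ∂(nodeLaw m ν) := fun τ => integral_eval_lagErr_sq hm hQ₁ _ _ τ
  simp only [eE, eL]
  set abar : Vec d := avg fun τ => mean (P.jump σ s τ) with habar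
  set vbar : Vec d := avg s.u - avg s.h with hvbar
  -- Linearity in mean closes the recursion on the averaged variables, whose jumps are controlled by
  -- `R²`; the nodewise constants enter only with an extra `1/n`.
  have hmeanE : (avg fun τ => ∫ q, ce τ q ∂(nodeLaw m ν)) =
      (1 - δ) • (abar + (vbar + avg s.e)) := by
    have e1 : ∀ τ, ∫ q, ce τ q ∂(nodeLaw m ν) =
        (1 - δ) • (mean (P.jump σ s τ) + ((s.u τ - s.h τ) + s.e τ)) := fun τ =>
      integral_compErr hm hQ hs _ _
    simp only [e1]
    rw [avg_smul, avg_add, avg_add, avg_sub]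
  have hmeanL : (avg fun τ => ∫ q, le τ q ∂(nodeLaw m ν)) =
      (1 - δ₁) • vbar + (1 / (m : ℝ)) • abar := by
    have e1 : ∀ τ, ∫ q, le τ q ∂(nodeLaw m ν) =
        (1 - δ₁) • (s.u τ - s.h τ) + (1 / (m : ℝ)) • mean (P.jump σ s τ) := fun τ =>
      integral_lagErr hm hQ₁ hs₁ _ _
    simp only [e1]
    rw [avg_add, avg_smul, avg_smul, avg_sub]
  rw [hmeanE, hmeanL]
  have hAbar : ‖(1 - δ) • (abar + (vbar + avg s.e))‖ ^ 2 ≤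
      (1 - δ / 2) * ‖avg s.e‖ ^ 2 + 4 * (1 - δ) / δ * (‖abar‖ ^ 2 + ‖vbar‖ ^ 2) := by
    refine le_trans ?_ (contraction_young_add hδ hδ1 abar vbar (avg s.e))
    rw [norm_smul, mul_pow, Real.norm_eq_abs, sq_abs]
    refine mul_le_mul_of_nonneg_right ?_ (sq_nonneg _)
    nlinarith
  have hBbar : ‖(1 - δ₁) • vbar + (1 / (m : ℝ)) • abar‖ ^ 2 ≤
      (1 - δ₁) * ‖vbar‖ ^ 2 + 1 / δ₁ * (‖abar‖ ^ 2 / (m : ℝ) ^ 2) := by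
    refine (lag_young hδ₁ hδ₁1 vbar _).trans_eq ?_
    rw [norm_smul, mul_pow, Real.norm_eq_abs, sq_abs]
    ring
  have hbar := scalar_drift_avg (δ₁ := δ₁) hδ hδ1 hδ₁ hθ hθ₁ hm' (sq_nonneg ‖avg s.e‖)
    (sq_nonneg ‖vbar‖) (sq_nonneg ‖abar‖)
  have hMS := norm_avg_mean_jump_sq_le (P := P) σ s
  rw [← habar] at hMS
  have hnode : ∀ τ, (3 / δ + 1 / 2) *
        (∫ q, ‖ce τ q‖ ^ 2 ∂(nodeLaw m ν) - ‖∫ q, ce τ q ∂(nodeLaw m ν)‖ ^ 2)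
      + 21 * (1 - δ) / δ * ∫ q, ‖ce τ q‖ ^ 2 ∂(nodeLaw m ν)
      + 84 * (1 - δ) / (5 * δ ^ 2 * δ₁) *
        (∫ q, ‖le τ q‖ ^ 2 ∂(nodeLaw m ν) - ‖∫ q, le τ q ∂(nodeLaw m ν)‖ ^ 2)
      + 1512 * (1 - δ) / (5 * δ ^ 2 * δ₁) * ∫ q, ‖le τ q‖ ^ 2 ∂(nodeLaw m ν) ≤
      θ * (21 * (1 - δ) / δ * ‖s.e τ‖ ^ 2
        + 1512 * (1 - δ) / (5 * δ ^ 2 * δ₁) * ‖s.h τ - s.u τ‖ ^ 2)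
        + 7 * (1 - δ) * ((11 / (2 * δ) + 228 / (5 * δ ^ 2 * δ₁ * (m : ℝ) ^ 2)) * P.Rm ^ 2
        + (12 * (1 - δ) / δ ^ 2 + 432 * (1 - δ₁) / (5 * δ ^ 2 * δ₁ ^ 2 * (m : ℝ) ^ 2))
          * P.RbarSq) * P.moveSq σ s τ := by
    intro τ
    have b1 := integral_compErr_sq_le' hm hQ (P.jump σ s τ) (s.u τ - s.h τ) (s.e τ)
    have b2 := integral_lagErr_sq_le hm hQ₁ (P.jump σ s τ) (s.u τ - s.h τ)
    have b1v := variance_compErr_le hm hQ hs (P.jump σ s τ) (s.u τ - s.h τ) (s.e τ)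
    have b2v := variance_lagErr_le hm hQ₁ hs₁ (P.jump σ s τ) (s.u τ - s.h τ)
    have b3 := scalar_drift_node hδ hδ1 hδ₁ hδ₁1 hθ hθ₁ hm' (sq_nonneg ‖s.e τ‖)
      (sq_nonneg ‖s.u τ - s.h τ‖) (sq_nonneg ‖mean (P.jump σ s τ)‖)
      (norm_mean_sq_le hm (P.jump σ s τ))
    have b4 := mul_le_mul_of_nonneg_left b1v (by positivity : 0 ≤ 3 / δ + 1 / 2)
    have b4' := mul_le_mul_of_nonneg_left b1 (by positivity : 0 ≤ 21 * (1 - δ) / δ)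
    have b5 := mul_le_mul_of_nonneg_left b2v
      (by positivity : 0 ≤ 84 * (1 - δ) / (5 * δ ^ 2 * δ₁))
    have b5' := mul_le_mul_of_nonneg_left b2
      (by positivity : 0 ≤ 1512 * (1 - δ) / (5 * δ ^ 2 * δ₁))
    have b6 := mul_le_mul_of_nonneg_left (norm_mean_jump_sq_le (P := P) σ s τ)
      (by positivity :
        0 ≤ 12 * (1 - δ) / δ ^ 2 + 432 * (1 - δ₁) / (5 * δ ^ 2 * δ₁ ^ 2 * (m : ℝ) ^ 2))
    have b7 := mul_le_mul_of_nonneg_left (meanSq_jump_le (P := P) σ s τ)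
      (by positivity : 0 ≤ 11 / (2 * δ) + 228 / (5 * δ ^ 2 * δ₁ * (m : ℝ) ^ 2))
    have b8 := mul_le_mul_of_nonneg_left (add_le_add b7 b6) (by positivity : 0 ≤ 7 * (1 - δ))
    rw [norm_sub_rev (s.h τ)]
    simp only [hce, hle]
    linarith
  have hsum := Finset.sum_le_sum fun τ (_ : τ ∈ Finset.univ) => hnode τ
  simp only [Finset.sum_add_distrib, ← Finset.mul_sum] at hsum
  have hsum2 := mul_le_mul_of_nonneg_left hsum (by positivity : 0 ≤ g / (n : ℝ) ^ 2)
  have q1 := mul_le_mul_of_nonneg_left hAbar (by positivity : 0 ≤ 3 / δ + 1 / 2)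
  have q2 := mul_le_mul_of_nonneg_left hBbar (by positivity : 0 ≤ 84 * (1 - δ) / (5 * δ ^ 2 * δ₁))
  have q3 := mul_le_mul_of_nonneg_left hMS (by positivity :
    0 ≤ 7 * (1 - δ) * (2 / δ ^ 2 + 12 / (5 * δ ^ 2 * δ₁ ^ 2 * (m : ℝ) ^ 2)))
  have hbar2 : (3 / δ + 1 / 2) * ‖(1 - δ) • (abar + (vbar + avg s.e))‖ ^ 2
      + 84 * (1 - δ) / (5 * δ ^ 2 * δ₁) * ‖(1 - δ₁) • vbar + (1 / (m : ℝ)) • abar‖ ^ 2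
      + 1 / 2 * ‖avg s.e‖ ^ 2 ≤
      θ * (3 / δ * ‖avg s.e‖ ^ 2 + 84 * (1 - δ) / (5 * δ ^ 2 * δ₁) * ‖vbar‖ ^ 2)
      + 7 * (1 - δ) * (2 / δ ^ 2 + 12 / (5 * δ ^ 2 * δ₁ ^ 2 * (m : ℝ) ^ 2)) *
        (P.RSq * (1 / n * ∑ τ, P.moveSq σ s τ)) := by linarith
  have hbar3 := mul_le_mul_of_nonneg_left hbar2 hg0.le
  have hv : ‖avg s.h - avg s.u‖ ^ 2 = ‖vbar‖ ^ 2 := by rw [norm_sub_rev]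
  rw [errPotentialMean, ← hg, hv]
  simp only [Finset.sum_sub_distrib]
  have f0 : g * P.compSqMean δ δ₁ * (1 / n * ∑ τ, P.moveSq σ s τ) =
      g * (7 * (1 - δ) * (2 / δ ^ 2 + 12 / (5 * δ ^ 2 * δ₁ ^ 2 * (m : ℝ) ^ 2)) *
        (P.RSq * (1 / n * ∑ τ, P.moveSq σ s τ)))
      + g / (n : ℝ) ^ 2 * (7 * (1 - δ) *
        ((11 / (2 * δ) + 228 / (5 * δ ^ 2 * δ₁ * (m : ℝ) ^ 2)) * P.Rm ^ 2
        + (12 * (1 - δ) / δ ^ 2 + 432 * (1 - δ₁) / (5 * δ ^ 2 * δ₁ ^ 2 * (m : ℝ) ^ 2))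
          * P.RbarSq) * ∑ τ, P.moveSq σ s τ) := by
    rw [compSqMean]
    field_simp
    ring
  have f1 : 21 * (1 - δ) * g / (δ * (n : ℝ) ^ 2) = g / (n : ℝ) ^ 2 * (21 * (1 - δ) / δ) := by
    field_simp
  have f2 : 1512 * (1 - δ) * g / (5 * δ ^ 2 * δ₁ * (n : ℝ) ^ 2) =
      g / (n : ℝ) ^ 2 * (1512 * (1 - δ) / (5 * δ ^ 2 * δ₁)) := by
    field_simp
  have f3 : 84 * (1 - δ) * g / (5 * δ ^ 2 * δ₁) = g * (84 * (1 - δ) / (5 * δ ^ 2 * δ₁)) := by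
    field_simp
  have f4 : 1 / (n : ℝ) ^ 2 = (n : ℝ)⁻¹ ^ 2 := by rw [inv_pow, one_div]
  have f5 : g / (n : ℝ) ^ 2 = g * (n : ℝ)⁻¹ ^ 2 := by rw [inv_pow, div_eq_mul_inv]
  have f6 : 3 * g / δ = g * (3 / δ) := by ring
  rw [f0, f1, f2, f3, f4, f5, f6]
  rw [f5] at hsum2
  simp only [Finset.sum_sub_distrib] at hsum2
  linarith

end Problem

lemma measurable_conj {t : ℕ} (φ : Vec t → ℝ) : Measurable (conj φ) :=
  (lowerSemicontinuous_conj φ).measurable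

/-! ### Measurability of the potentials, and geometric decay along a run. -/

namespace Problem

variable {d t m n : ℕ} {P : Problem d t m n} {γ lam δ δ₁ σ η θ : ℝ}

section Measurability

lemma Regular.measurable_g (hP : P.Regular γ lam) (hlam : 0 < lam) : Measurable P.g := by
  have h : ConvexOn ℝ Set.univ P.g := hP.strongConvex_g.convexOn fun r => by
    simp only [Pi.zero_apply]
    positivity
  exact (continuousOn_univ.1 (h.continuousOn isOpen_univ)).measurable

lemma measurable_dualDist (Ys : Fin m → Fin n → Vec t) :
    Measurable (dualDist (d := d) Ys) := by
  unfold dualDist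
  refine Finset.measurable_sum _ fun τ _ => Finset.measurable_sum _ fun i _ => ?_
  exact ((State.measurable_y i τ).sub_const _).norm.pow_const 2

lemma measurable_saddle_primal (hP : P.Regular γ lam) (hlam : 0 < lam)
    (Ys : Fin m → Fin n → Vec t) : Measurable fun x => P.saddleReal x Ys := by
  unfold saddleReal
  refine (hP.measurable_g hlam).add (Measurable.const_mul ?_ _)
  refine Finset.measurable_sum _ fun τ _ => Finset.measurable_sum _ fun i _ => ?_
  exact Continuous.measurable (by fun_prop)

lemma measurable_saddleReal_dual (xs : Vec d) :
    Measurable fun s : State d t m n => P.saddleReal xs s.y := by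
  unfold saddleReal
  refine (measurable_const).add (Measurable.const_mul ?_ _)
  refine Finset.measurable_sum _ fun τ _ => Finset.measurable_sum _ fun i _ => ?_
  have h : Measurable fun y : Vec t => ⟪y, (P.A i τ).adjoint xs⟫_ℝ - (conj (P.φ i τ) y).toReal :=
    (Continuous.measurable (by fun_prop)).sub (measurable_conj _).ereal_toReal
  exact h.comp (State.measurable_y i τ)

lemma measurable_gapReal (hP : P.Regular γ lam) (hlam : 0 < lam) (xs : Vec d)
    (Ys : Fin m → Fin n → Vec t) : Measurable (P.gapReal xs Ys) := by
  unfold gapReal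
  have h1 : Measurable fun s : State d t m n => P.saddleReal s.x Ys :=
    (measurable_saddle_primal hP hlam Ys).comp State.measurable_x
  exact (h1.sub_const _).add ((measurable_const.sub (measurable_saddleReal_dual xs)).const_mul _)

lemma measurableSet_dualFinite : MeasurableSet {s : State d t m n | P.DualFinite s.y} := by
  have h : {s : State d t m n | P.DualFinite s.y} =
      ⋂ i, ⋂ τ, (fun s : State d t m n => conj (P.φ i τ) (s.y i τ)) ⁻¹' {⊤}ᶜ := by
    ext s
    simp [DualFinite]
  rw [h]
  refine MeasurableSet.iInter fun i => MeasurableSet.iInter fun τ => ?_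
  exact ((measurable_conj _).comp (State.measurable_y i τ)) (measurableSet_singleton _).compl

open Classical in
-- The gap is a measurable real function where all conjugates at `s.y` are finite, and `⊤`
-- elsewhere.
lemma measurable_gap (hm : 0 < m) (hP : P.Regular γ lam) (hlam : 0 < lam) (xs : Vec d)
    {Ys : Fin m → Fin n → Vec t} (hYs : P.DualFinite Ys) : Measurable (P.gap xs Ys) := by
  have h : P.gap xs Ys = fun s =>
      if s ∈ {s : State d t m n | P.DualFinite s.y} then (P.gapReal xs Ys s : EReal) else ⊤ := by
    funext s
    split_ifs with hs
    · exact gap_eq_coe hYs xs hs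
    · exact gap_eq_top hm hYs xs hs
  rw [h]
  exact Measurable.ite measurableSet_dualFinite (measurable_gapReal hP hlam xs Ys).coe_real_ereal
    measurable_const

lemma measurable_avg_e : Measurable fun s : State d t m n => avg s.e :=
  measurable_avg State.measurable_e

lemma measurable_primalDist (xs : Vec d) :
    Measurable fun s : State d t m n => ‖s.x - η • avg s.e - xs‖ ^ 2 :=
  (((State.measurable_x.sub (measurable_avg_e.const_smul η)).sub_const _).norm).pow_const 2

lemma measurable_lyapunov (hP : P.Regular γ lam) (hlam : 0 < lam) (xs : Vec d)
    (Ys : Fin m → Fin n → Vec t) {V : State d t m n → ℝ}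
    (hV : Measurable V) : Measurable (P.lyapunov γ lam σ η θ V xs Ys) := by
  have hm : Measurable fun s : State d t m n => momentum θ s :=
    (State.measurable_z.sub State.measurable_x).const_smul θ⁻¹
  have hu : Measurable fun s : State d t m n => avg s.u - P.dualAvg Ys :=
    (measurable_avg State.measurable_u).sub_const _
  unfold lyapunov
  exact ((((((measurable_primalDist xs).const_mul _).add ((measurable_dualDist Ys).const_mul _)).add
    hV).add (measurable_gapReal hP hlam xs Ys)).add (hu.inner hm)).add ((hm.norm.pow_const 2).const_mul _)

lemma measurable_sum_e_sq : Measurable fun s : State d t m n => ∑ τ : Fin n, ‖s.e τ‖ ^ 2 :=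
  Finset.measurable_sum _ fun τ _ => (State.measurable_e τ).norm.pow_const 2

lemma measurable_sum_h_sub_u_sq :
    Measurable fun s : State d t m n => ∑ τ : Fin n, ‖s.h τ - s.u τ‖ ^ 2 :=
  Finset.measurable_sum _ fun τ _ =>
    ((State.measurable_h τ).sub (State.measurable_u τ)).norm.pow_const 2

lemma measurable_errPotential : Measurable (errPotential (d := d) (t := t) (m := m) (n := n) lam δ δ₁ η) :=
  (measurable_sum_e_sq.const_mul _).add (measurable_sum_h_sub_u_sq.const_mul _)

lemma measurable_errPotentialMean :
    Measurable (errPotentialMean (d := d) (t := t) (m := m) (n := n) lam δ δ₁ η) := by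
  have h1 : Measurable fun s : State d t m n => ‖avg s.h - avg s.u‖ ^ 2 :=
    ((measurable_avg State.measurable_h).sub (measurable_avg State.measurable_u)).norm.pow_const 2
  exact ((((measurable_avg_e.norm.pow_const 2).const_mul _).add
    (measurable_sum_e_sq.const_mul _)).add (h1.const_mul _)).add
    (measurable_sum_h_sub_u_sq.const_mul _)

end Measurability

variable (P) in
/-- The extended-real Lyapunov function with error potential `V`. -/
def potential (γ lam σ η : ℝ) (V : State d t m n → ℝ) (xs : Vec d) (Ys : Fin m → Fin n → Vec t)
    (s : State d t m n) : EReal :=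
  (((1 / (2 * η) + lam / 4) * ‖s.x - η • avg s.e - xs‖ ^ 2
    + (1 / (4 * σ) + γ / 2) * (1 / n) * dualDist Ys s + V s : ℝ) : EReal) + P.gap xs Ys s

lemma Phi2_eq_potential (xs : Vec d) (Ys : Fin m → Fin n → Vec t) (s : State d t m n) :
    P.Phi2 γ lam δ δ₁ σ η xs Ys s =
      P.potential γ lam σ η (errPotential lam δ δ₁ η) xs Ys s := by
  rw [Phi2, potential, errPotential]
  congr 2
  ring

lemma Psi2_eq_potential (xs : Vec d) (Ys : Fin m → Fin n → Vec t) (s : State d t m n) :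
    P.Psi2 γ lam δ δ₁ σ η xs Ys s =
      P.potential γ lam σ η (errPotentialMean lam δ δ₁ η) xs Ys s := by
  rw [Psi2, potential, errPotentialMean]
  congr 2
  ring

lemma measurable_potential (hm : 0 < m) (hP : P.Regular γ lam) (hlam : 0 < lam) (xs : Vec d)
    {Ys : Fin m → Fin n → Vec t} (hYs : P.DualFinite Ys) {V : State d t m n → ℝ}
    (hV : Measurable V) : Measurable (P.potential γ lam σ η V xs Ys) := by
  unfold potential
  exact ((((measurable_primalDist xs).const_mul _).add ((measurable_dualDist Ys).const_mul _)).add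
    hV).coe_real_ereal.add (measurable_gap hm hP hlam xs hYs)

lemma potential_eq_coe {Ys : Fin m → Fin n → Vec t} (hYs : P.DualFinite Ys) (xs : Vec d)
    (V : State d t m n → ℝ) {s : State d t m n} (hs : P.DualFinite s.y) :
    P.potential γ lam σ η V xs Ys s = (P.basePotential γ lam σ η V xs Ys s : EReal) := by
  rw [potential, gap_eq_coe hYs xs hs, ← EReal.coe_add, basePotential]

lemma potential_eq_top (hm : 0 < m) {Ys : Fin m → Fin n → Vec t} (hYs : P.DualFinite Ys)
    (xs : Vec d) (V : State d t m n → ℝ) {s : State d t m n} (hs : ¬ P.DualFinite s.y) :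
    P.potential γ lam σ η V xs Ys s = ⊤ := by
  rw [potential, gap_eq_top hm hYs xs hs, EReal.coe_add_top]

lemma dualDist_nonneg (Ys : Fin m → Fin n → Vec t) (s : State d t m n) : 0 ≤ dualDist Ys s := by
  unfold dualDist
  positivity

lemma basePotential_nonneg {xs : Vec d} {Ys : Fin m → Fin n → Vec t} (hsad : P.IsSaddlePoint xs Ys)
    (hYs : P.DualFinite Ys) (hγ : 0 < γ) (hlam : 0 < lam) (hσ : 0 < σ) (hη : 0 < η)
    {V : State d t m n → ℝ} (hV : ∀ s, 0 ≤ V s) {s : State d t m n} (hs : P.DualFinite s.y) :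
    0 ≤ P.basePotential γ lam σ η V xs Ys s := by
  have h1 := hsad.primal_nonneg hYs s.x
  have h2 := hsad.dual_nonneg hYs hs
  have h3 := hV s
  have h4 := dualDist_nonneg Ys s
  rw [basePotential, gapReal]
  positivity

lemma errPotential_nonneg (hlam : 0 < lam) (hη : 0 < η) (hδ : 0 < δ) (hδ1 : δ ≤ 1) (hδ₁ : 0 < δ₁)
    (s : State d t m n) : 0 ≤ errPotential lam δ δ₁ η s := by
  have : 0 ≤ 1 - δ := by linarith
  unfold errPotential
  positivity

lemma errPotentialMean_nonneg (hlam : 0 < lam) (hη : 0 < η) (hδ : 0 < δ) (hδ1 : δ ≤ 1)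
    (hδ₁ : 0 < δ₁) (s : State d t m n) : 0 ≤ errPotentialMean lam δ δ₁ η s := by
  have : 0 ≤ 1 - δ := by linarith
  unfold errPotentialMean
  positivity

variable (P) in
/-- The relations between the stepsizes, the problem constants and the cost `κ` of compression under
which the Lyapunov function contracts. -/
structure StepBounds (γ lam σ η θ κ : ℝ) : Prop where
  σ_pos : 0 < σ
  η_pos : 0 < η
  θ_pos : 0 < θ
  θ_le : θ ≤ 1
  primal : 1 / (2 * η) ≤ θ * (1 / (2 * η) + lam / 4)
  gap : 1 - 1 / (m : ℝ) ≤ θ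
  dual : (1 / (2 * σ) + γ / 2) * (1 - θ) ≤ γ / 2 * (1 / m)
  coupling : 8 * η * σ * P.RSq ≤ 1
  cost : 4 * η * (P.RSq + P.Rm ^ 2 / n) + κ ≤ 1 / (2 * σ)

section Run

variable {Ω S : Type*} [MeasurableSpace S] {ν : Measure S} [IsProbabilityMeasure ν]
  {Q Q₁ : S → Vec d → Vec d} [MeasurableSpace Ω] {μ : Measure Ω} [IsProbabilityMeasure μ]
  {ι : ℕ → Fin n → Ω → Fin m} {ξ : ℕ → Fin n → Ω → S}

/-- Geometric decay of the expected Lyapunov function, given the drift of its error part. -/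
theorem expect_potential_le (hm : 0 < m) (hn : 0 < n) (hP : P.Regular γ lam) (hγ : 0 < γ)
    (hlam : 0 < lam) {κ : ℝ} (hb : P.StepBounds γ lam σ η θ κ)
    (hQ : Measurable fun p : S × Vec d => Q p.1 p.2)
    (hQ₁ : Measurable fun p : S × Vec d => Q₁ p.1 p.2) (hsamp : IsSampling μ ν ι ξ)
    {xs : Vec d} {Ys : Fin m → Fin n → Vec t} (hsad : P.IsSaddlePoint xs Ys)
    {V : State d t m n → ℝ} (hVm : Measurable V) (hV0 : ∀ s, 0 ≤ V s)
    (hV : ∀ s, Integrable (fun p => V (P.next Q Q₁ σ η θ s p)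
        + (η + lam * η ^ 2) / 2 * ‖avg (P.next Q Q₁ σ η θ s p).e‖ ^ 2) (drawLaw m n ν) ∧
      ∫ p, (V (P.next Q Q₁ σ η θ s p)
        + (η + lam * η ^ 2) / 2 * ‖avg (P.next Q Q₁ σ η θ s p).e‖ ^ 2) ∂(drawLaw m n ν)
        + (η + lam * η ^ 2) / 2 * ‖avg s.e‖ ^ 2 ≤
        θ * V s + κ * (1 / n * ∑ τ, P.moveSq σ s τ))
    {x0 : Vec d} {y0 : Fin m → Fin n → Vec t} {h0 : Fin n → Vec d} {s : ℕ → Ω → State d t m n}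
    (hs : P.IsRun Q Q₁ σ η θ ι ξ (P.init x0 y0 h0) s) {ε : ℝ} (hε : 0 < ε) {k : ℕ}
    (hk : θ ^ k ≤ ε) :
    expect μ (fun ω => P.potential γ lam σ η V xs Ys (s k ω)) ≤
      (ε : EReal) * (P.potential γ lam σ η V xs Ys (P.init x0 y0 h0)
        + ((1 / (4 * σ * n) * dualDist Ys (P.init x0 y0 h0) : ℝ) : EReal)) := by
  have hYs := hsad.dualFinite hP
  obtain ⟨hσ, hη, hθ0, hθ1, hθx, hθm, hθy, hR, hκ⟩ := hb
  -- If a conjugate is infinite at the start, the right side is `⊤`. Otherwise finiteness persists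
  -- along the run, since proximal points have finite conjugate value.
  by_cases hfin : P.DualFinite y0
  swap
  · have e := potential_eq_top (γ := γ) (lam := lam) (σ := σ) (η := η) hm hYs xs V
      (s := P.init x0 y0 h0) hfin
    rw [e, EReal.top_add_coe, EReal.coe_mul_top_of_pos hε]
    exact le_top
  have hadm0 : P.Admissible (P.init x0 y0 h0) := ⟨hfin, fun _ => rfl⟩
  have hadm : ∀ k ω, P.Admissible (s k ω) := by
    intro k ω
    induction k with
    | zero => rw [hs.start]; exact hadm0
    | succ k ih =>
      rw [hs.eq_next hP hγ hlam hσ hη]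
      exact ih.next hP hγ hσ _
  have hbase : ∀ s, P.Admissible s → 0 ≤ P.basePotential γ lam σ η V xs Ys s := fun s h =>
    basePotential_nonneg hsad hYs hγ hlam hσ hη hV0 h.finite
  have hle : ∀ s, P.Admissible s →
      P.basePotential γ lam σ η V xs Ys s ≤ P.lyapunov γ lam σ η θ V xs Ys s := fun s h =>
    basePotential_le_lyapunov hm h hσ hη hR V xs Ys
  have hly := hs.lintegral_le hm hP hγ hlam hσ hη hQ hQ₁ hsamp
    (F := fun s => ENNReal.ofReal (P.lyapunov γ lam σ η θ V xs Ys s))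
    (measurable_lyapunov hP hlam xs Ys hVm).ennreal_ofReal (c := ENNReal.ofReal θ)
    (fun k ω => lintegral_lyapunov_next_le hm hn hP hγ hlam hσ hη hθ0 hθ1 hθx hθm hθy hκ hsad
      (hadm k ω) (hV _).1 (hV _).2 fun p => (hbase _ ((hadm k ω).next hP hγ hσ p)).trans
        (hle _ ((hadm k ω).next hP hγ hσ p))) k
  have hL0 : 0 ≤ P.lyapunov γ lam σ η θ V xs Ys (P.init x0 y0 h0) :=
    (hbase _ hadm0).trans (hle _ hadm0)
  have e0 : P.potential γ lam σ η V xs Ys (P.init x0 y0 h0)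
      + ((1 / (4 * σ * n) * dualDist Ys (P.init x0 y0 h0) : ℝ) : EReal) =
      (P.lyapunov γ lam σ η θ V xs Ys (P.init x0 y0 h0) : EReal) := by
    rw [potential_eq_coe hYs xs V hadm0.finite, lyapunov_eq_of_z_eq_x rfl hσ, EReal.coe_add]
  -- The potential is nonnegative along the run, so the expectation is the integral of its positive
  -- part alone.
  have hneg : ∫⁻ ω, (-P.potential γ lam σ η V xs Ys (s k ω)).toENNReal ∂μ = 0 := by
    rw [← lintegral_zero (μ := μ)]
    refine lintegral_congr fun ω => EReal.toENNReal_of_nonpos ?_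
    rw [potential_eq_coe hYs xs V (hadm k ω).finite, ← EReal.coe_neg]
    exact_mod_cast neg_nonpos.2 (hbase _ (hadm k ω))
  have hpos : ∫⁻ ω, (P.potential γ lam σ η V xs Ys (s k ω)).toENNReal ∂μ ≤
      ENNReal.ofReal (ε * P.lyapunov γ lam σ η θ V xs Ys (P.init x0 y0 h0)) := by
    calc _ ≤ ∫⁻ ω, ENNReal.ofReal (P.lyapunov γ lam σ η θ V xs Ys (s k ω)) ∂μ := by
          refine lintegral_mono fun ω => ?_
          dsimp only
          rw [potential_eq_coe hYs xs V (hadm k ω).finite, EReal.real_coe_toENNReal]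
          exact ENNReal.ofReal_le_ofReal (hle _ (hadm k ω))
      _ ≤ _ := hly
      _ = ENNReal.ofReal (θ ^ k * P.lyapunov γ lam σ η θ V xs Ys (P.init x0 y0 h0)) := by
          rw [ENNReal.ofReal_mul (pow_nonneg hθ0.le k), ENNReal.ofReal_pow hθ0.le]
      _ ≤ _ := ENNReal.ofReal_le_ofReal (mul_le_mul_of_nonneg_right hk hL0)
  rw [expect, hneg, e0, EReal.coe_ennreal_zero, sub_zero, ← EReal.coe_mul]
  refine (EReal.coe_ennreal_le_coe_ennreal_iff.2 hpos).trans_eq ?_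
  rw [EReal.coe_ennreal_ofReal, max_eq_left (mul_nonneg hε.le hL0)]

end Run

end Problem

lemma compSq_nonneg {d t m n : ℕ} (P : Problem d t m n) {δ δ₁ : ℝ} (hδ : 0 < δ) (hδ1 : δ ≤ 1)
    (hδ₁ : 0 < δ₁) (hδ₁1 : δ₁ ≤ 1) : 0 ≤ P.compSq δ δ₁ := by
  have h1 : 0 ≤ 1 - δ := by linarith
  have h2 : 0 ≤ 1 - δ₁ := by linarith
  have h3 := P.RbarSq_nonneg
  unfold Problem.compSq
  positivity

lemma compSqMean_nonneg {d t m n : ℕ} (P : Problem d t m n) {δ δ₁ : ℝ} (hδ : 0 < δ) (hδ1 : δ ≤ 1)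
    (hδ₁ : 0 < δ₁) (hδ₁1 : δ₁ ≤ 1) : 0 ≤ P.compSqMean δ δ₁ := by
  have h1 : 0 ≤ 1 - δ := by linarith
  have h2 : 0 ≤ 1 - δ₁ := by linarith
  have h3 := P.RbarSq_nonneg
  have h4 := P.RSq_nonneg
  unfold Problem.compSqMean
  positivity

lemma R2Sq_eq {d t m n : ℕ} (P : Problem d t m n) (δ δ₁ : ℝ) :
    P.R2Sq δ δ₁ = 2 * P.RSq + 2 * P.Rm ^ 2 / n + 3 / 4 * P.compSq δ δ₁ := by
  unfold Problem.R2Sq Problem.compSq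
  ring

lemma R3Sq_eq {d t m n : ℕ} (P : Problem d t m n) (δ δ₁ : ℝ) :
    P.R3Sq δ δ₁ = 2 * P.RSq + 2 * P.Rm ^ 2 / n + 3 / 4 * P.compSqMean δ δ₁ := by
  unfold Problem.R3Sq Problem.compSqMean
  ring

/-! ### The stepsizes and the resulting iteration counts. -/

section Stepsizes

variable {d t m n : ℕ} {P : Problem d t m n} {γ lam δ δ₁ r : ℝ}

lemma theta_le_one (hr : 0 < r) (hδ : 0 < δ) (hδ₁ : 0 < δ₁) :
    theta m γ lam δ δ₁ r ≤ 1 := by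
  unfold theta
  have : 0 ≤ min (1 / (m + 4 * r * √(m / (lam * γ)))) (min (δ / 6) (δ₁ / 6)) := by positivity
  linarith

lemma one_sub_le_theta : 1 - δ / 6 ≤ theta m γ lam δ δ₁ r :=
  sub_le_sub_left ((min_le_right _ _).trans (min_le_left _ _)) _

lemma one_sub_le_theta' : 1 - δ₁ / 6 ≤ theta m γ lam δ δ₁ r :=
  sub_le_sub_left ((min_le_right _ _).trans (min_le_right _ _)) _

/-- The stepsizes of the theorem satisfy the conditions of the Lyapunov analysis. -/
lemma stepBounds (hm : 0 < m) (hγ : 0 < γ) (hlam : 0 < lam) (hδ : 0 < δ) (hδ1 : δ ≤ 1)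
    (hδ₁ : 0 < δ₁) {T : ℝ} (hT : 0 ≤ T) (hr : 0 < r)
    (hrT : r ^ 2 = 2 * P.RSq + 2 * P.Rm ^ 2 / n + 3 / 4 * T) (hrγ : lam * γ ≤ r ^ 2) :
    P.StepBounds γ lam (sigma m γ lam r) (eta m γ lam r) (theta m γ lam δ δ₁ r)
      ((eta m γ lam r + lam * eta m γ lam r ^ 2) * T) := by
  have hm1 : (1 : ℝ) ≤ m := by exact_mod_cast hm
  have hm0 : (0 : ℝ) < m := by linarith
  -- In terms of `a`, `σ = a/(2r)` and `η = 1/(2ra)`; the other square root is `a / lam`.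
  set a := √(m * lam / γ) with ha
  have ha0 : 0 < a := Real.sqrt_pos.2 (by positivity)
  have ha2 : a ^ 2 * γ = m * lam := by
    rw [ha, Real.sq_sqrt (by positivity)]
    field_simp
  have hq : √(m / (lam * γ)) = a / lam := by
    rw [Real.sqrt_eq_iff_eq_sq (by positivity) (by positivity), div_pow]
    rw [div_eq_div_iff (by positivity) (by positivity)]
    linear_combination (-lam) * ha2
  have hσ : sigma m γ lam r = a / (2 * r) := by
    rw [sigma, ← ha]
    ring
  have hη : eta m γ lam r = 1 / (2 * r * a) := by
    have : √(γ / (m * lam)) = a⁻¹ := by rw [ha, ← Real.sqrt_inv, inv_div]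
    rw [eta, this]
    field_simp
  -- This uses the assumption `𝓡²/(λγ) ≥ 1`. It gives `lam * η ≤ 1/2`, hence `η + lam * η² ≤
  -- (3/2)η`, the reason for the factor `3/4` in front of `T`.
  have hlr : lam ≤ r * a := by
    refine le_of_sq_le_sq ?_ (by positivity)
    rw [mul_pow]
    have h1 : lam * γ * a ^ 2 ≤ r ^ 2 * a ^ 2 := mul_le_mul_of_nonneg_right hrγ (by positivity)
    have h2 : lam * γ * a ^ 2 = m * lam ^ 2 := by linear_combination lam * ha2
    have h3 : lam ^ 2 ≤ m * lam ^ 2 := le_mul_of_one_le_left (by positivity) hm1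
    linarith
  set θ := theta m γ lam δ δ₁ r with hθ
  set D := m + 4 * r * (a / lam) with hD
  have hD0 : 0 < D := by positivity
  have hρ : 1 - θ ≤ 1 / D := by
    have : 1 - 1 / D ≤ θ := by
      rw [hθ, theta, hq]
      exact sub_le_sub_left (min_le_left _ _) _
    linarith
  have hθ1 : θ ≤ 1 := theta_le_one hr hδ hδ₁
  have hθ0 : 0 < θ := by
    have := one_sub_le_theta (m := m) (γ := γ) (lam := lam) (δ := δ) (δ₁ := δ₁) (r := r)
    linarith
  have hηe : 1 / (2 * (1 / (2 * r * a))) = r * a := by field_simp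
  have hσe : 1 / (2 * (a / (2 * r))) = r / a := by field_simp
  rw [hσ, hη]
  refine ⟨by positivity, by positivity, hθ0, hθ1, ?_, ?_, ?_, ?_, ?_⟩
  · rw [hηe]
    have h1 : (1 - θ) * (r * a + lam / 4) ≤ 1 / D * (r * a + lam / 4) :=
      mul_le_mul_of_nonneg_right hρ (by positivity)
    have h2 : 1 / D * (r * a + lam / 4) ≤ lam / 4 := by
      rw [one_div_mul_eq_div, div_le_iff₀ hD0, hD]
      have : lam / 4 * (m + 4 * r * (a / lam)) = r * a + lam / 4 * m := by
        field_simp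
        ring
      rw [this]
      have := mul_le_mul_of_nonneg_left hm1 (by positivity : 0 ≤ lam / 4)
      linarith
    linarith
  · have : 1 / D ≤ 1 / m := one_div_le_one_div_of_le hm0 (by rw [hD]; simp; positivity)
    linarith
  · rw [hσe]
    have h1 : (r / a + γ / 2) * (1 - θ) ≤ (r / a + γ / 2) * (1 / D) :=
      mul_le_mul_of_nonneg_left hρ (by positivity)
    refine h1.trans ?_
    rw [mul_one_div, mul_one_div, div_le_div_iff₀ hD0 hm0, hD]
    -- The choice of `a` balances the primal and dual conditions, so the single term `4r√(m/(λγ))`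
    -- in `θ` serves both.
    have h2 : r / a * m = γ * r * a / lam := by
      rw [div_mul_eq_mul_div, div_eq_div_iff ha0.ne' hlam.ne']
      linear_combination (-r) * ha2
    have h3 : γ / 2 * (m + 4 * r * (a / lam)) = γ / 2 * m + 2 * (γ * r * a / lam) := by ring
    have h4 : 0 ≤ γ * r * a / lam := by positivity
    rw [h3, add_mul, h2]
    linarith
  · have h1 : 8 * (1 / (2 * r * a)) * (a / (2 * r)) * P.RSq = 2 * P.RSq / r ^ 2 := by
      field_simp
      ring
    rw [h1, div_le_one (by positivity), hrT]
    have : 0 ≤ 2 * P.Rm ^ 2 / n := by positivity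
    linarith
  · rw [hσe]
    set h := 1 / (2 * r * a) with hh
    have hh0 : 0 < h := by positivity
    have h1 : r / a = 2 * h * r ^ 2 := by rw [hh]; field_simp
    have h2 : lam * h ≤ 1 / 2 := by
      rw [hh, mul_one_div, div_le_div_iff₀ (by positivity) (by norm_num)]
      linarith
    have h3 : lam * h ^ 2 * T ≤ 1 / 2 * (h * T) := by
      have := mul_le_mul_of_nonneg_right h2 (by positivity : 0 ≤ h * T)
      calc _ = lam * h * (h * T) := by ring
        _ ≤ _ := this
    rw [h1, hrT]
    have h4 : 2 * h * (2 * P.RSq + 2 * P.Rm ^ 2 / n + 3 / 4 * T) =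
        4 * h * (P.RSq + P.Rm ^ 2 / n) + (h * T + 1 / 2 * (h * T)) := by ring
    rw [h4, add_mul]
    linarith

/-- `θ ≤ 1 - 1/B ≤ exp(-1/B)`. -/
lemma pow_le_of_log_le {θ B ε : ℝ} (hθ0 : 0 ≤ θ) (hB : 0 < B)
    (hθB : 1 / B ≤ 1 - θ) (hε : 0 < ε) {k : ℕ} (hk : B * Real.log (1 / ε) ≤ k) : θ ^ k ≤ ε := by
  have h1 : θ ≤ Real.exp (-(1 / B)) := by
    have := Real.add_one_le_exp (-(1 / B))
    linarith
  calc θ ^ k ≤ Real.exp (-(1 / B)) ^ k := pow_le_pow_left₀ hθ0 h1 k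
    _ = Real.exp (-(k / B)) := by rw [← Real.exp_nat_mul]; congr 1; ring
    _ ≤ Real.exp (Real.log ε) := by
        refine Real.exp_le_exp.2 ?_
        rw [one_div, Real.log_inv] at hk
        have : -Real.log ε ≤ k / B := by
          rw [le_div_iff₀ hB]
          linarith
        linarith
    _ = ε := Real.exp_log hε

lemma theta_pow_le (hr : 0 < r) (hδ : 0 < δ) (hδ1 : δ ≤ 1) (hδ₁ : 0 < δ₁) {B ε : ℝ} (hB0 : 0 < B)
    (hm : 0 < m) (hB : m + 4 * r * √(m / (lam * γ)) ≤ B) (hBδ : 6 / δ ≤ B) (hBδ₁ : 6 / δ₁ ≤ B)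
    (hε : 0 < ε) {k : ℕ} (hk : B * Real.log (1 / ε) ≤ k) : theta m γ lam δ δ₁ r ^ k ≤ ε := by
  have hm0 : (0 : ℝ) < m := by exact_mod_cast hm
  have hθ := one_sub_le_theta (m := m) (γ := γ) (lam := lam) (δ := δ) (δ₁ := δ₁) (r := r)
  refine pow_le_of_log_le (by linarith) hB0 ?_ hε hk
  rw [theta, sub_sub_cancel]
  refine le_min (one_div_le_one_div_of_le (by positivity) hB) (le_min ?_ ?_)
  · simpa using one_div_le_one_div_of_le (by positivity) hBδ
  · simpa using one_div_le_one_div_of_le (by positivity) hBδ₁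

lemma theta_pow_le_of_rate (hr : 0 < r) (hm : 0 < m) (hδ : 0 < δ) (hδ1 : δ ≤ 1) (hδ₁ : 0 < δ₁)
    {ε : ℝ} (hε : 0 < ε) {k : ℕ}
    (hk : 6 * ((1 / δ + 1 / δ₁ + m + r * √(m / (lam * γ))) * Real.log (1 / ε)) ≤ k) :
    theta m γ lam δ δ₁ r ^ k ≤ ε := by
  have hm0 : (0 : ℝ) < m := by exact_mod_cast hm
  have h1 : 0 < 1 / δ := by positivity
  have h2 : 0 < 1 / δ₁ := by positivity
  have h3 : 0 ≤ r * √(m / (lam * γ)) := by positivity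
  have e1 : 6 / δ = 6 * (1 / δ) := by ring
  have e2 : 6 / δ₁ = 6 * (1 / δ₁) := by ring
  rw [← mul_assoc] at hk
  exact theta_pow_le hr hδ hδ1 hδ₁ (by positivity) hm (by linarith) (by linarith) (by linarith) hε hk

/-- The assumption on `m` says `1/δ₁ ≤ cm`, so the `1/δ₁` part of the iteration count is absorbed by
`m`. -/
lemma theta_pow_le_of_rate_of_le (hr : 0 < r) (hm : 0 < m) (hδ : 0 < δ) (hδ1 : δ ≤ 1)
    (hδ₁ : 0 < δ₁) {c X : ℝ} (hc : 0 < c) (hX : 0 ≤ X) (hrX : r ≤ 22 * (1 + c) * X)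
    (hcm : 1 / (m : ℝ) ≤ c * δ₁) {ε : ℝ} (hε : 0 < ε) {k : ℕ}
    (hk : 100 * (1 + |c|) * ((X * √(m / (lam * γ)) + 1 / δ + m) * Real.log (1 / ε)) ≤ k) :
    theta m γ lam δ δ₁ r ^ k ≤ ε := by
  have hm0 : (0 : ℝ) < m := by exact_mod_cast hm
  set q := √(m / (lam * γ)) with hq
  have hq0 : 0 ≤ q := Real.sqrt_nonneg _
  rw [abs_of_pos hc, ← mul_assoc] at hk
  have h1 : 0 < 1 / δ := by positivity
  have hXq : 0 ≤ X * q := by positivity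
  have h2 : 1 / δ₁ ≤ c * m := by
    rw [div_le_iff₀ hm0] at hcm
    rw [div_le_iff₀ hδ₁]
    linarith
  have h3 : r * q ≤ 22 * (1 + c) * (X * q) := by
    calc _ ≤ 22 * (1 + c) * X * q := mul_le_mul_of_nonneg_right hrX hq0
      _ = _ := by ring
  have e1 : 6 / δ = 6 * (1 / δ) := by ring
  have e2 : 6 / δ₁ = 6 * (1 / δ₁) := by ring
  have hcX : 0 ≤ c * (X * q) := by positivity
  have hcd : 0 ≤ c * (1 / δ) := by positivity
  have hcm' : 0 ≤ c * m := by positivity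
  have e3 : 100 * (1 + c) * (X * q + 1 / δ + m) = 100 * (X * q) + 100 * (c * (X * q))
      + 100 * (1 / δ) + 100 * (c * (1 / δ)) + 100 * m + 100 * (c * m) := by ring
  have e4 : 22 * (1 + c) * (X * q) = 22 * (X * q) + 22 * (c * (X * q)) := by ring
  refine theta_pow_le hr hδ hδ1 hδ₁ (by positivity) hm ?_ ?_ ?_ hε hk <;> linarith

end Stepsizes

/-! ### Simplified constants when `1/m ≤ cδ₁`. -/

section Constants

variable {d t m n : ℕ} (P : Problem d t m n) {δ δ₁ c : ℝ}

lemma inv_mul_le_of_le (hm : 0 < m) (hδ₁ : 0 < δ₁) (hcm : 1 / (m : ℝ) ≤ c * δ₁) :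
    1 / (δ₁ * m) ≤ c := by
  have hm0 : (0 : ℝ) < m := by exact_mod_cast hm
  rw [div_le_iff₀ hm0] at hcm
  rw [div_le_iff₀ (by positivity)]
  linarith

lemma sum_sq_le_sq_sum {a b u v : ℝ} (ha : 0 ≤ a) (hb : 0 ≤ b) (hu : 0 ≤ u) (hv : 0 ≤ v) :
    a ^ 2 + b ^ 2 + u ^ 2 + v ^ 2 ≤ (a + b + u + v) ^ 2 := by
  have : 0 ≤ a * b + a * u + a * v + b * u + b * v + u * v := by positivity
  nlinarith

/-- As `1/(δ₁m) ≤ c`, the terms with `δ₁` are at most multiples of `(1 - δ)R̄²/δ²`; for the one with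
`R_m²` the bound `R_m² ≤ mR̄²` is also used. -/
lemma sqrt_R2Sq_le (hm : 0 < m) (hn : 0 < n) (hδ : 0 < δ) (hδ1 : δ ≤ 1) (hδ₁ : 0 < δ₁)
    (hc : 0 < c) (hcm : 1 / (m : ℝ) ≤ c * δ₁) :
    √(P.R2Sq δ δ₁) ≤ 22 * (1 + c) *
      (√P.RSq + P.Rm / √n + √(1 - δ) * √P.RbarSq / δ + √(1 - δ) * P.Rm / √δ) := by
  have hm0 : (0 : ℝ) < m := by exact_mod_cast hm
  have hn0 : (0 : ℝ) < n := by exact_mod_cast hn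
  have h1 : 0 ≤ 1 - δ := by linarith
  have hR := P.RSq_nonneg
  have hRb := P.RbarSq_nonneg
  have hRm := P.Rm_nonneg
  have hRmb := P.Rm_sq_le hm hn
  have hcδ := inv_mul_le_of_le hm hδ₁ hcm
  refine Real.sqrt_le_iff.2 ⟨by positivity, ?_⟩
  have hX := sum_sq_le_sq_sum (a := √P.RSq) (b := P.Rm / √n) (u := √(1 - δ) * √P.RbarSq / δ)
    (v := √(1 - δ) * P.Rm / √δ) (by positivity) (by positivity) (by positivity) (by positivity)
  rw [mul_pow]
  refine le_trans ?_ (mul_le_mul_of_nonneg_left hX (by positivity))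
  rw [div_pow, div_pow, div_pow, mul_pow (√(1 - δ)), mul_pow (√(1 - δ)), Real.sq_sqrt hR, Real.sq_sqrt hRb,
    Real.sq_sqrt h1, Real.sq_sqrt hn0.le, Real.sq_sqrt hδ.le]
  set U := (1 - δ) * P.RbarSq / δ ^ 2 with hU
  set W := (1 - δ) * P.Rm ^ 2 / δ with hW
  have hU0 : 0 ≤ U := by positivity
  have hW0 : 0 ≤ W := by positivity
  have e : P.R2Sq δ δ₁ = 2 * P.RSq + 2 * (P.Rm ^ 2 / n) + 3 / 4 * (14 * U + 7 / 2 * W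
      + 84 * ((1 - δ₁) * ((1 / (δ₁ * m)) ^ 2 * U))
      + 42 * ((1 - δ) / δ ^ 2 * (1 / (δ₁ * m)) * (P.Rm ^ 2 / m))) := by
    rw [Problem.R2Sq, hU, hW]
    field_simp
  have h2 : (1 - δ₁) * ((1 / (δ₁ * m)) ^ 2 * U) ≤ c ^ 2 * U := by
    have h3 : (1 / (δ₁ * m)) ^ 2 * U ≤ c ^ 2 * U := by gcongr
    have h4 : (1 - δ₁) * ((1 / (δ₁ * m)) ^ 2 * U) ≤ (1 / (δ₁ * m)) ^ 2 * U :=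
      mul_le_of_le_one_left (by positivity) (by linarith)
    linarith
  have h3 : (1 - δ) / δ ^ 2 * (1 / (δ₁ * m)) * (P.Rm ^ 2 / m) ≤ c * U := by
    have h4 : P.Rm ^ 2 / m ≤ P.RbarSq := by
      rw [div_le_iff₀ hm0]
      linarith
    calc _ ≤ (1 - δ) / δ ^ 2 * c * P.RbarSq := by gcongr
      _ = _ := by rw [hU]; ring
  have hRn : 0 ≤ P.Rm ^ 2 / n := by positivity
  have e2 : (22 * (1 + c)) ^ 2 * (P.RSq + P.Rm ^ 2 / n + U + W) =
      484 * (P.RSq + P.Rm ^ 2 / n + U + W) + 968 * (c * (P.RSq + P.Rm ^ 2 / n + W)) + 968 * (c * U)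
        + 484 * (c ^ 2 * U) + 484 * (c ^ 2 * (P.RSq + P.Rm ^ 2 / n + W)) := by ring
  have h5 : 0 ≤ c * (P.RSq + P.Rm ^ 2 / n + W) := by positivity
  have h6 : 0 ≤ c ^ 2 * (P.RSq + P.Rm ^ 2 / n + W) := by positivity
  have h7 : 0 ≤ c * U := by positivity
  have h8 : 0 ≤ c ^ 2 * U := by positivity
  rw [e, e2]
  linarith

/-- Here the nodewise constants come divided by `n`, and `R̄²/n ≤ R²` reduces the critical terms to
`(1 - δ)R²/δ²`. -/
lemma sqrt_R3Sq_le (hm : 0 < m) (hn : 0 < n) (hδ : 0 < δ) (hδ1 : δ ≤ 1) (hδ₁ : 0 < δ₁)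
    (hc : 0 < c) (hcm : 1 / (m : ℝ) ≤ c * δ₁) :
    √(P.R3Sq δ δ₁) ≤ 22 * (1 + c) *
      (√P.RSq + P.Rm / √n + √(1 - δ) * √P.RSq / δ + √(1 - δ) * P.Rm / √(δ * n)) := by
  have hm0 : (0 : ℝ) < m := by exact_mod_cast hm
  have hn0 : (0 : ℝ) < n := by exact_mod_cast hn
  have h1 : 0 ≤ 1 - δ := by linarith
  have hR := P.RSq_nonneg
  have hRb := P.RbarSq_nonneg
  have hRm := P.Rm_nonneg
  have hRmb := P.Rm_sq_le hm hn
  have hcδ := inv_mul_le_of_le hm hδ₁ hcm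
  have hRbn : P.RbarSq / n ≤ P.RSq := by
    rw [div_le_iff₀ hn0, mul_comm]
    exact P.RbarSq_le hm hn
  refine Real.sqrt_le_iff.2 ⟨by positivity, ?_⟩
  have hX := sum_sq_le_sq_sum (a := √P.RSq) (b := P.Rm / √n) (u := √(1 - δ) * √P.RSq / δ)
    (v := √(1 - δ) * P.Rm / √(δ * n)) (by positivity) (by positivity) (by positivity)
    (by positivity)
  rw [mul_pow]
  refine le_trans ?_ (mul_le_mul_of_nonneg_left hX (by positivity))
  rw [div_pow, div_pow, div_pow, mul_pow (√(1 - δ)), mul_pow (√(1 - δ)), Real.sq_sqrt hR,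
    Real.sq_sqrt h1, Real.sq_sqrt hn0.le, Real.sq_sqrt (by positivity : 0 ≤ δ * n)]
  set U := (1 - δ) * P.RSq / δ ^ 2 with hU
  set W := (1 - δ) * P.Rm ^ 2 / (δ * n) with hW
  have hU0 : 0 ≤ U := by positivity
  have hW0 : 0 ≤ W := by positivity
  have e : P.R3Sq δ δ₁ = 2 * P.RSq + 2 * (P.Rm ^ 2 / n) + 21 / 4 * (2 * U + 11 / 2 * W
      + 12 * ((1 - δ) * ((1 - δ) / δ ^ 2 * (P.RbarSq / n)))
      + 12 / 5 * ((1 / (δ₁ * m)) ^ 2 * U)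
      + 228 / 5 * ((1 - δ) / δ ^ 2 * (1 / (δ₁ * m)) * (P.Rm ^ 2 / m / n))
      + 432 / 5 * ((1 - δ₁) * ((1 - δ) / δ ^ 2 * (1 / (δ₁ * m)) ^ 2 * (P.RbarSq / n)))) := by
    rw [Problem.R3Sq, hU, hW]
    field_simp
  have h2 : (1 / (δ₁ * m)) ^ 2 * U ≤ c ^ 2 * U := by gcongr
  have h3 : (1 - δ) * ((1 - δ) / δ ^ 2 * (P.RbarSq / n)) ≤ U := by
    have h4 : (1 - δ) * ((1 - δ) / δ ^ 2 * (P.RbarSq / n)) ≤ (1 - δ) / δ ^ 2 * (P.RbarSq / n) :=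
      mul_le_of_le_one_left (by positivity) (by linarith)
    calc _ ≤ _ := h4
      _ ≤ (1 - δ) / δ ^ 2 * P.RSq := by gcongr
      _ = _ := by rw [hU]; ring
  have h4 : (1 - δ) / δ ^ 2 * (1 / (δ₁ * m)) * (P.Rm ^ 2 / m / n) ≤ c * U := by
    have h5 : P.Rm ^ 2 / m / n ≤ P.RSq := by
      refine le_trans ?_ hRbn
      gcongr
      rw [div_le_iff₀ hm0]
      linarith
    calc _ ≤ (1 - δ) / δ ^ 2 * c * P.RSq := by gcongr
      _ = _ := by rw [hU]; ring
  have h4' : (1 - δ₁) * ((1 - δ) / δ ^ 2 * (1 / (δ₁ * m)) ^ 2 * (P.RbarSq / n)) ≤ c ^ 2 * U := by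
    have h5 := mul_le_of_le_one_left
      (by positivity : 0 ≤ (1 - δ) / δ ^ 2 * (1 / (δ₁ * m)) ^ 2 * (P.RbarSq / n))
      (by linarith : 1 - δ₁ ≤ 1)
    calc _ ≤ _ := h5
      _ ≤ (1 - δ) / δ ^ 2 * c ^ 2 * P.RSq := by gcongr
      _ = _ := by rw [hU]; ring
  have hRn : 0 ≤ P.Rm ^ 2 / n := by positivity
  -- The value `22` is dictated by the `c²` terms, with total coefficient `(21/4)(12/5 + 432/5) =
  -- 466.2 ≤ 22² = 484`.
  have e2 : (22 * (1 + c)) ^ 2 * (P.RSq + P.Rm ^ 2 / n + U + W) =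
      484 * (P.RSq + P.Rm ^ 2 / n + U + W) + 968 * (c * (P.RSq + P.Rm ^ 2 / n + W)) + 968 * (c * U)
        + 484 * (c ^ 2 * U) + 484 * (c ^ 2 * (P.RSq + P.Rm ^ 2 / n + W)) := by ring
  have h5 : 0 ≤ c * (P.RSq + P.Rm ^ 2 / n + W) := by positivity
  have h6 : 0 ≤ c ^ 2 * (P.RSq + P.Rm ^ 2 / n + W) := by positivity
  have h7 : 0 ≤ c * U := by positivity
  have h8 : 0 ≤ c ^ 2 * U := by positivity
  rw [e, e2]
  linarith

end Constants

end ECSPDC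

end

/-! ### The convergence theorem. -/

theorem mainTheorem1 :
    ∃ (C : ℝ) (K : ℝ → ℝ), 0 < C ∧ (∀ c : ℝ, 0 < K c) ∧
    ∀ (d t m n : ℕ), 0 < m → 0 < n →
    ∀ (P : Problem d t m n) (γ lam δ δ₁ : ℝ), 0 < γ → 0 < lam → P.Regular γ lam →
    ∀ (S : Type*) [MeasurableSpace S] (ν : Measure S) [IsProbabilityMeasure ν]
      (Q Q₁ : S → Vec d → Vec d),
      IsContractionCompressor ν Q δ → IsContractionCompressor ν Q₁ δ₁ →
    ∀ (Ω : Type*) [MeasurableSpace Ω] (μ : Measure Ω) [IsProbabilityMeasure μ]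
      (ι : ℕ → Fin n → Ω → Fin m) (ξ : ℕ → Fin n → Ω → S), IsSampling μ ν ι ξ →
    ∀ (xs : Vec d) (Ys : Fin m → Fin n → Vec t), P.IsSaddlePoint xs Ys →
    ∀ (x0 : Vec d) (y0 : Fin m → Fin n → Vec t) (h0 : Fin n → Vec d),
      -- Part (i)
      (∀ r σ η θ : ℝ, r = √(P.R2Sq δ δ₁) → σ = sigma m γ lam r → η = eta m γ lam r →
        θ = theta m γ lam δ δ₁ r → 1 ≤ P.R2Sq δ δ₁ / (lam * γ) →
        ∀ s : ℕ → Ω → State d t m n, P.IsRun Q Q₁ σ η θ ι ξ (P.init x0 y0 h0) s →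
          (∀ k : ℕ, Measurable fun ω => P.Phi2 γ lam δ δ₁ σ η xs Ys (s k ω)) ∧
          (∀ ε : ℝ, 0 < ε → ∀ k : ℕ,
            C * ((1 / δ + 1 / δ₁ + m + r * √(m / (lam * γ))) * Real.log (1 / ε)) ≤ k →
            expect μ (fun ω => P.Phi2 γ lam δ δ₁ σ η xs Ys (s k ω)) ≤
              (ε : EReal) * (P.Phi2 γ lam δ δ₁ σ η xs Ys (P.init x0 y0 h0)
                + ((1 / (4 * σ * n) * Problem.dualDist Ys (P.init x0 y0 h0) : ℝ) : EReal))) ∧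
          (∀ c : ℝ, 0 < c → 1 / (m : ℝ) ≤ c * δ₁ → ∀ ε : ℝ, 0 < ε → ∀ k : ℕ,
            K c * (((√P.RSq + P.Rm / √n + √(1 - δ) * √P.RbarSq / δ + √(1 - δ) * P.Rm / √δ)
                * √(m / (lam * γ)) + 1 / δ + m) * Real.log (1 / ε)) ≤ k →
            expect μ (fun ω => P.Phi2 γ lam δ δ₁ σ η xs Ys (s k ω)) ≤
              (ε : EReal) * (P.Phi2 γ lam δ δ₁ σ η xs Ys (P.init x0 y0 h0)
                + ((1 / (4 * σ * n) * Problem.dualDist Ys (P.init x0 y0 h0) : ℝ) : EReal)))) ∧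
      -- Part (ii)
      (ScalesInMean ν Q δ → ScalesInMean ν Q₁ δ₁ →
        ∀ r σ η θ : ℝ, r = √(P.R3Sq δ δ₁) → σ = sigma m γ lam r → η = eta m γ lam r →
        θ = theta m γ lam δ δ₁ r → 1 ≤ P.R3Sq δ δ₁ / (lam * γ) →
        ∀ s : ℕ → Ω → State d t m n, P.IsRun Q Q₁ σ η θ ι ξ (P.init x0 y0 h0) s →
          (∀ k : ℕ, Measurable fun ω => P.Psi2 γ lam δ δ₁ σ η xs Ys (s k ω)) ∧
          (∀ ε : ℝ, 0 < ε → ∀ k : ℕ,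
            C * ((1 / δ + 1 / δ₁ + m + r * √(m / (lam * γ))) * Real.log (1 / ε)) ≤ k →
            expect μ (fun ω => P.Psi2 γ lam δ δ₁ σ η xs Ys (s k ω)) ≤
              (ε : EReal) * (P.Psi2 γ lam δ δ₁ σ η xs Ys (P.init x0 y0 h0)
                + ((1 / (4 * σ * n) * Problem.dualDist Ys (P.init x0 y0 h0) : ℝ) : EReal))) ∧
          (∀ c : ℝ, 0 < c → 1 / (m : ℝ) ≤ c * δ₁ → ∀ ε : ℝ, 0 < ε → ∀ k : ℕ,
            K c * (((√P.RSq + P.Rm / √n + √(1 - δ) * √P.RSq / δ + √(1 - δ) * P.Rm / √(δ * n))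
                * √(m / (lam * γ)) + 1 / δ + m) * Real.log (1 / ε)) ≤ k →
            expect μ (fun ω => P.Psi2 γ lam δ δ₁ σ η xs Ys (s k ω)) ≤
              (ε : EReal) * (P.Psi2 γ lam δ δ₁ σ η xs Ys (P.init x0 y0 h0)
                + ((1 / (4 * σ * n) * Problem.dualDist Ys (P.init x0 y0 h0) : ℝ) : EReal)))) := by
  -- The `6` reflects `δ/6` and `δ₁/6` in `θ`; the absolute value only keeps the second constant
  -- positive for negative `c`.
  refine ⟨6, fun c => 100 * (1 + |c|), by norm_num, fun c => by positivity, ?_⟩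
  intro d t m n hm hn P γ lam δ δ₁ hγ hlam hP S _ ν _ Q Q₁ hQ hQ₁ Ω _ μ _ ι ξ hsamp xs Ys hsad
    x0 y0 h0
  have hδ := hQ.pos
  have hδ1 := hQ.le_one
  have hδ₁ := hQ₁.pos
  have hδ₁1 := hQ₁.le_one
  have hR := P.RSq_nonneg
  have hRb := P.RbarSq_nonneg
  have hRm := P.Rm_nonneg
  have hYs := hsad.dualFinite hP
  have hlg : 0 < lam * γ := mul_pos hlam hγ
  refine ⟨?_, ?_⟩
  · intro r σ η θ hr hσ hη hθ h1 s hs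
    rw [one_le_div hlg] at h1
    have hr0 : 0 < r := hr ▸ Real.sqrt_pos.2 (hlg.trans_le h1)
    have hr2 : r ^ 2 = P.R2Sq δ δ₁ := hr ▸ Real.sq_sqrt (hlg.le.trans h1)
    have hb := stepBounds (P := P) hm hγ hlam hδ hδ1 hδ₁ (compSq_nonneg P hδ hδ1 hδ₁ hδ₁1) hr0
      (hr2.trans (R2Sq_eq P δ δ₁)) (hr2 ▸ h1)
    rw [← hσ, ← hη, ← hθ] at hb
    have hmain : ∀ ε : ℝ, 0 < ε → ∀ k : ℕ, θ ^ k ≤ ε →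
        expect μ (fun ω => P.Phi2 γ lam δ δ₁ σ η xs Ys (s k ω)) ≤
          (ε : EReal) * (P.Phi2 γ lam δ δ₁ σ η xs Ys (P.init x0 y0 h0)
            + ((1 / (4 * σ * n) * Problem.dualDist Ys (P.init x0 y0 h0) : ℝ) : EReal)) := by
      intro ε hε k hk
      simp only [Problem.Phi2_eq_potential]
      exact Problem.expect_potential_le hm hn hP hγ hlam hb hQ.measurable hQ₁.measurable hsamp hsad
        Problem.measurable_errPotential (Problem.errPotential_nonneg hlam hb.η_pos hδ hδ1 hδ₁)
        (Problem.errPotential_drift hm hn hQ hQ₁ hlam hb.η_pos (hθ ▸ one_sub_le_theta)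
          (hθ ▸ one_sub_le_theta')) hs hε hk
    refine ⟨fun k => ?_, fun ε hε k hk => hmain ε hε k ?_, fun c hc hcm ε hε k hk => hmain ε hε k ?_⟩
    · simp only [Problem.Phi2_eq_potential]
      exact (Problem.measurable_potential hm hP hlam xs hYs Problem.measurable_errPotential).comp
        (hs.measurable hP hγ hlam hb.σ_pos hb.η_pos hQ.measurable hQ₁.measurable hsamp k)
    · rw [hθ]
      exact theta_pow_le_of_rate hr0 hm hδ hδ1 hδ₁ hε hk
    · rw [hθ]
      exact theta_pow_le_of_rate_of_le hr0 hm hδ hδ1 hδ₁ hc (by positivity)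
        (hr ▸ sqrt_R2Sq_le P hm hn hδ hδ1 hδ₁ hc hcm) hcm hε hk
  · intro hmean hmean₁ r σ η θ hr hσ hη hθ h1 s hs
    rw [one_le_div hlg] at h1
    have hr0 : 0 < r := hr ▸ Real.sqrt_pos.2 (hlg.trans_le h1)
    have hr2 : r ^ 2 = P.R3Sq δ δ₁ := hr ▸ Real.sq_sqrt (hlg.le.trans h1)
    have hb := stepBounds (P := P) hm hγ hlam hδ hδ1 hδ₁ (compSqMean_nonneg P hδ hδ1 hδ₁ hδ₁1) hr0
      (hr2.trans (R3Sq_eq P δ δ₁)) (hr2 ▸ h1)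
    rw [← hσ, ← hη, ← hθ] at hb
    have hmain : ∀ ε : ℝ, 0 < ε → ∀ k : ℕ, θ ^ k ≤ ε →
        expect μ (fun ω => P.Psi2 γ lam δ δ₁ σ η xs Ys (s k ω)) ≤
          (ε : EReal) * (P.Psi2 γ lam δ δ₁ σ η xs Ys (P.init x0 y0 h0)
            + ((1 / (4 * σ * n) * Problem.dualDist Ys (P.init x0 y0 h0) : ℝ) : EReal)) := by
      intro ε hε k hk
      simp only [Problem.Psi2_eq_potential]
      exact Problem.expect_potential_le hm hn hP hγ hlam hb hQ.measurable hQ₁.measurable hsamp hsad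
        Problem.measurable_errPotentialMean (Problem.errPotentialMean_nonneg hlam hb.η_pos hδ hδ1 hδ₁)
        (Problem.errPotentialMean_drift hm hn hQ hQ₁ hmean hmean₁ hlam hb.η_pos (hθ ▸ one_sub_le_theta)
          (hθ ▸ one_sub_le_theta')) hs hε hk
    refine ⟨fun k => ?_, fun ε hε k hk => hmain ε hε k ?_, fun c hc hcm ε hε k hk => hmain ε hε k ?_⟩
    · simp only [Problem.Psi2_eq_potential]
      exact (Problem.measurable_potential hm hP hlam xs hYs Problem.measurable_errPotentialMean).comp
        (hs.measurable hP hγ hlam hb.σ_pos hb.η_pos hQ.measurable hQ₁.measurable hsamp k)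
    · rw [hθ]
      exact theta_pow_le_of_rate hr0 hm hδ hδ1 hδ₁ hε hk
    · rw [hθ]
      exact theta_pow_le_of_rate_of_le hr0 hm hδ hδ1 hδ₁ hc (by positivity)
        (hr ▸ sqrt_R3Sq_le P hm hn hδ hδ1 hδ₁ hc hcm) hcm hε hk
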